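/- **Setting.** Let $(\mathcal S',\rho')$ be a separable metric space. For each $n\ge 1$ let the vertices $1,\dots,n$ carry random attributes $\mathbf a_1,\dots,\mathbf a_n$, put $\mathscr F_n=\sigma(\mathbf a_1,\dots,\mathbf a_n)$, $\mathbb P_n=P(\cdot\mid\mathscr F_n)$ and $\nu_n=\frac1n\sum_{i=1}^n\delta_{\mathbf a_i}$, and let $W_1$ be the Wasserstein distance of order one for the metric $|x_1-y_1|+\rho'(x_2,y_2)$. Let $G_n$ be a random graph on $\{1,\dots,n\}$ and let $I$ be a uniform vertex, independent of $G_n$ given $\mathscr F_n$. Assume one of the following. * (CM) $\mathbf a_i=(D_i,\mathbf b_i)\in\mathbb N\times\mathcal S'$, $L_n=\sum_i D_i$ is even, and given $\mathscr F_n$ the multigraph $G_n$ is a configuration model: vertex $i$ has $D_i$ stubs, the stubs are paired one at a time (in any order), each with a uniformly chosen stub among the other unpaired ones, and each pair is an edge. There is a probability measure $\nu$ with $W_1(\nu_n,\nu)\xrightarrow{P}0$ and $E[\mathscr D+\rho'(\boldsymbol B,\mathbf b_0)]<\infty$ for some $\mathbf b_0\in\mathcal S'$, where $(\mathscr D,\boldsymbol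 B)\sim\nu$. * (IR) $\mathbf a_i=(W_i,\mathbf b_i)\in[0,\infty)\times\mathcal S'$, and given $\mathscr F_n$ the edges $\{i,j\}$, $i<j$, of the simple graph $G_n$ are present independently with probabilities $p_{ij}=1\wedge\frac{W_iW_j}{\theta n}(1+\varphi_n(W_i,W_j))$, where $\varphi_n(W_i,W_j)>-1$ a.s. may also depend on $(W_1,\dots,W_n)$, and $\frac1n\sum_iW_i\xrightarrow{P}\theta\in(0,\infty)$. There is a probability measure $\nu$ with $W_1(\nu_n,\nu)\xrightarrow{P}0$ and $E[W+\rho'(\boldsymbol B,\mathbf b_0)]<\infty$ for some $\mathbf b_0\in\mathcal S'$, where $(W,\boldsymbol B)\sim\nu$; moreover $\frac1n\sum_i\sum_{j\ne i}\left|p_{ij}-\left(\frac{W_iW_j}{\theta n}\wedge1\right)\right|\xrightarrow{P}0$. Further, $b_n\ge0$ are $\mathscr F_n$-measurable with $b_n\xrightarrow{P}\infty$ and $b_n/\sqrt n\xrightarrow{P}0$; put $\bar W_i=W_i\wedge b_n$ and $\Lambda_n=\sum_i\bar W_i$. Let $\mathcal G_I^{(k)}(\mathbf a)$ be the subgraph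 of $G_n$ on the vertices at hop distance at most $k$ from $I$, with all their (multiple) edges and self-loops, rooted at $I$, where vertex $i$ is marked with its degree in $G_n$ and its attribute $\mathbf a_i$. **Theorem.** On an extension of the probability space of $(\mathbf a_1,\dots,\mathbf a_n,G_n,I)$, for each $n$, there are random vectors $(\hat N_{\mathbf i},\mathbf{\hat A}_{\mathbf i})$, indexed by the finite sequences $\mathbf i$ of positive integers, that are conditionally independent given $\mathscr F_n$, with $\mathbf{\hat A}_\emptyset=\mathbf a_I$ a.s., and with the following laws given $\mathscr F_n$: * in the CM, $(\hat N_\emptyset,\mathbf{\hat A}_\emptyset)$ is $(D_i,\mathbf a_i)$ with probability $1/n$, and for $\mathbf i\neq\emptyset$, $(\hat N_{\mathbf i}+1,\mathbf{\hat A}_{\mathbf i})$ is $(D_i,\mathbf a_i)$ with probability $D_i/L_n$, $1\le i\le n$; * in the IR, $\mathbf{\hat A}_\emptyset=\mathbf a_i$ with probability $1/n$, and for $\mathbf i\ne\emptyset$, $\mathbf{\hat A}_{\mathbf i}=\mathbf a_i$ with probability $\bar W_i/\Lambda_n$, $1\le i\le n$, and in both cases, given that index $i$ was drawn, the offspring number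 is Poisson with mean $\Lambda_n\bar W_i/(\theta n)$ (if $L_n=0$, respectively $\Lambda_n=0$, the root has no offspring and the index $i$ for $\mathbf i\ne\emptyset$ is by convention uniform, with $\hat N_{\mathbf i}=0$). Let $\hat T^{(k)}(\mathbf{\hat A})$ be the first $k$ generations of the tree in which node $\mathbf i$ has the children $(\mathbf i,1),\dots,(\mathbf i,\hat N_{\mathbf i})$, where the root $\emptyset$ is marked with $(\hat N_\emptyset,\mathbf{\hat A}_\emptyset)$ and every other node with $(\hat N_{\mathbf i}+1,\mathbf{\hat A}_{\mathbf i})$. Then for every fixed $k\ge1$, $$\mathbb P_n\left(\mathcal G_I^{(k)}(\mathbf a)\not\simeq\hat T^{(k)}(\mathbf{\hat A})\right)\xrightarrow{P}0,\qquad n\to\infty,$$ where $\simeq$ means that there is a bijection of the vertices that preserves edge multiplicities, self-loops and marks and maps $I$ to $\emptyset$. -/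

import Mathlib

open MeasureTheory ProbabilityTheory Filter Topology
open scoped ENNReal NNReal

namespace GraphCoupling

/-! ### Convergence in probability, empirical measures, Wasserstein distance -/

/-- `X n` (a random variable on the probability space `(Ω n, P n)`) converges in probability along
the filter `l`.  For `l = 𝓝 c` this is convergence in probability to the constant `c`, and
for `l = atTop` it is convergence in probability to infinity. -/
def TendstoInProb {Ω : ℕ+ → Type*} [∀ n, MeasurableSpace (Ω n)] {E : Type*}
    (P : ∀ n, Measure (Ω n)) (X : ∀ n, Ω n → E) (l : Filter E) : Prop :=
  ∀ U ∈ l, Tendsto (fun n => P n {ω | X n ω ∉ U}) atTop (𝓝 0)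

/-- The empirical measure `n⁻¹ ∑ᵢ δ_{aᵢ}`. -/
noncomputable def empirical {A : Type*} [MeasurableSpace A] {n : ℕ} (a : Fin n → A) : Measure A :=
  (n : ℝ≥0∞)⁻¹ • ∑ i, Measure.dirac (a i)

/-- The Wasserstein distance of order one on `R × S` for the metric
`|x₁ - y₁| + ρ'(x₂, y₂)`: the infimum of the transport cost over all couplings. -/
noncomputable def W1 {R S : Type*} [PseudoEMetricSpace R] [MeasurableSpace R]
    [PseudoEMetricSpace S] [MeasurableSpace S] (μ ν : Measure (R × S)) : ℝ≥0∞ :=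
  ⨅ (γ : Measure ((R × S) × (R × S))) (_ : γ.map Prod.fst = μ ∧ γ.map Prod.snd = ν),
    ∫⁻ p, (edist p.1.1 p.2.1 + edist p.1.2 p.2.2) ∂γ

/-- The σ-algebra `𝓕ₙ = σ(a₁, …, aₙ)` generated by the attributes. -/
@[reducible] def attrSigma {Ω A : Type*} [MeasurableSpace A] {n : ℕ} (a : Ω → Fin n → A) : MeasurableSpace Ω :=
  MeasurableSpace.comap a inferInstance

/-! ### Multigraphs, neighbourhoods, isomorphism of marked graphs -/

/-- A rooted vertex-weighted multigraph on the vertex set `V` with marks in `M`: `e i j` is the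
number of edges between `i` and `j`, and `e i i` is the number of self-loops of `i`. -/
structure MarkedGraph (V M : Type*) where
  e : V → V → ℕ
  mark : V → M
  root : V

/-- Isomorphism of rooted vertex-weighted multigraphs: a bijection of the vertices that preserves
edge multiplicities, self-loops and marks, and maps the root to the root. -/
def MarkedGraph.Iso {V V' M : Type*} (G : MarkedGraph V M) (H : MarkedGraph V' M) : Prop :=
  ∃ σ : V ≃ V', σ G.root = H.root ∧ (∀ i, H.mark (σ i) = G.mark i) ∧
    ∀ i j, H.e (σ i) (σ j) = G.e i j

/-- The edge multiplicities of a simple graph. -/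
noncomputable def simpleMult {V : Type*} (H : SimpleGraph V) : V → V → ℕ :=
  open Classical in fun i j => if H.Adj i j then 1 else 0

/-- The degree of a vertex in a multigraph; a self-loop counts twice. -/
def degree {n : ℕ} (e : Fin n → Fin n → ℕ) (i : Fin n) : ℕ :=
  ∑ j, e i j + e i i

/-- Hop distance in a multigraph (`⊤` for vertices in different components). -/
noncomputable def hopDist {V : Type*} (e : V → V → ℕ) (i j : V) : ℕ∞ :=
  (SimpleGraph.fromRel fun u v => e u v ≠ 0).edist i j

/-- The depth-`k` neighbourhood of the vertex `v`: the subgraph consisting of all the vertices at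
hop distance at most `k` from `v` together with their (multiple) edges and self-loops.  Each vertex
`i` carries its full mark `(Dᵢ, aᵢ)`, where `Dᵢ` is its degree in the whole graph. -/
def nbhd {n : ℕ} {A : Type*} (k : ℕ) (e : Fin n → Fin n → ℕ) (a : Fin n → A) (v : Fin n) :
    MarkedGraph {i : Fin n // hopDist e v i ≤ k} (ℕ × A) where
  e i j := e i j
  mark i := (degree e i, a i)
  root := ⟨v, by simp [hopDist]⟩

/-! ### Marked trees -/

/-- A realization of `{(N_𝐢, A_𝐢) : 𝐢 ∈ 𝓤}`: `N_𝐢` is the number of offspring and `A_𝐢` the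
attribute of the label `𝐢`.  Labels are finite lists; the empty list is the root, and the children
of `𝐢` are `r :: 𝐢` with `r < N_𝐢` (the last coordinate of the label is the head of the list). -/
abbrev TreeData (A : Type*) := List ℕ → ℕ × A

/-- The labels that are nodes of the tree. -/
def IsNode {A : Type*} (t : TreeData A) : List ℕ → Prop
  | [] => True
  | r :: i => IsNode t i ∧ r < (t i).1

/-- The full mark of a node: `(N_∅, A_∅)` for the root, `(N_𝐢 + 1, A_𝐢)` for the other nodes. -/
def nodeMark {A : Type*} (t : TreeData A) : List ℕ → ℕ × A
  | [] => t []
  | r :: i => ((t (r :: i)).1 + 1, (t (r :: i)).2)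

/-- The marked tree restricted to its first `k` generations. -/
noncomputable def treeGraph {A : Type*} (k : ℕ) (t : TreeData A) :
    MarkedGraph {i : List ℕ // IsNode t i ∧ i.length ≤ k} (ℕ × A) where
  e i j := open Classical in if ∃ r : ℕ, i.1 = r :: j.1 ∨ j.1 = r :: i.1 then 1 else 0
  mark i := nodeMark t i
  root := ⟨[], by simp [IsNode]⟩

/-! ### The configuration model -/

/-- The stubs: vertex `i` has `d i` of them. -/
abbrev Stub {n : ℕ} (d : Fin n → ℕ) := Σ i : Fin n, Fin (d i)

/-- The stubs that are still unpaired, given the list of the pairs made so far. -/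
def unpaired {n : ℕ} {d : Fin n → ℕ} (h : List (Stub d × Stub d)) : Finset (Stub d) :=
  Finset.univ.filter fun s => ∀ p ∈ h, s ≠ p.1 ∧ s ≠ p.2

/-- A rule that picks the next stub to pair, given the pairs made so far. -/
abbrev PickRule {n : ℕ} (d : Fin n → ℕ) :=
  ∀ h : List (Stub d × Stub d), (unpaired h).Nonempty → {s : Stub d // s ∈ unpaired h}

/-- Pairing stub by stub: pick an unpaired stub according to the rule, pair it with a uniformly
chosen one of the remaining unpaired stubs, and continue (at most `m` more times). -/
noncomputable def pairStubs {n : ℕ} {d : Fin n → ℕ} (pick : PickRule d) :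
    ℕ → List (Stub d × Stub d) → PMF (List (Stub d × Stub d))
  | 0, h => PMF.pure h
  | m + 1, h =>
    if h₁ : (unpaired h).Nonempty then
      if h₂ : ((unpaired h).erase (pick h h₁).1).Nonempty then
        (PMF.uniformOfFinset _ h₂).bind fun s => pairStubs pick m (((pick h h₁).1, s) :: h)
      else PMF.pure h
    else PMF.pure h

/-- The multigraph of a list of pairs of stubs: one edge for each pair. -/
def pairGraph {n : ℕ} {d : Fin n → ℕ} (h : List (Stub d × Stub d)) : Fin n → Fin n → ℕ :=
  fun i j => (h.map fun p => s(p.1.1, p.2.1)).count s(i, j)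

/-- The law of the configuration model with degree sequence `d`. -/
noncomputable def cmLaw {n : ℕ} {d : Fin n → ℕ} (pick : PickRule d) :
    PMF (Fin n → Fin n → ℕ) :=
  (pairStubs pick ((∑ i, d i) / 2) []).map pairGraph

/-- On the probability space `(Ω, P)` we are given random attributes `aᵢ = (Dᵢ, bᵢ)` of `n`
vertices with `∑ Dᵢ` even, a random multigraph `G` and a random vertex `I`, such that,
conditionally on the attributes, `G` is a configuration model with degrees `Dᵢ` and `I` is uniform
and independent of `G`. -/
structure IsCM {Ω S : Type*} [MeasurableSpace Ω] [MeasurableSpace S] {n : ℕ} (P : Measure Ω)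
    (pick : ∀ d : Fin n → ℕ, PickRule d) (a : Ω → Fin n → ℕ × S)
    (G : Ω → Fin n → Fin n → ℕ) (I : Ω → Fin n) : Prop where
  measurable_a : Measurable a
  measurable_G : Measurable G
  measurable_I : Measurable I
  even : ∀ᵐ ω ∂P, Even (∑ i, (a ω i).1)
  law : ∀ (v : Fin n) (M : Fin n → Fin n → ℕ),
    P⟦{ω | I ω = v ∧ G ω = M} | attrSigma a⟧ =ᵐ[P]
      fun ω => (n : ℝ)⁻¹ * (cmLaw (pick fun i => (a ω i).1) M).toReal

/-- The standing assumption in the configuration model: `W₁(νₙ, ν) → 0` in probability and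
`E[𝒟 + ρ'(B, b₀)] < ∞` for some `b₀`, where `(𝒟, B) ∼ ν`. -/
structure AssumptionCM {Ω : ℕ+ → Type*} {S : Type*} [∀ n, MeasurableSpace (Ω n)] [MetricSpace S]
    [MeasurableSpace S] (P : ∀ n, Measure (Ω n)) (a : ∀ n, Ω n → Fin (n : ℕ) → ℕ × S)
    (ν : Measure (ℕ × S)) : Prop where
  wasserstein : TendstoInProb P (fun n ω => W1 (empirical (a n ω)) ν) (𝓝 0)
  moment : ∃ b₀ : S, ∫⁻ x, ((x.1 : ℝ≥0∞) + edist x.2 b₀) ∂ν < ∞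

/-! ### The inhomogeneous random graph -/

/-- The edge probability `p_{ij}` (symmetric in `i`, `j`, and zero for `i = j`) for the weights `w`,
where `φ` is the function `φₙ(wᵢ, wⱼ, w)`. -/
noncomputable def edgeProb {n : ℕ} (θ : ℝ≥0) (φ : ℝ≥0 → ℝ≥0 → (Fin n → ℝ≥0) → ℝ)
    (w : Fin n → ℝ≥0) (i j : Fin n) : ℝ :=
  if i = j then 0
  else min 1 ((w i * w j : ℝ) / (θ * n) * (1 + φ (w (min i j)) (w (max i j)) w))

/-- The probability of the simple graph `H` if the edges `{i, j}`, `i < j`, are present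
independently of each other with probabilities `p i j`. -/
noncomputable def bernoulliGraphProb {n : ℕ} (p : Fin n → Fin n → ℝ)
    (H : SimpleGraph (Fin n)) : ℝ :=
  open Classical in ∏ i, ∏ j ∈ Finset.Ioi i, if H.Adj i j then p i j else 1 - p i j

/-- On the probability space `(Ω, P)` we are given random attributes `aᵢ = (Wᵢ, bᵢ)` of `n`
vertices, a random simple graph `G` and a random vertex `I`, such that, conditionally on the
attributes, `G` is an inhomogeneous random graph with the edge probabilities `p_{ij}` and `I` is
uniform and independent of `G`. -/
structure IsIR {Ω S : Type*} [MeasurableSpace Ω] [MeasurableSpace S] {n : ℕ} (P : Measure Ω)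
    (θ : ℝ≥0) (φ : ℝ≥0 → ℝ≥0 → (Fin n → ℝ≥0) → ℝ) (a : Ω → Fin n → ℝ≥0 × S)
    (G : Ω → SimpleGraph (Fin n)) (I : Ω → Fin n) : Prop where
  measurable_a : Measurable a
  measurable_G : ∀ H, MeasurableSet {ω | G ω = H}
  measurable_I : Measurable I
  measurable_φ : Measurable fun x : ℝ≥0 × ℝ≥0 × (Fin n → ℝ≥0) => φ x.1 x.2.1 x.2.2
  phi_gt : ∀ᵐ ω ∂P, ∀ i j, i < j → -1 < φ (a ω i).1 (a ω j).1 fun l => (a ω l).1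
  law : ∀ (v : Fin n) (H : SimpleGraph (Fin n)),
    P⟦{ω | I ω = v ∧ G ω = H} | attrSigma a⟧ =ᵐ[P]
      fun ω => (n : ℝ)⁻¹ * bernoulliGraphProb (edgeProb θ φ fun i => (a ω i).1) H

/-- `𝓔ₙ = n⁻¹ ∑ᵢ ∑_{j ≠ i} |p_{ij} - (r_{ij} ∧ 1)|` with `r_{ij} = wᵢ wⱼ / (θ n)`. -/
noncomputable def edgeError {n : ℕ} (θ : ℝ≥0) (φ : ℝ≥0 → ℝ≥0 → (Fin n → ℝ≥0) → ℝ)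
    (w : Fin n → ℝ≥0) : ℝ :=
  (n : ℝ)⁻¹ * ∑ i, ∑ j ∈ Finset.univ.erase i,
    |edgeProb θ φ w i j - min ((w i * w j : ℝ) / (θ * n)) 1|

/-- The standing assumptions in the inhomogeneous random graph: `n⁻¹ ∑ Wᵢ → θ ∈ (0, ∞)`,
`W₁(νₙ, ν) → 0` and `𝓔ₙ → 0` in probability, and `E[W + ρ'(B, b₀)] < ∞` for some `b₀`, where
`(W, B) ∼ ν`. -/
structure AssumptionIR {Ω : ℕ+ → Type*} {S : Type*} [∀ n, MeasurableSpace (Ω n)] [MetricSpace S]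
    [MeasurableSpace S] (P : ∀ n, Measure (Ω n)) (θ : ℝ≥0)
    (φ : ∀ n : ℕ+, ℝ≥0 → ℝ≥0 → (Fin (n : ℕ) → ℝ≥0) → ℝ)
    (a : ∀ n, Ω n → Fin (n : ℕ) → ℝ≥0 × S) (ν : Measure (ℝ≥0 × S)) : Prop where
  theta_pos : 0 < θ
  mean : TendstoInProb P (fun n ω => ((n : ℕ) : ℝ≥0)⁻¹ * ∑ i, (a n ω i).1) (𝓝 θ)
  wasserstein : TendstoInProb P (fun n ω => W1 (empirical (a n ω)) ν) (𝓝 0)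
  edges : TendstoInProb P (fun n ω => edgeError θ (φ n) fun i => (a n ω i).1) (𝓝 0)
  moment : ∃ b₀ : S, ∫⁻ x, ((x.1 : ℝ≥0∞) + edist x.2 b₀) ∂ν < ∞

/-! ### The intermediate Galton–Watson tree -/

/-- The size-biased probabilities `wᵢ / ∑ⱼ wⱼ`; uniform, by convention, if all the weights vanish
(in which case the root of the trees below has no offspring). -/
noncomputable def sizeBias {n : ℕ} (w : Fin n → ℝ≥0) (i : Fin n) : ℝ≥0∞ :=
  if ∑ j, w j = 0 then (n : ℝ≥0∞)⁻¹ else ((w i / ∑ j, w j : ℝ≥0) : ℝ≥0∞)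

/-- Configuration model: the law of `(N_∅, A_∅)`, i.e. of `(D_i, a_i)` for a uniform `i`. -/
noncomputable def rootLawCM {S : Type*} [MeasurableSpace S] {n : ℕ} (a : Fin n → ℕ × S) :
    Measure (ℕ × (ℕ × S)) :=
  ∑ i, (n : ℝ≥0∞)⁻¹ • Measure.dirac ((a i).1, a i)

/-- Configuration model: the law of `(N_𝐢, A_𝐢)`, `𝐢 ≠ ∅`, i.e. of `(D_i - 1, a_i)` for an `i` drawn
with probability `D_i / L_n`; thus `(N_𝐢 + 1, A_𝐢)` is distributed as `(D_i, a_i)`. -/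
noncomputable def nodeLawCM {S : Type*} [MeasurableSpace S] {n : ℕ} (a : Fin n → ℕ × S) :
    Measure (ℕ × (ℕ × S)) :=
  ∑ i, sizeBias (fun j => ((a j).1 : ℝ≥0)) i • Measure.dirac ((a i).1 - 1, a i)

/-- The mean `Λₙ W̄ᵢ / (θ n)` of the number of offspring of a node with attribute `aᵢ`, where
`W̄ⱼ = Wⱼ ∧ b` and `Λₙ = ∑ⱼ W̄ⱼ`. -/
noncomputable def poissonMean {n : ℕ} (θ b : ℝ≥0) (w : Fin n → ℝ≥0) (i : Fin n) : ℝ≥0 :=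
  (∑ j, min (w j) b) * min (w i) b / (θ * n)

/-- Inhomogeneous random graph: the law of `(N_∅, A_∅)`, i.e. of `(Poisson(Λₙ W̄ᵢ/(θ n)), aᵢ)` for
a uniform `i`. -/
noncomputable def rootLawIR {S : Type*} [MeasurableSpace S] {n : ℕ} (θ b : ℝ≥0)
    (a : Fin n → ℝ≥0 × S) : Measure (ℕ × (ℝ≥0 × S)) :=
  ∑ i, (n : ℝ≥0∞)⁻¹ •
    (poissonMeasure (poissonMean θ b (fun j => (a j).1) i)).map fun m => (m, a i)

/-- Inhomogeneous random graph: the law of `(N_𝐢, A_𝐢)`, `𝐢 ≠ ∅`, i.e. of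
`(Poisson(Λₙ W̄ᵢ/(θ n)), aᵢ)` for an `i` drawn with probability `W̄ᵢ / Λₙ`. -/
noncomputable def nodeLawIR {S : Type*} [MeasurableSpace S] {n : ℕ} (θ b : ℝ≥0)
    (a : Fin n → ℝ≥0 × S) : Measure (ℕ × (ℝ≥0 × S)) :=
  ∑ i, sizeBias (fun j => min (a j).1 b) i •
    (poissonMeasure (poissonMean θ b (fun j => (a j).1) i)).map fun m => (m, a i)

/-- `Q` extends the probability space `(Ω, P)`, which carries the attributes `a`, the graph and the
vertex `I`, by a delayed marked Galton–Watson tree: the second coordinate is a family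
`(N_𝐢, A_𝐢)` which, conditionally on the attributes, is independent, with law `rootLaw` for `𝐢 = ∅`
and `nodeLaw` for all `𝐢 ≠ ∅`.  The root of the tree corresponds to `I`: it has its attribute. -/
structure IsTreeCoupling {Ω A : Type*} [MeasurableSpace Ω] [MeasurableSpace A] {n : ℕ}
    (P : Measure Ω) (a : Ω → Fin n → A) (I : Ω → Fin n) (rootLaw nodeLaw : Ω → Measure (ℕ × A))
    (Q : Measure (Ω × TreeData A)) : Prop where
  extends_P : Q.map Prod.fst = P
  law : ∀ (s : Finset (List ℕ)) (B : List ℕ → Set (ℕ × A)), (∀ i ∈ s, MeasurableSet (B i)) →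
    Q⟦{x | ∀ i ∈ s, x.2 i ∈ B i} | attrSigma fun x : Ω × TreeData A => a x.1⟧ =ᵐ[Q]
      fun x => ∏ i ∈ s, ((if i = [] then rootLaw x.1 else nodeLaw x.1) (B i)).toReal
  root : ∀ᵐ x ∂Q, (x.2 []).2 = a x.1 (I x.1)

/-- The event that the depth-`k` neighbourhood of `I` in the graph with edge multiplicities `e` and
the first `k` generations of the tree are not isomorphic as marked graphs. -/
def notIso {Ω A : Type*} {n : ℕ} (k : ℕ) (e : Ω → Fin n → Fin n → ℕ) (a : Ω → Fin n → A)
    (I : Ω → Fin n) : Set (Ω × TreeData A) :=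
  {x | ¬ (nbhd k (e x.1) (a x.1) (I x.1)).Iso (treeGraph k x.2)}

/-- There is a marked Galton–Watson tree with the given conditional laws, constructed on an
extension of the probability space of the graph, such that, for every `k ≥ 1`, the conditional
probability given the attributes that the depth-`k` neighbourhood of `I` and the first `k`
generations of the tree are not isomorphic as marked graphs tends to zero in probability. -/
def ExistsTreeCoupling {Ω : ℕ+ → Type*} {A : Type*} [∀ n, MeasurableSpace (Ω n)]
    [MeasurableSpace A] (P : ∀ n, Measure (Ω n)) (a : ∀ n, Ω n → Fin (n : ℕ) → A)
    (e : ∀ n, Ω n → Fin (n : ℕ) → Fin (n : ℕ) → ℕ) (I : ∀ n, Ω n → Fin (n : ℕ))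
    (rootLaw nodeLaw : ∀ n, Ω n → Measure (ℕ × A)) : Prop :=
  ∃ Q : ∀ n, Measure (Ω n × TreeData A),
    (∀ n, IsTreeCoupling (P n) (a n) (I n) (rootLaw n) (nodeLaw n) (Q n)) ∧
    ∀ k : ℕ, 1 ≤ k →
      (∀ n, MeasurableSet (notIso k (e n) (a n) (I n))) ∧
      TendstoInProb Q
        (fun n => (Q n)⟦notIso k (e n) (a n) (I n) |
          attrSigma fun x : Ω n × TreeData A => a n x.1⟧) (𝓝 0)

end GraphCoupling

/-! Condition on the attributes and let the nodes of the tree carry vertices instead of attributes;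
the attributes are restored at the end by `relabel`. Such a labelled tree matches the graph to depth
`k` (`Matches`) if the labels of the first `k + 1` generations are distinct, the vertices of the
first `k` generations have the degrees announced by the marks, and tree edges are graph edges. This
already forces an isomorphism (`Matches.iso`): the distinct tree neighbours of a vertex use up its
whole degree, which excludes loops, multiple edges and all further edges.

The graph is not explored vertex by vertex. After enrichment by some extra randomness it matches at
most one tree shape. Suppose that every shape in a good set is matched by the graph with at least
`c` times the probability that the tree has this shape. Then a maximal coupling of the two laws
produces a match with probability at least `c` times that of the good set
(`exists_maximal_coupling`, `exists_coupling_of_relation`). It remains to compare two explicit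
probabilities.

Configuration model: the graph is enriched to the pairing of the stubs, and the nodes of the tree to
independent uniform stubs. With `L` stubs in all, a shape with `N` nodes other than the root has
probability at most `L⁻ᴺ`, and the pairing contains `N` prescribed disjoint pairs with probability
at least `L⁻ᴺ`, whatever the order of pairing (`prod_le_pairStubs`). So `c = 1`, and a tree is good
as soon as its labels are distinct.

Inhomogeneous graph: a node at `u` with `N` children has weight `exp (-m u) ∏ (m u * q w) / N!`,
where `m u * q w` is the edge probability computed from truncated weights (`truncProb_eq`). The
graph offers `∏ p u w` for the tree edges, `∏ (1 - p u w)` for the absence of other edges, and `1 /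
N!` from an independent uniform ordering of the children. These agree up to factors near one unless
the tree meets an atypical vertex or pair (`goodTrees_le`).

Asymptotically, convergence in `W1` makes the weights uniformly integrable (`uniformTail_of_W1`).
Hence a fixed finite set of labels contains the tree with high probability (`exists_nodes_subset`),
its vertices are distinct (`not_injOn_le`), and atypical vertices and pairs are avoided because the
mean deviation of `p` from the truncated probabilities vanishes (`goodTrees_compl_le`). In the
configuration model, a limit law with mean degree zero is treated apart.

The coupling is then disintegrated with respect to the graph, which places the tree on an extension
of the given space (`exists_isTreeCoupling`). A diagonal choice of the depth yields one extension
for all `k`, and Markov's inequality passes from probabilities to conditional probabilities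
(`existsTreeCoupling_of_tendsto`). -/

namespace GraphCoupling

/-! ### Matching a multigraph with a labelled tree -/

/-- The labels of the children of the node `i`. -/
def children {A : Type*} (t : TreeData A) (i : List ℕ) : Finset (List ℕ) :=
  (Finset.range (t i).1).image (· :: i)

/-- The nodes of the first `k` generations. -/
def nodes {A : Type*} (t : TreeData A) : ℕ → Finset (List ℕ)
  | 0 => {[]}
  | k + 1 => insert [] ((nodes t k).biUnion (children t))

theorem mem_children {A : Type*} {t : TreeData A} {i j : List ℕ} :
    j ∈ children t i ↔ ∃ r < (t i).1, r :: i = j := by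
  simp [children]

theorem card_children {A : Type*} (t : TreeData A) (i : List ℕ) :
    (children t i).card = (t i).1 := by
  rw [children, Finset.card_image_of_injective _ fun a b h => by simpa using h, Finset.card_range]

theorem mem_nodes {A : Type*} {t : TreeData A} {k : ℕ} {i : List ℕ} :
    i ∈ nodes t k ↔ IsNode t i ∧ i.length ≤ k := by
  induction k generalizing i with
  | zero => cases i <;> simp [nodes, IsNode]
  | succ k ih =>
    cases i with
    | nil => simp [nodes, IsNode]
    | cons r i =>
      simp only [nodes, Finset.mem_insert, Finset.mem_biUnion, ih, mem_children, IsNode,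
        List.length_cons]
      constructor
      · rintro (h | ⟨j, ⟨h1, h2⟩, s, hs, h⟩)
        · simp at h
        · obtain ⟨rfl, rfl⟩ := List.cons.inj h
          exact ⟨⟨h1, hs⟩, by omega⟩
      · rintro ⟨⟨h1, h2⟩, h3⟩
        exact Or.inr ⟨i, ⟨h1, by omega⟩, r, h2, rfl⟩

theorem nil_mem_nodes {A : Type*} (t : TreeData A) (k : ℕ) : [] ∈ nodes t k := by
  simp [mem_nodes, IsNode]

theorem cons_mem_nodes {A : Type*} {t : TreeData A} {k r : ℕ} {i : List ℕ} :
    r :: i ∈ nodes t (k + 1) ↔ i ∈ nodes t k ∧ r < (t i).1 := by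
  simp only [mem_nodes, IsNode, List.length_cons, add_le_add_iff_right]; tauto

theorem nodes_mono {A : Type*} (t : TreeData A) {j k : ℕ} (h : j ≤ k) : nodes t j ⊆ nodes t k :=
  fun _ hi => mem_nodes.2 ⟨(mem_nodes.1 hi).1, (mem_nodes.1 hi).2.trans h⟩

/-- The parent of a node, if there is one. -/
def parentSet : List ℕ → Finset (List ℕ)
  | [] => ∅
  | _ :: i => {i}

theorem mem_parentSet {i j : List ℕ} : j ∈ parentSet i ↔ ∃ r, r :: j = i := by
  cases i with
  | nil => simp [parentSet]
  | cons r i =>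
    simp only [parentSet, Finset.mem_singleton, List.cons.injEq, exists_eq_left]

/-- The neighbours of a node in the tree. -/
def treeNbrs {A : Type*} (t : TreeData A) (i : List ℕ) : Finset (List ℕ) :=
  children t i ∪ parentSet i

/-- The mark of a node is its degree in the tree: the extra one away from the root is the edge to
the parent. -/
theorem card_treeNbrs {A : Type*} (t : TreeData A) (i : List ℕ) :
    (treeNbrs t i).card = (nodeMark t i).1 := by
  rw [treeNbrs, Finset.card_union_of_disjoint, card_children]
  · cases i <;> simp [parentSet, nodeMark]
  · rw [Finset.disjoint_left]
    rintro j hj hp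
    obtain ⟨r, -, rfl⟩ := mem_children.1 hj
    obtain ⟨s, hs⟩ := mem_parentSet.1 hp
    have := congrArg List.length hs
    simp only [List.length_cons] at this
    omega

theorem treeNbrs_subset {A : Type*} {t : TreeData A} {k : ℕ} {i : List ℕ} (hi : i ∈ nodes t k) :
    treeNbrs t i ⊆ nodes t (k + 1) := by
  intro j hj
  rcases Finset.mem_union.1 hj with h | h
  · obtain ⟨r, hr, rfl⟩ := mem_children.1 h
    exact cons_mem_nodes.2 ⟨hi, hr⟩
  · obtain ⟨r, rfl⟩ := mem_parentSet.1 h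
    exact nodes_mono t (Nat.le_succ _) (nodes_mono t (Nat.le_succ _)
      ((cons_mem_nodes (k := k)).1 (nodes_mono t (Nat.le_succ _) hi)).1) |>
      fun h => (mem_nodes.2 ⟨(mem_nodes.1 h).1, by
        have := (mem_nodes.1 hi).2
        simp only [List.length_cons] at this; omega⟩)

/-- The multigraph `e`, explored from `v` up to depth `k`, coincides with the tree `t`, whose nodes
are labelled by vertices of `e`. -/
structure Matches {n : ℕ} (k : ℕ) (e : Fin n → Fin n → ℕ) (v : Fin n) (t : TreeData (Fin n)) :
    Prop where
  symm : ∀ i j, e i j = e j i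
  root : (t []).2 = v
  inj : Set.InjOn (fun i => (t i).2) (nodes t (k + 1))
  deg : ∀ i ∈ nodes t k, degree e (t i).2 = (nodeMark t i).1
  edge : ∀ i ∈ nodes t k, ∀ r < (t i).1, e (t i).2 (t (r :: i)).2 ≠ 0

namespace Matches

variable {n k : ℕ} {e : Fin n → Fin n → ℕ} {v : Fin n} {t : TreeData (Fin n)}

theorem mono {j : ℕ} (h : Matches k e v t) (hj : j ≤ k) : Matches j e v t where
  symm := h.symm
  root := h.root
  inj := h.inj.mono (Finset.coe_subset.2 (nodes_mono t (by omega)))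
  deg i hi := h.deg i (nodes_mono t hj hi)
  edge i hi := h.edge i (nodes_mono t hj hi)

theorem edge_ne_zero (h : Matches k e v t) {i j : List ℕ} (hi : i ∈ nodes t k)
    (hj : j ∈ treeNbrs t i) : e (t i).2 (t j).2 ≠ 0 := by
  rcases Finset.mem_union.1 hj with h' | h'
  · obtain ⟨r, hr, rfl⟩ := mem_children.1 h'
    exact h.edge i hi r hr
  · obtain ⟨r, rfl⟩ := mem_parentSet.1 h'
    rw [h.symm]
    have := mem_nodes.1 hi
    simp only [IsNode, List.length_cons] at this
    exact h.edge j (mem_nodes.2 ⟨this.1.1, by omega⟩) r this.1.2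

/-- The tree neighbours have distinct labels and each is joined to the vertex at least once, so
together they already account for its degree. Equality in the sum forces every multiplicity to be
one, leaves no edge to any other vertex, and kills the additional loop term of `degree`. Distinct
labels in generation `k + 1` are needed because the neighbours of a node of generation `k` lie
there. -/
theorem edge_eq (h : Matches k e v t) {i : List ℕ} (hi : i ∈ nodes t k) (u : Fin n) :
    e (t i).2 u = if u ∈ (treeNbrs t i).image (fun j => (t j).2) then 1 else 0 := by
  set B := (treeNbrs t i).image (fun j => (t j).2) with hB
  have hcard : B.card = (nodeMark t i).1 := by
    rw [hB, Finset.card_image_of_injOn (h.inj.mono (Finset.coe_subset.2 (treeNbrs_subset hi))),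
      card_treeNbrs]
  have hdeg := h.deg i hi
  have hpos : ∀ w ∈ B, 1 ≤ e (t i).2 w := by
    intro w hw
    obtain ⟨j, hj, rfl⟩ := Finset.mem_image.1 hw
    exact Nat.one_le_iff_ne_zero.2 (h.edge_ne_zero hi hj)
  have hsum : ∑ w, (if w ∈ B then 1 else 0) = B.card := by simp
  have hle : ∀ w ∈ Finset.univ, (if w ∈ B then 1 else 0) ≤ e (t i).2 w := by
    intro w _; split_ifs with hw
    · exact hpos w hw
    · exact Nat.zero_le _
  have hle' := Finset.sum_le_sum hle
  have heq : ∑ w, (if w ∈ B then 1 else 0) = ∑ w, e (t i).2 w := by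
    unfold degree at hdeg; omega
  exact ((Finset.sum_eq_sum_iff_of_le hle).1 heq u (Finset.mem_univ u)).symm

theorem edge_eq_nodes (h : Matches k e v t) {i j : List ℕ} (hi : i ∈ nodes t k)
    (hj : j ∈ nodes t (k + 1)) :
    e (t i).2 (t j).2 = if j ∈ treeNbrs t i then 1 else 0 := by
  rw [h.edge_eq hi]
  refine if_congr ?_ rfl rfl
  rw [Finset.mem_image]
  constructor
  · rintro ⟨l, hl, hlj⟩
    rwa [← h.inj (treeNbrs_subset hi hl) hj hlj]
  · exact fun hj => ⟨j, hj, rfl⟩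

theorem adj_iff (h : Matches k e v t) (u w : Fin n) :
    (SimpleGraph.fromRel fun u v => e u v ≠ 0).Adj u w ↔ u ≠ w ∧ e u w ≠ 0 := by
  rw [SimpleGraph.fromRel_adj, h.symm w u, or_self]

theorem hopDist_le (h : Matches k e v t) (i : List ℕ) (hi : i ∈ nodes t k) :
    hopDist e v (t i).2 ≤ i.length := by
  induction i with
  | nil => simp [hopDist, h.root]
  | cons r i ih =>
    have hi' := mem_nodes.1 hi
    simp only [IsNode, List.length_cons] at hi'
    have hin : i ∈ nodes t k := mem_nodes.2 ⟨hi'.1.1, by omega⟩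
    have hadj : (SimpleGraph.fromRel fun u v => e u v ≠ 0).Adj (t i).2 (t (r :: i)).2 := by
      rw [h.adj_iff]
      refine ⟨fun hc => ?_, h.edge i hin r hi'.1.2⟩
      have := h.inj (nodes_mono t (Nat.le_succ _) hin) (nodes_mono t (Nat.le_succ _) hi) hc
      simpa using congrArg List.length this
    calc hopDist e v (t (r :: i)).2
        ≤ hopDist e v (t i).2 + hopDist e (t i).2 (t (r :: i)).2 := SimpleGraph.edist_triangle
      _ ≤ i.length + 1 := add_le_add (ih hin) (SimpleGraph.edist_eq_one_iff_adj.2 hadj).le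
      _ = _ := by simp

/-- The walk ends at the root, so the induction prepends one step at a time to a vertex already
known to be a node; by `edge_eq` this step can only lead to a tree neighbour, whose generation is
larger by at most one. -/
theorem exists_node_of_walk (h : Matches k e v t) {w u : Fin n}
    (p : (SimpleGraph.fromRel fun u v => e u v ≠ 0).Walk u w) (hw : w = v) (hp : p.length ≤ k) :
    ∃ i ∈ nodes t k, i.length ≤ p.length ∧ (t i).2 = u := by
  induction p with
  | nil => exact ⟨[], nil_mem_nodes t k, by simp, h.root.trans hw.symm⟩
  | @cons u u' w hadj p ih =>
    rw [SimpleGraph.Walk.length_cons] at hp ⊢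
    obtain ⟨i, hi, hil, rfl⟩ := ih hw (by omega)
    have := ((h.adj_iff _ _).1 hadj).2
    rw [h.symm, h.edge_eq hi] at this
    obtain ⟨j, hj, rfl⟩ : ∃ j ∈ treeNbrs t i, (t j).2 = u := by simpa using this
    have hj1 := (mem_nodes.1 (treeNbrs_subset hi hj)).1
    have hjl : j.length ≤ i.length + 1 := by
      have : i ∈ nodes t i.length := mem_nodes.2 ⟨(mem_nodes.1 hi).1, le_rfl⟩
      exact (mem_nodes.1 (treeNbrs_subset this hj)).2
    exact ⟨j, mem_nodes.2 ⟨hj1, by omega⟩, by omega, rfl⟩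

theorem hopDist_le_iff (h : Matches k e v t) (u : Fin n) :
    hopDist e v u ≤ k ↔ ∃ i ∈ nodes t k, (t i).2 = u := by
  constructor
  · intro hu
    obtain ⟨p, hp⟩ := SimpleGraph.exists_walk_of_edist_ne_top
      (ne_top_of_le_ne_top (ENat.natCast_ne_top k) hu)
    have hl : p.length ≤ k := by
      have : (p.length : ℕ∞) ≤ k := hp.trans_le hu
      exact_mod_cast this
    obtain ⟨i, hi, -, h2⟩ := h.exists_node_of_walk p.reverse rfl (by simpa using hl)
    exact ⟨i, hi, h2⟩
  · rintro ⟨i, hi, rfl⟩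
    exact (h.hopDist_le i hi).trans (by exact_mod_cast (mem_nodes.1 hi).2)

/-- The tree with its nodes marked by the attributes of the vertices. -/
def _root_.GraphCoupling.relabel {A : Type*} (a : Fin n → A) (t : TreeData (Fin n)) : TreeData A :=
  fun i => ((t i).1, a (t i).2)

theorem _root_.GraphCoupling.isNode_relabel {A : Type*} (a : Fin n → A) (t : TreeData (Fin n))
    (i : List ℕ) : IsNode (relabel a t) i ↔ IsNode t i := by
  induction i with
  | nil => rfl
  | cons r i ih => simp only [IsNode, ih]; rfl

/-- The inverse of the labelling is the isomorphism: the labels of the first `k` generations are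
exactly the vertices within hop distance `k`, and `edge_eq_nodes` compares the edges. -/
theorem iso {A : Type*} (a : Fin n → A) (h : Matches k e v t) :
    (nbhd k e a v).Iso (treeGraph k (relabel a t)) := by
  have hm : ∀ i : {i : List ℕ // IsNode (relabel a t) i ∧ i.length ≤ k}, i.1 ∈ nodes t k :=
    fun i => mem_nodes.2 ⟨(isNode_relabel a t _).1 i.2.1, i.2.2⟩
  let f : {i : List ℕ // IsNode (relabel a t) i ∧ i.length ≤ k} → {u : Fin n // hopDist e v u ≤ k} :=
    fun i => ⟨(t i).2, (h.hopDist_le_iff _).2 ⟨i, hm i, rfl⟩⟩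
  have hf : Function.Bijective f := by
    constructor
    · intro i j hij
      exact Subtype.ext (h.inj (nodes_mono t (Nat.le_succ _) (hm i))
        (nodes_mono t (Nat.le_succ _) (hm j)) (congrArg Subtype.val hij))
    · rintro ⟨u, hu⟩
      obtain ⟨i, hi, rfl⟩ := (h.hopDist_le_iff _).1 hu
      exact ⟨⟨i, (isNode_relabel a t _).2 (mem_nodes.1 hi).1, (mem_nodes.1 hi).2⟩, rfl⟩
  let σ := Equiv.ofBijective f hf
  refine ⟨σ.symm, ?_, ?_, ?_⟩
  · rw [Equiv.symm_apply_eq]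
    exact Subtype.ext h.root.symm
  · intro u
    obtain ⟨i, rfl⟩ := σ.surjective u
    rw [Equiv.symm_apply_apply]
    refine Prod.ext ((h.deg i (hm i)).trans ?_).symm ?_
    · obtain ⟨_ | ⟨r, i⟩, hi⟩ := i <;> rfl
    · obtain ⟨_ | ⟨r, i⟩, hi⟩ := i <;> rfl
  · intro u w
    obtain ⟨i, rfl⟩ := σ.surjective u
    obtain ⟨j, rfl⟩ := σ.surjective w
    rw [Equiv.symm_apply_apply, Equiv.symm_apply_apply]
    refine Eq.trans ?_ (h.edge_eq_nodes (hm i) (nodes_mono t (Nat.le_succ _) (hm j))).symm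
    suffices key : (∃ r : ℕ, i.1 = r :: j.1 ∨ j.1 = r :: i.1) ↔ j.1 ∈ treeNbrs t i.1 by
      simp only [treeGraph, key]
    rw [treeNbrs, Finset.mem_union, mem_children, mem_parentSet]
    have hi := (mem_nodes.1 (hm i)).1
    have hj := (mem_nodes.1 (hm j)).1
    constructor
    · rintro ⟨r, h1 | h1⟩
      · exact Or.inr ⟨r, h1.symm⟩
      · rw [h1] at hj
        exact Or.inl ⟨r, hj.2, h1.symm⟩
    · rintro (⟨r, -, h1⟩ | ⟨r, h1⟩)
      · exact ⟨r, Or.inr h1.symm⟩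
      · exact ⟨r, Or.inl h1.symm⟩

end Matches

/-! ### Maximal couplings -/

section Overlap

variable {T : Type*}

/-- The maximal coupling of the probability mass functions `p` and `q`. -/
noncomputable def overlap (p q : T → ℝ≥0∞) (t t' : T) : ℝ≥0∞ :=
  open Classical in (if t = t' then min (p t) (q t) else 0) +
    (p t - min (p t) (q t)) * (q t' - min (p t') (q t')) / (1 - ∑' s, min (p s) (q s))

theorem overlap_comm (p q : T → ℝ≥0∞) (t t' : T) : overlap p q t t' = overlap q p t' t := by
  classical
  simp only [overlap, min_comm (p _), mul_comm (p t - _)]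
  congr 1
  by_cases h : t = t'
  · subst h; simp
  · simp [h, Ne.symm h]

theorem overlap_eq_zero {p q : T → ℝ≥0∞} {t t' : T} (h : q t' = 0) : overlap p q t t' = 0 := by
  classical
  rw [overlap]
  by_cases ht : t = t'
  · subst ht; simp [h]
  · simp [h, ht]

/-- The diagonal carries the common part of `p` and `q`, and the excess of `p` is distributed
proportionally to the excess of `q`, whose total mass is the normalizing constant. -/
theorem tsum_overlap {p q : T → ℝ≥0∞} (hp : ∑' t, p t = 1) (hq : ∑' t, q t = 1) (t : T) :
    ∑' t', overlap p q t t' = p t := by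
  classical
  have hle : ∑' s, min (p s) (q s) ≤ 1 := hp ▸ ENNReal.tsum_le_tsum fun s => min_le_left _ _
  have hfin : ∑' s, min (p s) (q s) ≠ ∞ := ne_top_of_le_ne_top ENNReal.one_ne_top hle
  have hsub : ∀ r : T → ℝ≥0∞, (∀ s, min (p s) (q s) ≤ r s) → ∑' s, r s = 1 →
      ∑' s, (r s - min (p s) (q s)) = 1 - ∑' s, min (p s) (q s) := fun r hr hr1 => by
    refine ENNReal.eq_sub_of_add_eq hfin ?_
    rw [← ENNReal.tsum_add, ← hr1]
    exact tsum_congr fun s => tsub_add_cancel_of_le (hr s)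
  simp only [overlap, div_eq_mul_inv]
  rw [ENNReal.tsum_add, ENNReal.tsum_mul_right, ENNReal.tsum_mul_left,
    hsub q (fun s => min_le_right _ _) hq, tsum_eq_single t (by intro s hs; simp [Ne.symm hs]),
    if_pos rfl]
  -- If the normalizing constant vanishes, `p` has no excess anywhere, so the quotient by zero is
  -- multiplied by zero.
  by_cases h1 : 1 - ∑' s, min (p s) (q s) = 0
  · have := hsub p (fun s => min_le_left _ _) hp
    rw [h1, ENNReal.tsum_eq_zero] at this
    rw [this t, zero_mul, zero_mul, add_zero]
    exact le_antisymm (min_le_left _ _) (tsub_eq_zero_iff_le.1 (this t))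
  · rw [mul_assoc, ENNReal.mul_inv_cancel h1 (ENNReal.sub_ne_top ENNReal.one_ne_top), mul_one]
    exact add_tsub_cancel_of_le (min_le_left _ _)

theorem min_le_overlap (p q : T → ℝ≥0∞) (t : T) : min (p t) (q t) ≤ overlap p q t t := by
  classical
  rw [overlap, if_pos rfl]
  exact le_self_add

/-- The density of the maximal coupling with respect to the product of `p` and `q`. -/
noncomputable def overlapDensity (p q : T → ℝ≥0∞) (t t' : T) : ℝ≥0∞ :=
  overlap p q t t' / (p t * q t')

theorem overlapDensity_comm (p q : T → ℝ≥0∞) (t t' : T) :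
    overlapDensity p q t t' = overlapDensity q p t' t := by
  rw [overlapDensity, overlapDensity, overlap_comm, mul_comm]

variable [Countable T] [MeasurableSpace T] [DiscreteMeasurableSpace T]

theorem tsum_measure_fiber {X : Type*} [MeasurableSpace X] (μ : Measure X) [IsProbabilityMeasure μ]
    {f : X → T} (hf : Measurable f) : ∑' t, μ (f ⁻¹' {t}) = 1 := by
  rw [← measure_iUnion (fun s t h => Disjoint.preimage f (Set.disjoint_singleton.2 h))
    fun t => hf (MeasurableSet.of_discrete), ← Set.preimage_iUnion, Set.iUnion_of_singleton,
    Set.preimage_univ, measure_univ]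

theorem lintegral_overlapDensity {X : Type*} [MeasurableSpace X] (ν : Measure X)
    [IsProbabilityMeasure ν] {g : X → T} (hg : Measurable g) {p : T → ℝ≥0∞} (hp : ∑' t, p t = 1)
    {t : T} (ht : p t ≠ 0) :
    ∫⁻ x, overlapDensity p (fun s => ν (g ⁻¹' {s})) t (g x) ∂ν = 1 := by
  have hq := tsum_measure_fiber ν hg
  have htop : p t ≠ ∞ := ENNReal.ne_top_of_tsum_ne_top (hp ▸ ENNReal.one_ne_top) t
  rw [← lintegral_map (f := fun s => overlapDensity p (fun s => ν (g ⁻¹' {s})) t s)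
    (measurable_of_countable _) hg, lintegral_countable']
  have : ∀ s, overlapDensity p (fun s => ν (g ⁻¹' {s})) t s * ν.map g {s} =
      overlap p (fun s => ν (g ⁻¹' {s})) t s * (p t)⁻¹ := by
    intro s
    rw [Measure.map_apply hg (MeasurableSet.of_discrete), overlapDensity]
    by_cases hs : ν (g ⁻¹' {s}) = 0
    · rw [hs, overlap_eq_zero (q := fun s => ν (g ⁻¹' {s})) hs]; simp
    · rw [div_eq_mul_inv, ENNReal.mul_inv (Or.inl ht) (Or.inl htop), mul_assoc, mul_assoc,
        ENNReal.inv_mul_cancel hs (measure_ne_top _ _), mul_one]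
  simp_rw [this]
  rw [ENNReal.tsum_mul_right, tsum_overlap hp hq, ENNReal.mul_inv_cancel ht htop]

end Overlap

/-! ### Maximal coupling of two kernels through discrete statistics. -/

section CouplingKernel

variable {Θ X Y T : Type*} [MeasurableSpace Θ] [MeasurableSpace X] [MeasurableSpace Y]
  [Countable T] [MeasurableSpace T] [DiscreteMeasurableSpace T]

/-- Since `T` is countable, almost every point lies in a fibre of positive mass, and over such a
point the density integrates to one. -/
theorem lintegral_overlapDensity_fiber (μ : Measure X) [IsProbabilityMeasure μ] (ν : Measure Y)
    [IsProbabilityMeasure ν] {f : X → T} {g : Y → T} (hf : Measurable f) (hg : Measurable g)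
    (s : Set X) :
    ∫⁻ x in s, ∫⁻ y, overlapDensity (fun t => μ (f ⁻¹' {t})) (fun t => ν (g ⁻¹' {t})) (f x) (g y)
      ∂ν ∂μ = μ s := by
  have hae : ∀ᵐ x ∂μ, μ (f ⁻¹' {f x}) ≠ 0 := by
    have : {x | ¬ μ (f ⁻¹' {f x}) ≠ 0} = ⋃ t ∈ {t | μ (f ⁻¹' {t}) = 0}, f ⁻¹' {t} := by
      ext x; simp
    rw [ae_iff, this]
    exact (measure_biUnion_null_iff (Set.to_countable _)).2 fun t ht => ht
  rw [← setLIntegral_one]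
  refine lintegral_congr_ae (ae_restrict_of_ae (hae.mono fun x hx => ?_))
  exact lintegral_overlapDensity ν hg (tsum_measure_fiber μ hf) hx

/-- The coupling has a density with respect to the product measure that depends on the points only
through `f` and `g`: these statistics are coupled maximally, and the rest is conditionally
independent given them. The explicit density makes the measurability in `θ` visible, so that the
coupling is a kernel. -/
theorem exists_maximal_coupling (μ : Kernel Θ X) [IsMarkovKernel μ] (ν : Kernel Θ Y)
    [IsMarkovKernel ν] {f : X → T} {g : Y → T} (hf : Measurable f) (hg : Measurable g) :
    ∃ π : Kernel Θ (X × Y), IsMarkovKernel π ∧ (∀ θ, (π θ).map Prod.fst = μ θ) ∧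
      (∀ θ, (π θ).map Prod.snd = ν θ) ∧
      ∀ θ t, min (μ θ (f ⁻¹' {t})) (ν θ (g ⁻¹' {t})) ≤ π θ {x | f x.1 = t ∧ g x.2 = t} := by
  let D : Θ → X × Y → ℝ≥0∞ := fun θ x =>
    overlapDensity (fun t => μ θ (f ⁻¹' {t})) (fun t => ν θ (g ⁻¹' {t})) (f x.1) (g x.2)
  have hfm : ∀ t, MeasurableSet (f ⁻¹' {t}) := fun t => hf MeasurableSet.of_discrete
  have hgm : ∀ t, MeasurableSet (g ⁻¹' {t}) := fun t => hg MeasurableSet.of_discrete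
  have hD : Measurable (Function.uncurry D) := by
    have h0 : Measurable fun z : Θ × (T × T) =>
        overlapDensity (fun t => μ z.1 (f ⁻¹' {t})) (fun t => ν z.1 (g ⁻¹' {t})) z.2.1 z.2.2 := by
      refine measurable_from_prod_countable_left fun ⟨t, t'⟩ => ?_
      have hp : ∀ t, Measurable fun θ => μ θ (f ⁻¹' {t}) := fun t => μ.measurable_coe (hfm t)
      have hq : ∀ t, Measurable fun θ => ν θ (g ⁻¹' {t}) := fun t => ν.measurable_coe (hgm t)
      have hm : ∀ t, Measurable fun θ => min (μ θ (f ⁻¹' {t})) (ν θ (g ⁻¹' {t})) :=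
        fun t => (hp t).min (hq t)
      have hS : Measurable fun θ => ∑' t, min (μ θ (f ⁻¹' {t})) (ν θ (g ⁻¹' {t})) :=
        Measurable.tsum hm
      unfold overlapDensity overlap
      refine Measurable.div (Measurable.add ?_ (Measurable.div (Measurable.mul ?_ ?_) ?_)) ?_
      · by_cases h : t = t'
        · simpa [h] using hm t'
        · simp [h]
      · exact (hp t).sub (hm t)
      · exact (hq t').sub (hm t')
      · exact measurable_const.sub hS
      · exact (hp t).mul (hq t')
    exact h0.comp (measurable_fst.prodMk ((hf.comp (measurable_fst.comp measurable_snd)).prodMk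
      (hg.comp (measurable_snd.comp measurable_snd))))
  have hDθ : ∀ θ, Measurable (D θ) := fun θ => hD.of_uncurry_left
  let π := (μ ×ₖ ν).withDensity D
  have hπ : ∀ θ s, MeasurableSet s → π θ s = ∫⁻ x in s, D θ x ∂((μ θ).prod (ν θ)) := by
    intro θ s hs
    rw [Kernel.withDensity_apply' _ hD, Kernel.prod_apply]
  have hfst : ∀ θ s, MeasurableSet s → π θ (s ×ˢ Set.univ) = μ θ s := by
    intro θ s hs
    rw [hπ θ _ (hs.prod MeasurableSet.univ), ← Measure.prod_restrict, Measure.restrict_univ,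
      lintegral_prod _ (hDθ θ).aemeasurable]
    exact lintegral_overlapDensity_fiber (μ θ) (ν θ) hf hg s
  have hsnd : ∀ θ s, MeasurableSet s → π θ (Set.univ ×ˢ s) = ν θ s := by
    intro θ s hs
    rw [hπ θ _ (MeasurableSet.univ.prod hs), ← Measure.prod_restrict, Measure.restrict_univ,
      lintegral_prod_symm _ (hDθ θ).aemeasurable]
    simp only [D, overlapDensity_comm (fun t => μ θ (f ⁻¹' {t}))]
    exact lintegral_overlapDensity_fiber (ν θ) (μ θ) hg hf s
  refine ⟨π, ⟨fun θ => ⟨?_⟩⟩, fun θ => ?_, fun θ => ?_, fun θ t => ?_⟩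
  · rw [← Set.univ_prod_univ, hfst θ _ MeasurableSet.univ, measure_univ]
  · ext s hs
    rw [Measure.map_apply measurable_fst hs, ← hfst θ s hs]
    congr 1; ext; simp
  · ext s hs
    rw [Measure.map_apply measurable_snd hs, ← hsnd θ s hs]
    congr 1; ext; simp
  · have : {x : X × Y | f x.1 = t ∧ g x.2 = t} = (f ⁻¹' {t}) ×ˢ (g ⁻¹' {t}) := by
      ext; simp
    rw [this, hπ θ _ ((hfm t).prod (hgm t))]
    have h1 : ∀ x ∈ (f ⁻¹' {t}) ×ˢ (g ⁻¹' {t}), overlapDensity (fun t => μ θ (f ⁻¹' {t}))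
        (fun t => ν θ (g ⁻¹' {t})) t t ≤ D θ x := by
      rintro x ⟨rfl, h2⟩
      change g x.2 = f x.1 at h2
      simp only [D, h2, le_refl]
    refine le_trans ?_ (setLIntegral_mono' ((hfm t).prod (hgm t)) h1)
    rw [setLIntegral_const, Measure.prod_prod, overlapDensity]
    by_cases h0 : μ θ (f ⁻¹' {t}) * ν θ (g ⁻¹' {t}) = 0
    · rcases mul_eq_zero.1 h0 with h | h <;> simp [h]
    · rw [ENNReal.div_mul_cancel h0 (ENNReal.mul_ne_top (measure_ne_top _ _) (measure_ne_top _ _))]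
      exact min_le_overlap (fun t => μ θ (f ⁻¹' {t})) (fun t => ν θ (g ⁻¹' {t})) t

/-- A coupling which realizes the relation `R` as often as possible, if the fibres of `g` over
`R`-related points have a `ν`-measure which is controlled by the `μ`-measure of the points that are
related to them. -/
theorem exists_coupling_of_relation [DiscreteMeasurableSpace X] (μ : Kernel Θ X) [IsMarkovKernel μ]
    (ν : Kernel Θ Y) [IsMarkovKernel ν] {g : Y → T} (hg : Measurable g) (R : X → Y → Prop)
    (hR : ∀ x y y', R x y → R x y' → g y = g y') :
    ∃ π : Kernel Θ (X × Y), IsMarkovKernel π ∧ (∀ θ, (π θ).map Prod.fst = μ θ) ∧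
      (∀ θ, (π θ).map Prod.snd = ν θ) ∧
      ∀ θ (c : ℝ≥0∞) (s : Set Y), c ≤ 1 →
        (∀ y ∈ s, c * ν θ (g ⁻¹' {g y}) ≤ μ θ {x | R x y}) →
        c * ν θ s ≤ π θ {x | ∃ y, R x.1 y ∧ g y = g x.2} := by
  classical
  let _ : MeasurableSpace (Option T) := ⊤
  have _ : DiscreteMeasurableSpace (Option T) := ⟨fun _ => trivial⟩
  -- The statistic of `x` is the value of `g` at any point related to `x`, which by `hR` does not
  -- depend on the point; `none` means that there is no such point. Now `f` and `g` are coupled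
  -- maximally, and the overlap at the value `g y` is at least `c * ν θ (g ⁻¹' {g y})`.
  let f : X → Option T := fun x => if h : ∃ y, R x y then some (g h.choose) else none
  have hfR : ∀ x y, R x y → f x = some (g y) := by
    intro x y hxy
    have h : ∃ y, R x y := ⟨y, hxy⟩
    simp only [f, dif_pos h]
    rw [hR x _ y h.choose_spec hxy]
  have hRf : ∀ x t, f x = some t → ∃ y, R x y ∧ g y = t := by
    intro x t hx
    by_cases h : ∃ y, R x y
    · simp only [f, dif_pos h, Option.some.injEq] at hx
      exact ⟨_, h.choose_spec, hx⟩
    · simp [f, dif_neg h] at hx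
  have hg' : Measurable fun y => some (g y) := (measurable_of_countable _).comp hg
  obtain ⟨π, h1, h2, h3, h4⟩ := exists_maximal_coupling (f := f) (g := fun y => some (g y)) μ ν
    (Measurable.of_discrete) hg'
  refine ⟨π, h1, h2, h3, fun θ c s hc hs => ?_⟩
  have hsub : (⋃ t ∈ g '' s, {x : X × Y | f x.1 = some t ∧ some (g x.2) = some t}) ⊆
      {x | ∃ y, R x.1 y ∧ g y = g x.2} := by
    intro x hx
    simp only [Set.mem_iUnion, Set.mem_ofPred_eq] at hx
    obtain ⟨t, -, hx1, hx2⟩ := hx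
    obtain ⟨y, hy, rfl⟩ := hRf _ _ hx1
    exact ⟨y, hy, (Option.some.inj hx2).symm⟩
  refine le_trans ?_ (measure_mono hsub)
  rw [measure_biUnion (Set.to_countable _)]
  · have hcov : s ⊆ ⋃ t ∈ g '' s, g ⁻¹' {t} := fun y hy =>
      Set.mem_biUnion (Set.mem_image_of_mem g hy) rfl
    calc c * ν θ s ≤ c * ∑' t : g '' s, ν θ (g ⁻¹' {t.1}) := by
          gcongr
          exact (measure_mono hcov).trans (measure_biUnion_le _ (Set.to_countable _) _)
      _ = ∑' t : g '' s, c * ν θ (g ⁻¹' {t.1}) := ENNReal.tsum_mul_left.symm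
      _ ≤ _ := ENNReal.tsum_le_tsum ?_
    rintro ⟨_, y, hy, rfl⟩
    have hpre : (fun y => some (g y)) ⁻¹' {some (g y)} = g ⁻¹' {g y} := by ext; simp
    refine le_trans (le_min ?_ ?_) (h4 θ (some (g y)))
    · exact (hs y hy).trans (measure_mono fun x hx => hfR x y hx)
    · rw [hpre]
      exact mul_le_of_le_one_left' hc
  · rintro t - t' - htt
    refine Set.disjoint_left.2 fun x hx hx' => htt ?_
    exact Option.some.inj (hx.2.symm.trans hx'.2)
  · intro t _
    exact (MeasurableSet.of_discrete (s := {x | f x = some t})).preimage measurable_fst |>.inter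
      ((hg' (MeasurableSet.of_discrete (s := {some t}))).preimage measurable_snd)

end CouplingKernel

/-! ### Partial matchings in the configuration model -/

section Pairing

variable {n : ℕ} {d : Fin n → ℕ}

/-- The stubs occurring in a list of pairs. -/
def stubList (h : List (Stub d × Stub d)) : List (Stub d) := h.flatMap fun p => [p.1, p.2]

theorem stubList_cons (p : Stub d × Stub d) (h : List (Stub d × Stub d)) :
    stubList (p :: h) = p.1 :: p.2 :: stubList h := by
  simp [stubList]

theorem mem_unpaired {h : List (Stub d × Stub d)} {s : Stub d} :
    s ∈ unpaired h ↔ s ∉ stubList h := by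
  simp only [unpaired, stubList, Finset.mem_filter, Finset.mem_univ, true_and, List.mem_flatMap,
    List.mem_cons, List.not_mem_nil, or_false, not_exists, not_and, not_or]

theorem unpaired_cons (p : Stub d × Stub d) (h : List (Stub d × Stub d)) :
    unpaired (p :: h) = ((unpaired h).erase p.1).erase p.2 := by
  ext s
  simp only [mem_unpaired, stubList_cons, Finset.mem_erase, List.mem_cons]
  tauto

/-- Each stub contributes one to the degree of its vertex. A pair of stubs of the same vertex is one
loop but two stubs, and the second one is the extra `e i i` in `degree`. -/
theorem degree_pairGraph (h : List (Stub d × Stub d)) (u : Fin n) :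
    degree (pairGraph h) u = (stubList h).countP (fun s => s.1 = u) := by
  induction h with
  | nil => simp [degree, pairGraph, stubList]
  | cons p h ih =>
    have hcons : ∀ i j, pairGraph (p :: h) i j =
        pairGraph h i j + if s(p.1.1, p.2.1) = s(i, j) then 1 else 0 := by
      intro i j
      simp [pairGraph, List.count_cons]
    rw [stubList_cons, List.countP_cons, List.countP_cons, ← ih]
    simp only [degree, hcons, Finset.sum_add_distrib, Sym2.eq_iff]
    have hs : ∑ j, (if p.1.1 = u ∧ p.2.1 = j ∨ p.1.1 = j ∧ p.2.1 = u then 1 else 0) +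
        (if p.1.1 = u ∧ p.2.1 = u ∨ p.1.1 = u ∧ p.2.1 = u then 1 else 0) =
        (if p.2.1 = u then 1 else 0) + (if p.1.1 = u then 1 else 0) := by
      by_cases h1 : p.1.1 = u <;> by_cases h2 : p.2.1 = u <;>
        simp [h1, h2, eq_comm]
    simp only [decide_eq_true_eq]
    omega

theorem degree_pairGraph_le {h : List (Stub d × Stub d)} (hh : (stubList h).Nodup) (u : Fin n) :
    degree (pairGraph h) u ≤ d u := by
  rw [degree_pairGraph, List.countP_eq_length_filter, ← List.toFinset_card_of_nodup (hh.filter _)]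
  calc _ ≤ (Finset.univ.map ⟨fun x : Fin (d u) => (⟨u, x⟩ : Stub d), fun a b => by simp⟩).card := by
        refine Finset.card_le_card fun s hs => ?_
        obtain ⟨v, x⟩ := s
        simp only [List.mem_toFinset, List.mem_filter, decide_eq_true_eq] at hs
        obtain ⟨-, rfl⟩ := hs
        exact Finset.mem_map.2 ⟨x, Finset.mem_univ _, rfl⟩
    _ = d u := by simp

theorem pairGraph_comm (h : List (Stub d × Stub d)) (i j : Fin n) :
    pairGraph h i j = pairGraph h j i := by
  rw [pairGraph, Sym2.eq_swap, pairGraph]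

theorem pairGraph_ne_zero {h : List (Stub d × Stub d)} {x y : Stub d} (hxy : (x, y) ∈ h) :
    pairGraph h x.1 y.1 ≠ 0 := by
  rw [pairGraph, Ne, List.count_eq_zero, not_not, List.mem_map]
  exact ⟨_, hxy, rfl⟩

/-- The final lists of pairs which extend `h` and which contain the pairs `{x i, y i}`. -/
def extensions {ι : Type*} (idx : Finset ι) (x y : ι → Stub d) (h : List (Stub d × Stub d)) :
    Set (List (Stub d × Stub d)) :=
  {h' | (stubList h').Nodup ∧ h ⊆ h' ∧ ∀ i ∈ idx, (x i, y i) ∈ h' ∨ (y i, x i) ∈ h'}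

/-- Induction on the number of pairs still to be made. If the picked stub belongs to a prescribed
pair, its partner is the right one with probability `1 / (2m + 1)`, which is the first factor of the
product. Otherwise its partner must avoid the `2N` prescribed stubs, which has probability `(2m + 1
- 2N) / (2m + 1)`; multiplying by this replaces the product for `m` by the one for `m + 1`, as all
other factors telescope. The bound does not see the rule by which stubs are picked. -/
theorem prod_le_pairStubs (pick : PickRule d) {ι : Type*} [DecidableEq ι] (x y : ι → Stub d)
    (m : ℕ) (idx : Finset ι) (h : List (Stub d × Stub d)) (hcard : (unpaired h).card = 2 * m)
    (hh : (stubList h).Nodup) (hx : ∀ i ∈ idx, x i ∈ unpaired h) (hy : ∀ i ∈ idx, y i ∈ unpaired h)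
    (hxi : Set.InjOn x idx) (hyi : Set.InjOn y idx) (hxy : ∀ i ∈ idx, ∀ j ∈ idx, x i ≠ y j) :
    ∏ l ∈ Finset.range idx.card, ((2 * m - 1 - 2 * l : ℕ) : ℝ≥0∞)⁻¹ ≤
      (pairStubs pick m h).toOuterMeasure (extensions idx x y h) := by
  induction m generalizing idx h with
  | zero =>
    have he : unpaired h = ∅ := Finset.card_eq_zero.1 hcard
    have hidx : idx = ∅ := Finset.eq_empty_of_forall_notMem fun i hi => by
      simpa [he] using hx i hi
    subst hidx
    rw [pairStubs, PMF.toOuterMeasure_pure_apply, if_pos]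
    · simp
    · exact ⟨hh, List.Subset.refl _, by simp⟩
  | succ m ih =>
    have h₁ : (unpaired h).Nonempty := Finset.card_pos.1 (by omega)
    obtain ⟨s₀, hs₀⟩ : ∃ s₀, s₀ = (pick h h₁).1 := ⟨_, rfl⟩
    have hs₀m : s₀ ∈ unpaired h := hs₀ ▸ (pick h h₁).2
    have hce : ((unpaired h).erase s₀).card = 2 * m + 1 := by
      rw [Finset.card_erase_of_mem hs₀m]; omega
    have h₂ : ((unpaired h).erase s₀).Nonempty := Finset.card_pos.1 (by omega)
    rw [pairStubs, dif_pos h₁]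
    simp only [← hs₀]
    rw [dif_pos h₂, PMF.toOuterMeasure_bind_apply]
    simp only [PMF.uniformOfFinset_apply, hce]
    have hstep : ∀ s ∈ (unpaired h).erase s₀, (unpaired ((s₀, s) :: h)).card = 2 * m ∧
        (stubList ((s₀, s) :: h)).Nodup := by
      intro s hs
      refine ⟨by rw [unpaired_cons, Finset.card_erase_of_mem hs, hce]; omega, ?_⟩
      rw [stubList_cons, List.nodup_cons, List.nodup_cons, List.mem_cons]
      obtain ⟨hs1, hs2⟩ := Finset.mem_erase.1 hs
      exact ⟨not_or.2 ⟨Ne.symm hs1, mem_unpaired.1 hs₀m⟩, mem_unpaired.1 hs2, hh⟩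
    have hc0 : (2 * (m + 1) - 1 - 2 * 0 : ℕ) = 2 * m + 1 := by omega
    by_cases hcase : ∃ i ∈ idx, s₀ = x i ∨ s₀ = y i
    · obtain ⟨i, hi, hi'⟩ := hcase
      obtain ⟨s, hs, hsx⟩ : ∃ s ∈ unpaired h, s₀ = x i ∧ s = y i ∨ s₀ = y i ∧ s = x i := by
        rcases hi' with h' | h'
        · exact ⟨y i, hy i hi, Or.inl ⟨h', rfl⟩⟩
        · exact ⟨x i, hx i hi, Or.inr ⟨h', rfl⟩⟩
      have hne : s ≠ s₀ := by
        rcases hsx with ⟨rfl, rfl⟩ | ⟨rfl, rfl⟩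
        · exact (hxy i hi i hi).symm
        · exact hxy i hi i hi
      have hse : s ∈ (unpaired h).erase s₀ := Finset.mem_erase.2 ⟨hne, hs⟩
      have hcov : ∀ z, z ∈ unpaired h → z ≠ x i → z ≠ y i → z ∈ unpaired ((s₀, s) :: h) := by
        intro z hz h1 h2
        rw [unpaired_cons, Finset.mem_erase, Finset.mem_erase]
        rcases hsx with ⟨rfl, rfl⟩ | ⟨rfl, rfl⟩
        · exact ⟨h2, h1, hz⟩
        · exact ⟨h1, h2, hz⟩
      have key := ih (idx.erase i) ((s₀, s) :: h) (hstep s hse).1 (hstep s hse).2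
        (fun j hj => by
          obtain ⟨hj1, hj2⟩ := Finset.mem_erase.1 hj
          exact hcov _ (hx j hj2) (fun hc => hj1 (hxi hj2 hi hc)) (hxy j hj2 i hi))
        (fun j hj => by
          obtain ⟨hj1, hj2⟩ := Finset.mem_erase.1 hj
          exact hcov _ (hy j hj2) (hxy i hi j hj2).symm (fun hc => hj1 (hyi hj2 hi hc)))
        (hxi.mono (Finset.coe_subset.2 (Finset.erase_subset _ _)))
        (hyi.mono (Finset.coe_subset.2 (Finset.erase_subset _ _)))
        (fun j hj l hl => hxy j (Finset.mem_of_mem_erase hj) l (Finset.mem_of_mem_erase hl))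
      refine le_trans ?_ (ENNReal.le_tsum s)
      rw [if_pos hse, ← Finset.card_erase_add_one hi, Finset.prod_range_succ', hc0, mul_comm]
      gcongr
      refine le_trans (le_of_eq ?_) (key.trans (measure_mono ?_))
      · refine Finset.prod_congr rfl fun l _ => ?_
        congr 2; omega
      · rintro h' ⟨h1, h2, h3⟩
        refine ⟨h1, fun p hp => h2 (List.mem_cons_of_mem _ hp), fun j hj => ?_⟩
        by_cases hji : j = i
        · subst hji
          have := h2 (List.mem_cons_self (a := (s₀, s)))
          rcases hsx with ⟨rfl, rfl⟩ | ⟨rfl, rfl⟩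
          · exact Or.inl this
          · exact Or.inr this
        · exact h3 j (Finset.mem_erase.2 ⟨hji, hj⟩)
    · have hnx : ∀ i ∈ idx, s₀ ≠ x i ∧ s₀ ≠ y i := fun i hi =>
        ⟨fun hc => hcase ⟨i, hi, Or.inl hc⟩, fun hc => hcase ⟨i, hi, Or.inr hc⟩⟩
      set B := idx.image x ∪ idx.image y with hB
      have hBcard : B.card = 2 * idx.card := by
        rw [hB, Finset.card_union_of_disjoint, Finset.card_image_of_injOn hxi,
          Finset.card_image_of_injOn hyi, two_mul]
        rw [Finset.disjoint_left]
        intro z hz hz'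
        obtain ⟨i, hi, rfl⟩ := Finset.mem_image.1 hz
        obtain ⟨j, hj, hij⟩ := Finset.mem_image.1 hz'
        exact hxy i hi j hj hij.symm
      have hBsub : B ⊆ (unpaired h).erase s₀ := by
        intro z hz
        rcases Finset.mem_union.1 hz with hz | hz <;> obtain ⟨i, hi, rfl⟩ := Finset.mem_image.1 hz
        · exact Finset.mem_erase.2 ⟨(hnx i hi).1.symm, hx i hi⟩
        · exact Finset.mem_erase.2 ⟨(hnx i hi).2.symm, hy i hi⟩
      have hmle : 2 * idx.card ≤ 2 * m + 1 := by
        rw [← hBcard, ← hce]; exact Finset.card_le_card hBsub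
      have hcB : (((unpaired h).erase s₀) \ B).card = 2 * m + 1 - 2 * idx.card := by
        rw [Finset.card_sdiff_of_subset hBsub, hce, hBcard]
      refine le_trans ?_ (ENNReal.sum_le_tsum (((unpaired h).erase s₀) \ B))
      have key : ∀ s ∈ ((unpaired h).erase s₀) \ B,
          ((2 * m + 1 : ℕ) : ℝ≥0∞)⁻¹ *
            ∏ l ∈ Finset.range idx.card, ((2 * m - 1 - 2 * l : ℕ) : ℝ≥0∞)⁻¹ ≤
          (if s ∈ (unpaired h).erase s₀ then ((2 * m + 1 : ℕ) : ℝ≥0∞)⁻¹ else 0) *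
            (pairStubs pick m ((s₀, s) :: h)).toOuterMeasure (extensions idx x y h) := by
        intro s hs
        obtain ⟨hs1, hs2⟩ := Finset.mem_sdiff.1 hs
        rw [if_pos hs1]
        gcongr
        have hcov : ∀ z ∈ B, z ∈ unpaired ((s₀, s) :: h) := by
          intro z hz
          rw [unpaired_cons]
          exact Finset.mem_erase.2 ⟨fun hc => hs2 (by rwa [← show z = s from hc]), hBsub hz⟩
        refine (ih idx ((s₀, s) :: h) (hstep s hs1).1 (hstep s hs1).2
          (fun i hi => hcov _ (Finset.mem_union_left _ (Finset.mem_image_of_mem x hi)))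
          (fun i hi => hcov _ (Finset.mem_union_right _ (Finset.mem_image_of_mem y hi)))
          hxi hyi hxy).trans (measure_mono ?_)
        rintro h' ⟨h1, h2, h3⟩
        exact ⟨h1, fun p hp => h2 (List.mem_cons_of_mem _ hp), h3⟩
      refine le_trans (le_of_eq ?_) (Finset.sum_le_sum key)
      rw [Finset.sum_const, hcB, nsmul_eq_mul]
      let A : ℕ → ℝ≥0∞ := fun l => ((2 * (m + 1) - 1 - 2 * l : ℕ) : ℝ≥0∞)⁻¹
      have hA0 : A 0 = ((2 * m + 1 : ℕ) : ℝ≥0∞)⁻¹ := by simp only [A, hc0]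
      have hA1 : ∏ l ∈ Finset.range idx.card, ((2 * m - 1 - 2 * l : ℕ) : ℝ≥0∞)⁻¹ =
          ∏ l ∈ Finset.range idx.card, A (l + 1) := by
        refine Finset.prod_congr rfl fun l _ => ?_
        simp only [A]
        congr 2; omega
      -- The difference is positive: `2 * idx.card ≤ 2 * m + 1`, and the two sides have different
      -- parity.
      have : A idx.card * ((2 * m + 1 - 2 * idx.card : ℕ) : ℝ≥0∞) = 1 := by
        simp only [A]
        rw [show 2 * (m + 1) - 1 - 2 * idx.card = 2 * m + 1 - 2 * idx.card by omega]
        refine ENNReal.inv_mul_cancel ?_ (ENNReal.natCast_ne_top _)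
        rw [Nat.cast_ne_zero]; omega
      rw [hA1, ← hA0, mul_comm (A 0), ← Finset.prod_range_succ', Finset.prod_range_succ,
        mul_comm _ (_ * _), mul_assoc, this, mul_one]

/-- Every factor `1 / (L - 1 - 2l)` is at least `1 / L`. Nothing is lost for the coupling, since
independent uniform stubs give at most this power of `1 / L`. -/
theorem inv_pow_le_pairStubs (pick : PickRule d) (heven : Even (∑ i, d i)) {ι : Type*}
    [DecidableEq ι] (x y : ι → Stub d) (idx : Finset ι) (hxi : Set.InjOn x idx)
    (hyi : Set.InjOn y idx) (hxy : ∀ i ∈ idx, ∀ j ∈ idx, x i ≠ y j) :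
    ((∑ i, d i : ℕ) : ℝ≥0∞)⁻¹ ^ idx.card ≤
      (pairStubs pick ((∑ i, d i) / 2) []).toOuterMeasure
        {h | (stubList h).Nodup ∧ ∀ i ∈ idx, (x i, y i) ∈ h ∨ (y i, x i) ∈ h} := by
  have hL : 2 * ((∑ i, d i) / 2) = ∑ i, d i := Nat.two_mul_div_two_of_even heven
  have h0 : ∀ s : Stub d, s ∈ unpaired ([] : List (Stub d × Stub d)) := by
    intro s; simp [mem_unpaired, stubList]
  have hcard : (unpaired ([] : List (Stub d × Stub d))).card = 2 * ((∑ i, d i) / 2) := by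
    rw [Finset.eq_univ_of_forall h0, hL]; simp
  refine le_trans ?_ ((prod_le_pairStubs pick x y _ idx [] hcard (by simp [stubList])
    (fun i _ => h0 _) (fun i _ => h0 _) hxi hyi hxy).trans
      (measure_mono fun h' hh' => ⟨hh'.1, hh'.2.2⟩))
  rw [← Finset.card_range idx.card, ← Finset.prod_const, Finset.card_range]
  refine Finset.prod_le_prod' fun l _ => ?_
  rw [ENNReal.inv_le_inv, Nat.cast_le]
  omega

end Pairing

/-! ### Labelled trees: agreement, measurability, laws -/

section Agree

variable {A : Type*} {t t' : TreeData A} {k : ℕ}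

/-- The trees `t` and `t'` have the same attributes up to generation `k + 1` and the same numbers
of offspring up to generation `k`. -/
def Agree (k : ℕ) (t t' : TreeData A) : Prop :=
  (∀ i ∈ nodes t k, (t' i).1 = (t i).1) ∧ ∀ i ∈ nodes t (k + 1), (t' i).2 = (t i).2

theorem Agree.nodes_eq (h : Agree k t t') {j : ℕ} (hj : j ≤ k + 1) : nodes t' j = nodes t j := by
  induction j with
  | zero => rfl
  | succ j ih =>
    rw [nodes, nodes, ih (by omega)]
    congr 1
    refine Finset.biUnion_congr rfl fun i hi => ?_
    rw [children, children, h.1 i (nodes_mono t (by omega) hi)]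

/-- Matching depends on the tree only through the data compared by `Agree`. This allows the coupling
to control merely the shape of the tree. -/
theorem Matches.congr {n : ℕ} {e : Fin n → Fin n → ℕ} {v : Fin n} {t t' : TreeData (Fin n)}
    (h : Matches k e v t) (ha : Agree k t t') : Matches k e v t' := by
  have hk := ha.nodes_eq (Nat.le_succ k)
  have hk1 := ha.nodes_eq le_rfl
  have hs := nodes_mono t (Nat.le_succ k)
  refine ⟨h.symm, (ha.2 [] (nil_mem_nodes _ _)).trans h.root, ?_, ?_, ?_⟩
  · rw [hk1]
    intro i hi j hj hij
    exact h.inj hi hj (by simpa only [ha.2 i hi, ha.2 j hj] using hij)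
  · intro i hi
    rw [hk] at hi
    rw [ha.2 i (hs hi), h.deg i hi]
    have := ha.1 i hi
    cases i <;> simp [nodeMark, this]
  · intro i hi r hr
    rw [hk] at hi
    rw [ha.1 i hi] at hr
    rw [ha.2 i (hs hi), ha.2 (r :: i) (cons_mem_nodes.2 ⟨hi, hr⟩)]
    exact h.edge i hi r hr

end Agree

section MeasurableTree

variable {A : Type*} [MeasurableSpace A]

theorem measurable_offspring (i : List ℕ) : Measurable fun t : TreeData A => (t i).1 :=
  measurable_fst.comp (measurable_pi_apply i)

theorem measurable_label (i : List ℕ) : Measurable fun t : TreeData A => (t i).2 :=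
  measurable_snd.comp (measurable_pi_apply i)

theorem measurableSet_isNode (i : List ℕ) : MeasurableSet {t : TreeData A | IsNode t i} := by
  induction i with
  | nil => simp [IsNode]
  | cons r i ih =>
    exact ih.inter (measurableSet_lt measurable_const (measurable_offspring i))

theorem measurableSet_mem_nodes (k : ℕ) (i : List ℕ) :
    MeasurableSet {t : TreeData A | i ∈ nodes t k} := by
  simp only [mem_nodes]
  exact (measurableSet_isNode i).inter (MeasurableSet.const _)

theorem measurableSet_injOn {n : ℕ} (k : ℕ) :
    MeasurableSet {t : TreeData (Fin n) | Set.InjOn (fun i => (t i).2) (nodes t k)} := by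
  have : {t : TreeData (Fin n) | Set.InjOn (fun i => (t i).2) (nodes t k)} =
      ⋂ i : List ℕ, ⋂ j : List ℕ, {t | i ∈ nodes t k}ᶜ ∪ ({t | j ∈ nodes t k}ᶜ ∪
        ({t | (t i).2 = (t j).2}ᶜ ∪ {_t | i = j})) := by
    ext t
    simp only [Set.InjOn, Set.mem_iInter, Set.mem_union, Set.mem_compl_iff, Set.mem_ofPred_eq,
      Finset.mem_coe]
    refine forall_congr' fun i => ?_
    constructor
    · intro h j
      simp only [← imp_iff_not_or]
      exact fun hi hj hij => h hi hj hij
    · intro h hi j hj hij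
      simp only [← imp_iff_not_or] at h
      exact h j hi hj hij
  rw [this]
  refine MeasurableSet.iInter fun i => MeasurableSet.iInter fun j => ?_
  exact (measurableSet_mem_nodes k i).compl.union ((measurableSet_mem_nodes k j).compl.union
    ((measurableSet_eq_fun (measurable_label i) (measurable_label j)).compl.union
      (MeasurableSet.const _)))

theorem measurableSet_matches {n : ℕ} (k : ℕ) (e : Fin n → Fin n → ℕ) (v : Fin n) :
    MeasurableSet {t : TreeData (Fin n) | Matches k e v t} := by
  have : {t : TreeData (Fin n) | Matches k e v t} =
      {_t | ∀ i j, e i j = e j i} ∩ ({t | (t []).2 = v} ∩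
        ({t | Set.InjOn (fun i => (t i).2) (nodes t (k + 1))} ∩
        ⋂ i : List ℕ, {t | i ∈ nodes t k}ᶜ ∪ ({t | degree e (t i).2 = (nodeMark t i).1} ∩
          ⋂ r : ℕ, {t | r < (t i).1}ᶜ ∪ {t | e (t i).2 (t (r :: i)).2 ≠ 0}))) := by
    ext t
    simp only [Set.mem_inter_iff, Set.mem_iInter, Set.mem_union, Set.mem_compl_iff,
      Set.mem_ofPred_eq]
    constructor
    · intro h
      refine ⟨h.symm, h.root, h.inj, fun i => or_iff_not_imp_left.2 fun hi => ?_⟩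
      rw [not_not] at hi
      refine ⟨h.deg i hi, fun r => or_iff_not_imp_left.2 fun hr => ?_⟩
      exact h.edge i hi r (not_not.1 hr)
    · rintro ⟨h1, h2, h3, h4⟩
      refine ⟨h1, h2, h3, fun i hi => ?_, fun i hi r hr => ?_⟩
      · exact ((h4 i).resolve_left (not_not.2 hi)).1
      · exact (((h4 i).resolve_left (not_not.2 hi)).2 r).resolve_left (not_not.2 hr)
  have hlab : ∀ i, Measurable fun t : TreeData (Fin n) => (t i).2 := measurable_label
  rw [this]
  refine (MeasurableSet.const _).inter ((measurableSet_eq_fun (hlab []) measurable_const).inter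
    ((measurableSet_injOn (k + 1)).inter (MeasurableSet.iInter fun i => ?_)))
  refine (measurableSet_mem_nodes k i).compl.union (MeasurableSet.inter ?_
    (MeasurableSet.iInter fun r => ?_))
  · refine measurableSet_eq_fun ((measurable_of_countable (degree e)).comp (hlab i)) ?_
    cases i with
    | nil => exact measurable_offspring []
    | cons r i => exact (measurable_offspring (r :: i)).add_const 1
  · refine (measurableSet_lt measurable_const (measurable_offspring i)).compl.union ?_
    have h2 : Measurable fun t : TreeData (Fin n) => e (t i).2 (t (r :: i)).2 :=
      (measurable_of_countable (fun p : Fin n × Fin n => e p.1 p.2)).comp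
        ((hlab i).prodMk (hlab (r :: i)))
    exact (measurableSet_eq_fun h2 measurable_const).compl

/-- The law of a delayed Galton–Watson tree whose nodes are independent, with law `root` for the
root and `node` for all the other nodes. -/
noncomputable def treeLaw (root node : Measure (ℕ × A)) : Measure (TreeData A) :=
  Measure.infinitePi fun i => if i = [] then root else node

instance (root node : Measure (ℕ × A)) [IsProbabilityMeasure root] [IsProbabilityMeasure node]
    (i : List ℕ) : IsProbabilityMeasure (if i = [] then root else node) := by
  split_ifs <;> infer_instance

instance (root node : Measure (ℕ × A)) [IsProbabilityMeasure root] [IsProbabilityMeasure node] :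
    IsProbabilityMeasure (treeLaw root node) := by
  unfold treeLaw; infer_instance

variable (root node : Measure (ℕ × A)) [IsProbabilityMeasure root] [IsProbabilityMeasure node]

theorem treeLaw_box (s : Finset (List ℕ)) {B : List ℕ → Set (ℕ × A)}
    (hB : ∀ i ∈ s, MeasurableSet (B i)) :
    treeLaw root node {t | ∀ i ∈ s, t i ∈ B i} =
      ∏ i ∈ s, (if i = [] then root else node) (B i) := by
  have : {t : TreeData A | ∀ i ∈ s, t i ∈ B i} = Set.pi s B := by ext; simp [Set.mem_pi]
  rw [this, treeLaw, Measure.infinitePi_pi _ hB]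

theorem treeLaw_apply (i : List ℕ) {B : Set (ℕ × A)} (hB : MeasurableSet B) :
    treeLaw root node {t | t i ∈ B} = (if i = [] then root else node) B := by
  simpa using treeLaw_box root node {i} (B := fun _ => B) fun _ _ => hB

theorem treeLaw_apply_pair {i j : List ℕ} (hij : i ≠ j) {B C : Set (ℕ × A)}
    (hB : MeasurableSet B) (hC : MeasurableSet C) :
    treeLaw root node {t | t i ∈ B ∧ t j ∈ C} =
      (if i = [] then root else node) B * (if j = [] then root else node) C := by
  have := treeLaw_box root node {i, j} (B := fun l => if l = i then B else C) fun l _ => by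
    split_ifs
    · exact hB
    · exact hC
  rw [Finset.prod_pair hij] at this
  simpa [hij.symm] using this

end MeasurableTree

/-! ### Coupling of the configuration model with degrees `d` and the tree of stubs -/

/-- The labelled version of `nodeLawCM`: the law of `(d j - 1, j)` for a size-biased `j`. -/
noncomputable def labelLawCM {n : ℕ} (d : Fin n → ℕ) : Measure (ℕ × Fin n) :=
  ∑ j, sizeBias (fun j => (d j : ℝ≥0)) j • Measure.dirac (d j - 1, j)

section StubTree

variable {n : ℕ} {d : Fin n → ℕ} {v : Fin n}

/-- The labelled tree in which the node `i ≠ ∅` is attached to its parent by the stub `s i`. -/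
def stubTree (v : Fin n) (s : List ℕ → Stub d) : TreeData (Fin n) :=
  fun i => if i = [] then (d v, v) else (d (s i).1 - 1, (s i).1)

@[simp] theorem stubTree_nil (s : List ℕ → Stub d) : stubTree v s [] = (d v, v) := by
  simp [stubTree]

@[simp] theorem stubTree_cons (s : List ℕ → Stub d) (r : ℕ) (i : List ℕ) :
    stubTree v s (r :: i) = (d (s (r :: i)).1 - 1, (s (r :: i)).1) := by
  simp [stubTree]

/-- The `r`-th stub of the vertex `j`. -/
def nthStub (j : Fin n) (r : ℕ) (s : Stub d) : Stub d :=
  -- The fallback `s` is only reached for labels that are not nodes of the tree.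
  if h : r < d j then ⟨j, r, h⟩ else s

/-- The stub by which the parent of the node is attached to the node. -/
def parentStub (v : Fin n) (s : List ℕ → Stub d) : List ℕ → Stub d
  | [] => s []
  | [r] => nthStub v r (s [r])
  | r :: q :: i => nthStub (s (q :: i)).1 (if r < (s (q :: i)).2 then r else r + 1) (s (r :: q :: i))

theorem slot_lt {a : ℕ} {r x : ℕ} (hr : r < a - 1) : (if r < x then r else r + 1) < a := by
  split_ifs <;> omega

theorem parentStub_fst {s : List ℕ → Stub d} {r : ℕ} {i : List ℕ} (hr : r < (stubTree v s i).1) :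
    (parentStub v s (r :: i)).1 = (stubTree v s i).2 := by
  cases i with
  | nil =>
    rw [stubTree_nil] at hr
    simp [parentStub, nthStub, show r < d v from hr]
  | cons q i =>
    rw [stubTree_cons] at hr
    simp [parentStub, nthStub, slot_lt (x := (s (q :: i)).2) hr]

theorem parentStub_ne {s : List ℕ → Stub d} {r q : ℕ} {i : List ℕ}
    (hr : r < (stubTree v s (q :: i)).1) : parentStub v s (r :: q :: i) ≠ s (q :: i) := by
  rw [stubTree_cons] at hr
  intro h
  rw [parentStub, nthStub, dif_pos (slot_lt hr)] at h
  have h2 := congrArg (fun z : Stub d => (z.2 : ℕ)) h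
  simp only at h2
  split_ifs at h2 <;> omega

theorem parentStub_inj {s : List ℕ → Stub d} {r r' : ℕ} {i : List ℕ}
    (hr : r < (stubTree v s i).1) (hr' : r' < (stubTree v s i).1)
    (h : parentStub v s (r :: i) = parentStub v s (r' :: i)) : r = r' := by
  cases i with
  | nil =>
    rw [stubTree_nil] at hr hr'
    rw [parentStub, parentStub, nthStub, nthStub, dif_pos hr, dif_pos hr'] at h
    exact congrArg (fun z : Stub d => (z.2 : ℕ)) h
  | cons q i =>
    rw [stubTree_cons] at hr hr'
    rw [parentStub, parentStub, nthStub, nthStub, dif_pos (slot_lt hr), dif_pos (slot_lt hr')] at h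
    have h2 := congrArg (fun z : Stub d => (z.2 : ℕ)) h
    simp only at h2
    split_ifs at h2 <;> omega

theorem partner_unique {h : List (Stub d × Stub d)} (hh : (stubList h).Nodup) {x y z : Stub d}
    (hy : (x, y) ∈ h ∨ (y, x) ∈ h) (hz : (x, z) ∈ h ∨ (z, x) ∈ h) : y = z := by
  have hmem : ∀ {l : List (Stub d × Stub d)} {a b : Stub d}, (a, b) ∈ l →
      a ∈ stubList l ∧ b ∈ stubList l := fun hl =>
    ⟨List.mem_flatMap.2 ⟨_, hl, by simp⟩, List.mem_flatMap.2 ⟨_, hl, by simp⟩⟩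
  induction h with
  | nil => simp at hy
  | cons p h ih =>
    obtain ⟨p1, p2⟩ := p
    rw [stubList_cons, List.nodup_cons, List.nodup_cons, List.mem_cons, not_or] at hh
    simp only [List.mem_cons, Prod.mk.injEq] at hy hz
    have := ih hh.2.2
    have h1 := hh.1.2
    have h2 := hh.2.1
    rcases hy with (⟨rfl, rfl⟩ | hy) | (⟨rfl, rfl⟩ | hy) <;>
      rcases hz with (⟨h3, h4⟩ | hz) | (⟨h3, h4⟩ | hz) <;>
      first
        | exact (h4.trans ‹_›).symm
        | exact this (Or.inl hy) (Or.inl hz)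
        | exact this (Or.inl hy) (Or.inr hz)
        | exact this (Or.inr hy) (Or.inl hz)
        | exact this (Or.inr hy) (Or.inr hz)
        | (have := hmem hz; grind)
        | (have := hmem hy; grind)
        | grind

/-- The nodes other than the root of the first `k + 1` generations of the stub tree. -/
def stubIndex (k : ℕ) (v : Fin n) (s : List ℕ → Stub d) : Finset (List ℕ) :=
  (nodes (stubTree v s) (k + 1)).erase []

/-- The first `k + 1` generations of the stub tree. -/
def stubShape (k : ℕ) (v : Fin n) (s : List ℕ → Stub d) : Finset (List ℕ × Stub d) :=
  (stubIndex k v s).image fun i => (i, s i)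

theorem mem_stubShape {k : ℕ} {s : List ℕ → Stub d} {p : List ℕ × Stub d} :
    p ∈ stubShape k v s ↔ p.1 ∈ nodes (stubTree v s) (k + 1) ∧ p.1 ≠ [] ∧ s p.1 = p.2 := by
  simp only [stubShape, stubIndex, Finset.mem_image, Finset.mem_erase]
  constructor
  · rintro ⟨i, ⟨h1, h2⟩, rfl⟩
    exact ⟨h2, h1, rfl⟩
  · rintro ⟨h1, h2, h3⟩
    exact ⟨p.1, ⟨h2, h1⟩, Prod.ext rfl h3⟩

theorem stub_eq_of_shape_eq {k : ℕ} {s s' : List ℕ → Stub d} (h : stubShape k v s = stubShape k v s')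
    {i : List ℕ} (hi : i ∈ stubIndex k v s) : s' i = s i := by
  have h1 : (i, s i) ∈ stubShape k v s := Finset.mem_image_of_mem _ hi
  rw [h, mem_stubShape] at h1
  exact h1.2.2

theorem agree_of_shape_eq {k : ℕ} {s s' : List ℕ → Stub d}
    (h : stubShape k v s = stubShape k v s') : Agree k (stubTree v s) (stubTree v s') := by
  have key : ∀ i ∈ nodes (stubTree v s) (k + 1), stubTree v s' i = stubTree v s i := by
    intro i hi
    cases i with
    | nil => simp
    | cons r i =>
      simp only [stubTree_cons]
      rw [stub_eq_of_shape_eq h (Finset.mem_erase.2 ⟨by simp, hi⟩)]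
  exact ⟨fun i hi => by rw [key i (nodes_mono _ (Nat.le_succ k) hi)], fun i hi => by rw [key i hi]⟩

/-- The list `h` of pairs of stubs contains the edges of the first `k + 1` generations of the stub
tree `s`, whose nodes are distinct vertices. -/
structure StubMatch (k : ℕ) (v : Fin n) (h : List (Stub d × Stub d)) (s : List ℕ → Stub d) :
    Prop where
  nodup : (stubList h).Nodup
  inj : Set.InjOn (fun i => (stubTree v s i).2) (nodes (stubTree v s) (k + 1))
  pairs : ∀ i ∈ stubIndex k v s, (parentStub v s i, s i) ∈ h ∨ (s i, parentStub v s i) ∈ h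

/-- The pairing reveals the tree generation by generation: the stub pointing from a known parent to
its `r`-th child is known, and by `partner_unique` its partner is the stub of the child. -/
theorem StubMatch.forall_mem {k : ℕ} {h : List (Stub d × Stub d)} {s s' : List ℕ → Stub d}
    (hs : StubMatch k v h s) (hs' : StubMatch k v h s') (i : List ℕ)
    (hi : i ∈ nodes (stubTree v s) (k + 1)) :
    i ∈ nodes (stubTree v s') (k + 1) ∧ (i ≠ [] → s' i = s i) := by
  induction i with
  | nil => exact ⟨nil_mem_nodes _ _, by simp⟩
  | cons r i ih =>
    obtain ⟨hik, hr⟩ := cons_mem_nodes.1 hi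
    obtain ⟨hi1, hi2⟩ := ih (nodes_mono _ (Nat.le_succ k) hik)
    have ht : stubTree v s' i = stubTree v s i := by
      cases i with
      | nil => simp
      | cons q i => simp only [stubTree_cons]; rw [hi2 (by simp)]
    have hm : r :: i ∈ nodes (stubTree v s') (k + 1) := by
      refine cons_mem_nodes.2 ⟨mem_nodes.2 ⟨(mem_nodes.1 hi1).1, (mem_nodes.1 hik).2⟩, ?_⟩
      rwa [ht]
    refine ⟨hm, fun _ => ?_⟩
    have hp : parentStub v s' (r :: i) = parentStub v s (r :: i) := by
      cases i with
      | nil =>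
        rw [stubTree_nil] at hr
        simp [parentStub, nthStub, show r < d v from hr]
      | cons q i =>
        rw [stubTree_cons] at hr
        rw [parentStub, parentStub, hi2 (by simp), nthStub, nthStub, dif_pos (slot_lt hr),
          dif_pos (slot_lt hr)]
    have h1 := hs.pairs (r :: i) (Finset.mem_erase.2 ⟨by simp, hi⟩)
    have h2 := hs'.pairs (r :: i) (Finset.mem_erase.2 ⟨by simp, hm⟩)
    rw [hp] at h2
    exact partner_unique hs.nodup h2 h1

theorem StubMatch.shape_eq {k : ℕ} {h : List (Stub d × Stub d)} {s s' : List ℕ → Stub d}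
    (hs : StubMatch k v h s) (hs' : StubMatch k v h s') : stubShape k v s = stubShape k v s' := by
  have key : ∀ {s s' : List ℕ → Stub d}, StubMatch k v h s → StubMatch k v h s' →
      stubShape k v s ⊆ stubShape k v s' := by
    intro s s' hs hs' p hp
    rw [mem_stubShape] at hp ⊢
    obtain ⟨h1, h2⟩ := hs.forall_mem hs' p.1 hp.1
    exact ⟨h1, hp.2.1, (h2 hp.2.1).trans hp.2.2⟩
  exact Finset.Subset.antisymm (key hs hs') (key hs' hs)

theorem card_le_degree (e : Fin n → Fin n → ℕ) (u : Fin n) (B : Finset (Fin n))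
    (hB : ∀ w ∈ B, e u w ≠ 0) : B.card ≤ degree e u := by
  have h1 : B.card ≤ ∑ w ∈ B, e u w := by
    rw [Finset.card_eq_sum_ones]
    exact Finset.sum_le_sum fun w hw => Nat.one_le_iff_ne_zero.2 (hB w hw)
  have h2 : ∑ w ∈ B, e u w ≤ ∑ w, e u w :=
    Finset.sum_le_sum_of_subset (Finset.subset_univ B)
  unfold degree; omega

/-- A vertex cannot use more stubs than it has, which bounds its degree from above; its distinct
tree neighbours bound it from below. -/
theorem StubMatch.matches {k : ℕ} {h : List (Stub d × Stub d)} {s : List ℕ → Stub d}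
    (hs : StubMatch k v h s) : Matches k (pairGraph h) v (stubTree v s) := by
  have hedge : ∀ i ∈ nodes (stubTree v s) k, ∀ r < (stubTree v s i).1,
      pairGraph h (stubTree v s i).2 (stubTree v s (r :: i)).2 ≠ 0 := by
    intro i hi r hr
    rw [← parentStub_fst hr, stubTree_cons]
    rcases hs.pairs (r :: i) (Finset.mem_erase.2 ⟨by simp, cons_mem_nodes.2 ⟨hi, hr⟩⟩) with h1 | h1
    · exact pairGraph_ne_zero h1
    · rw [pairGraph_comm]
      exact pairGraph_ne_zero h1
  refine ⟨pairGraph_comm h, by simp, hs.inj, fun i hi => le_antisymm ?_ ?_, hedge⟩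
  · refine (degree_pairGraph_le hs.nodup _).trans ?_
    cases i with
    | nil => simp [nodeMark]
    | cons r i => simp only [nodeMark, stubTree_cons]; omega
  · rw [← card_treeNbrs, ← Finset.card_image_of_injOn
      (hs.inj.mono (Finset.coe_subset.2 (treeNbrs_subset hi)))]
    refine card_le_degree _ _ _ fun w hw => ?_
    obtain ⟨j, hj, rfl⟩ := Finset.mem_image.1 hw
    rcases Finset.mem_union.1 hj with h' | h'
    · obtain ⟨r, hr, rfl⟩ := mem_children.1 h'
      exact hedge i hi r hr
    · obtain ⟨r, rfl⟩ := mem_parentSet.1 h'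
      rw [pairGraph_comm]
      have := mem_nodes.1 hi
      simp only [IsNode, List.length_cons] at this
      exact hedge j (mem_nodes.2 ⟨this.1.1, by omega⟩) r this.1.2

/-- When the labels are distinct, all stubs used by the tree edges are distinct, on the side of the
children as well as on that of the parents, so the bound on prescribed pairs applies. -/
theorem inv_pow_le_stubMatch (pick : PickRule d) (heven : Even (∑ i, d i)) (k : ℕ)
    (s : List ℕ → Stub d)
    (hs : Set.InjOn (fun i => (stubTree v s i).2) (nodes (stubTree v s) (k + 1))) :
    ((∑ i, d i : ℕ) : ℝ≥0∞)⁻¹ ^ (stubIndex k v s).card ≤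
      (pairStubs pick ((∑ i, d i) / 2) []).toOuterMeasure {h | StubMatch k v h s} := by
  have hidx : ∀ i ∈ stubIndex k v s, i ∈ nodes (stubTree v s) (k + 1) ∧
      ∃ r j, i = r :: j ∧ j ∈ nodes (stubTree v s) (k + 1) ∧ r < (stubTree v s j).1 := by
    intro i hi
    obtain ⟨h1, h2⟩ := Finset.mem_erase.1 hi
    refine ⟨h2, ?_⟩
    cases i with
    | nil => exact absurd rfl h1
    | cons r j =>
      have := cons_mem_nodes.1 h2
      exact ⟨r, j, rfl, nodes_mono _ (Nat.le_succ k) this.1, this.2⟩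
  have hlab : ∀ i ∈ stubIndex k v s, (stubTree v s i).2 = (s i).1 := by
    intro i hi
    obtain ⟨-, r, j, rfl, -⟩ := hidx i hi
    simp
  refine (inv_pow_le_pairStubs pick heven (parentStub v s) s (stubIndex k v s) ?_ ?_ ?_).trans
    (measure_mono fun h hh => ⟨hh.1, hs, hh.2⟩)
  · intro i hi i' hi' hii
    obtain ⟨-, r, j, rfl, hj, hr⟩ := hidx i hi
    obtain ⟨-, r', j', rfl, hj', hr'⟩ := hidx i' hi'
    have h1 := congrArg Sigma.fst hii
    rw [parentStub_fst hr, parentStub_fst hr'] at h1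
    obtain rfl := hs hj hj' h1
    rw [parentStub_inj hr hr' hii]
  · intro i hi i' hi' hii
    refine hs (hidx i hi).1 (hidx i' hi').1 ?_
    change (stubTree v s i).2 = (stubTree v s i').2
    rw [hlab i hi, hlab i' hi', hii]
  · intro i hi i' hi' hii
    obtain ⟨-, r, j, rfl, hj, hr⟩ := hidx i hi
    obtain ⟨hi'1, r', j', rfl, -⟩ := hidx i' hi'
    have h1 := congrArg Sigma.fst hii
    rw [parentStub_fst hr, ← hlab _ hi'] at h1
    obtain rfl := hs hj hi'1 h1
    exact parentStub_ne hr hii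

end StubTree

/-! ### Uniform stubs and the coupling for fixed degrees. -/

section StubLaw

variable {n : ℕ} {d : Fin n → ℕ}

instance : DiscreteMeasurableSpace (Stub d) :=
  ⟨fun s => by
    refine MeasurableSpace.measurableSet_iInf.2 fun i => ?_
    exact MeasurableSet.of_discrete (α := Fin (d i))⟩

instance : MeasurableSpace (List (Stub d × Stub d)) := ⊤

instance : DiscreteMeasurableSpace (List (Stub d × Stub d)) := ⟨fun _ => trivial⟩

/-- The uniform distribution on the stubs. -/
noncomputable def stubLaw (d : Fin n → ℕ) : Measure (Stub d) :=
  ((∑ i, d i : ℕ) : ℝ≥0∞)⁻¹ • ∑ s : Stub d, Measure.dirac s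

theorem stubLaw_singleton (s : Stub d) : stubLaw d {s} = ((∑ i, d i : ℕ) : ℝ≥0∞)⁻¹ := by
  classical
  simp [stubLaw, Measure.finsetSum_apply, Set.indicator_apply]

theorem card_stub_ne_zero [Nonempty (Stub d)] : ∑ i, d i ≠ 0 := by
  have : Fintype.card (Stub d) = ∑ i, d i := by simp
  rw [← this]
  exact Fintype.card_ne_zero

instance [Nonempty (Stub d)] : IsProbabilityMeasure (stubLaw d) := by
  constructor
  rw [stubLaw, Measure.smul_apply, Measure.finsetSum_apply]
  simp only [measure_univ, Finset.sum_const, Finset.card_univ, Fintype.card_sigma,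
    Fintype.card_fin, smul_eq_mul, nsmul_eq_mul, mul_one]
  exact ENNReal.inv_mul_cancel (Nat.cast_ne_zero.2 card_stub_ne_zero) (ENNReal.natCast_ne_top _)

theorem sizeBias_nat (d : Fin n → ℕ) (hd : ∑ i, d i ≠ 0) (j : Fin n) :
    sizeBias (fun j => (d j : ℝ≥0)) j = (d j : ℝ≥0∞) * ((∑ i, d i : ℕ) : ℝ≥0∞)⁻¹ := by
  have h0 : ∑ i, (d i : ℝ≥0) ≠ 0 := by exact_mod_cast hd
  rw [sizeBias, if_neg h0, ENNReal.coe_div h0, div_eq_mul_inv]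
  push_cast
  rfl

theorem stubLaw_map (hd : ∑ i, d i ≠ 0) :
    (stubLaw d).map (fun s => (d s.1 - 1, s.1)) = labelLawCM d := by
  ext B hB
  rw [Measure.map_apply Measurable.of_discrete hB, stubLaw, labelLawCM, Measure.smul_apply,
    Measure.finsetSum_apply, Measure.finsetSum_apply, Finset.univ_sigma_univ.symm,
    Finset.sum_sigma, smul_eq_mul, Finset.mul_sum]
  refine Finset.sum_congr rfl fun j _ => ?_
  rw [Measure.smul_apply, sizeBias_nat d hd, Measure.dirac_apply' _ hB, smul_eq_mul]
  simp only [Measure.dirac_apply' _ (MeasurableSet.of_discrete)]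
  have : ∀ x ∈ (Finset.univ : Finset (Fin (d j))),
      ((fun s : Stub d => (d s.1 - 1, s.1)) ⁻¹' B).indicator (1 : Stub d → ℝ≥0∞) ⟨j, x⟩ =
        B.indicator 1 (d j - 1, j) := fun _ _ => rfl
  rw [Finset.sum_congr rfl this, Finset.sum_const, Finset.card_univ, Fintype.card_fin, nsmul_eq_mul]
  ring

theorem sum_sizeBias (hn : n ≠ 0) (w : Fin n → ℝ≥0) : ∑ j, sizeBias w j = 1 := by
  by_cases h : ∑ j, w j = 0
  · simp only [sizeBias, if_pos h, Finset.sum_const, Finset.card_univ, Fintype.card_fin,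
      nsmul_eq_mul]
    exact ENNReal.mul_inv_cancel (Nat.cast_ne_zero.2 hn) (ENNReal.natCast_ne_top _)
  · simp only [sizeBias, if_neg h]
    rw [← ENNReal.ofNNReal_finsetSum, ← Finset.sum_div, div_self h, ENNReal.coe_one]

theorem isProbabilityMeasure_labelLawCM (hn : n ≠ 0) (d : Fin n → ℕ) :
    IsProbabilityMeasure (labelLawCM d) := by
  constructor
  rw [labelLawCM, Measure.finsetSum_apply]
  simp only [Measure.smul_apply, measure_univ, smul_eq_mul, mul_one]
  exact sum_sizeBias hn _

variable {v : Fin n}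

theorem measurable_stubTree : Measurable (stubTree v : (List ℕ → Stub d) → TreeData (Fin n)) := by
  refine measurable_pi_lambda _ fun i => ?_
  unfold stubTree
  split_ifs
  · exact measurable_const
  · exact (Measurable.of_discrete (f := fun s : Stub d => (d s.1 - 1, s.1))).comp
      (measurable_pi_apply i)

/-- The vertex of a uniform stub is size-biased, so the tree of independent uniform stubs has the
law of the labelled tree. -/
theorem map_stubTree [Nonempty (Stub d)] :
    (Measure.infinitePi fun _ : List ℕ => stubLaw d).map (stubTree v) =
      treeLaw (Measure.dirac (d v, v)) (labelLawCM d) := by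
  have h := Measure.infinitePi_map_pi (fun _ : List ℕ => stubLaw d)
    (f := fun i s => if i = [] then (d v, v) else (d s.1 - 1, s.1))
    (fun i => Measurable.of_discrete)
  refine h.trans ?_
  rw [treeLaw]
  congr 1
  ext1 i
  by_cases hi : i = []
  · simp [hi]
  · simp only [hi, if_false]
    exact stubLaw_map card_stub_ne_zero

theorem measurable_stubShape (k : ℕ) [MeasurableSpace (Finset (List ℕ × Stub d))] :
    Measurable (stubShape k v : (List ℕ → Stub d) → Finset (List ℕ × Stub d)) := by
  refine measurable_to_countable' fun F => ?_
  have : stubShape k v ⁻¹' {F} = ⋂ p : List ℕ × Stub d,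
      {s : List ℕ → Stub d | (p.1 ∈ nodes (stubTree v s) (k + 1) ∧ p.1 ≠ [] ∧ s p.1 = p.2) ↔
        p ∈ F} := by
    ext s
    simp only [Set.mem_preimage, Set.mem_singleton_iff, Finset.ext_iff, mem_stubShape,
      Set.mem_iInter, Set.mem_ofPred_eq]
  rw [this]
  refine MeasurableSet.iInter fun p => MeasurableSet.iff ?_ (MeasurableSet.const _)
  refine ((measurableSet_mem_nodes (k + 1) p.1).preimage measurable_stubTree).inter
    ((MeasurableSet.const _).inter ?_)
  exact measurableSet_eq_fun (measurable_pi_apply p.1) measurable_const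

/-- A shape prescribes one of the `L` stubs, independently, at each of its nodes other than the
root. -/
theorem infinitePi_shape_le [Nonempty (Stub d)] (k : ℕ) (s : List ℕ → Stub d) :
    (Measure.infinitePi fun _ : List ℕ => stubLaw d) (stubShape k v ⁻¹' {stubShape k v s}) ≤
      ((∑ i, d i : ℕ) : ℝ≥0∞)⁻¹ ^ (stubIndex k v s).card := by
  have hsub : stubShape k v ⁻¹' {stubShape k v s} ⊆
      Set.pi (stubIndex k v s) fun i => {s i} := by
    intro s' hs' i hi
    exact stub_eq_of_shape_eq (Eq.symm hs') hi
  refine (measure_mono hsub).trans (le_of_eq ?_)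
  rw [Measure.infinitePi_pi _ fun i _ => MeasurableSet.of_discrete]
  simp only [stubLaw_singleton, Finset.prod_const]

/-- The configuration model with fixed degrees and the label tree can be coupled in such a way that
they match whenever the nodes of the tree are distinct vertices. -/
theorem exists_coupling_CM (pick : PickRule d) (heven : Even (∑ i, d i)) (v : Fin n) (k : ℕ) :
    ∃ π : Measure ((Fin n → Fin n → ℕ) × TreeData (Fin n)), IsProbabilityMeasure π ∧
      π.map Prod.fst = (cmLaw pick).toMeasure ∧
      π.map Prod.snd = treeLaw (Measure.dirac (d v, v)) (labelLawCM d) ∧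
      treeLaw (Measure.dirac (d v, v)) (labelLawCM d)
        {t | Set.InjOn (fun i => (t i).2) (nodes t (k + 1))} ≤
        π {x | Matches k x.1 v x.2} := by
  have hn : n ≠ 0 := by rintro rfl; exact v.elim0
  have := isProbabilityMeasure_labelLawCM hn d
  by_cases hne : Nonempty (Stub d)
  · let _ : MeasurableSpace (Finset (List ℕ × Stub d)) := ⊤
    have _ : DiscreteMeasurableSpace (Finset (List ℕ × Stub d)) := ⟨fun _ => trivial⟩
    let μ : Measure (List (Stub d × Stub d)) := (pairStubs pick ((∑ i, d i) / 2) []).toMeasure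
    let ν : Measure (List ℕ → Stub d) := Measure.infinitePi fun _ : List ℕ => stubLaw d
    obtain ⟨π, h1, h2, h3, h4⟩ := exists_coupling_of_relation (Kernel.const Unit μ)
      (Kernel.const Unit ν) (measurable_stubShape (v := v) k) (StubMatch k v)
      (fun x y y' => StubMatch.shape_eq)
    have hmeas : Measurable (Prod.map (pairGraph (d := d)) (stubTree (d := d) v)) :=
      Measurable.of_discrete.prodMap measurable_stubTree
    refine ⟨(π ()).map (Prod.map pairGraph (stubTree v)),
      Measure.isProbabilityMeasure_map hmeas.aemeasurable, ?_, ?_, ?_⟩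
    · rw [Measure.map_map measurable_fst hmeas, cmLaw, ← PMF.toMeasure_map _ _ Measurable.of_discrete]
      have := h2 ()
      rw [Kernel.const_apply] at this
      change _ = μ.map _
      rw [← this, Measure.map_map Measurable.of_discrete measurable_fst]
      rfl
    · rw [Measure.map_map measurable_snd hmeas, ← map_stubTree]
      have := h3 ()
      rw [Kernel.const_apply] at this
      change _ = ν.map _
      rw [← this, Measure.map_map measurable_stubTree measurable_snd]
      rfl
    · rw [← map_stubTree, Measure.map_apply measurable_stubTree (measurableSet_injOn (k + 1))]
      refine le_trans ?_ (Measure.le_map_apply hmeas.aemeasurable _)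
      -- The ratio is `1`: the two powers of `1 / L` coincide, and only trees with repeated vertices
      -- are lost.
      have key := h4 () 1 (stubTree v ⁻¹' {t | Set.InjOn (fun i => (t i).2) (nodes t (k + 1))})
        le_rfl (fun s hs => ?_)
      · rw [one_mul, Kernel.const_apply] at key
        refine key.trans (measure_mono ?_)
        rintro ⟨h, s⟩ ⟨s', hs', hss⟩
        exact hs'.matches.congr (agree_of_shape_eq hss)
      · rw [one_mul, Kernel.const_apply, Kernel.const_apply]
        refine (infinitePi_shape_le k s).trans ((inv_pow_le_stubMatch pick heven k s hs).trans ?_)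
        exact PMF.toOuterMeasure_apply_le_toMeasure_apply _ _
  · have hd : ∀ j, d j = 0 := by
      intro j
      by_contra hj
      exact hne ⟨⟨j, 0, Nat.pos_of_ne_zero hj⟩⟩
    have hlaw : cmLaw pick = PMF.pure fun _ _ => 0 := by
      rw [cmLaw]
      simp only [hd, Finset.sum_const_zero, Nat.zero_div, pairStubs, PMF.pure_map]
      rfl
    have hmeas : Measurable fun t : TreeData (Fin n) => ((fun _ _ => 0 : Fin n → Fin n → ℕ), t) :=
      measurable_prodMk_left
    refine ⟨(treeLaw (Measure.dirac (d v, v)) (labelLawCM d)).map fun t => (fun _ _ => 0, t),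
      Measure.isProbabilityMeasure_map hmeas.aemeasurable, ?_, ?_, ?_⟩
    · rw [Measure.map_map measurable_fst hmeas, hlaw, PMF.toMeasure_pure]
      exact (Measure.map_const _ _).trans (by simp)
    · rw [Measure.map_map measurable_snd hmeas]
      exact Measure.map_id
    · refine le_trans ?_ (Measure.le_map_apply hmeas.aemeasurable _)
      have h0 : treeLaw (Measure.dirac (d v, v)) (labelLawCM d) {t | t [] ∈ ({(d v, v)} : Set _)} = 1 := by
        rw [treeLaw_apply _ _ _ (measurableSet_singleton _), if_pos rfl]
        simp
      refine prob_le_one.trans (h0.symm.le.trans (measure_mono ?_))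
      intro t ht
      have ht0 : t [] = (0, v) := by rw [← hd v]; exact ht
      change Matches k (fun _ _ => 0) v t
      have hnodes : ∀ k, nodes t k ⊆ {[]} := by
        intro k
        induction k with
        | zero => simp [nodes]
        | succ k ih =>
          rw [nodes, Finset.insert_subset_iff]
          refine ⟨by simp, Finset.biUnion_subset.2 fun i hi => ?_⟩
          rw [Finset.mem_singleton.1 (ih hi), children, ht0]
          simp
      refine ⟨fun _ _ => rfl, by rw [ht0], fun i hi j hj _ => ?_, fun i hi => ?_, fun i hi r hr => ?_⟩
      · rw [Finset.mem_singleton.1 (hnodes _ hi), Finset.mem_singleton.1 (hnodes _ hj)]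
      · rw [Finset.mem_singleton.1 (hnodes _ hi)]
        simp [degree, nodeMark, ht0]
      · rw [Finset.mem_singleton.1 (hnodes _ hi), ht0] at hr
        simp at hr

end StubLaw

/-! ### Inhomogeneous random graphs: probabilities of local events -/

section BernoulliGraph

variable {n : ℕ}

instance : DiscreteMeasurableSpace (SimpleGraph (Fin n)) := by
  refine ⟨fun s => ?_⟩
  have hsing : ∀ H : SimpleGraph (Fin n), MeasurableSet {H} := by
    intro H
    have : {H} = ⋂ u, ⋂ v, {G : SimpleGraph (Fin n) | G.Adj u v ↔ H.Adj u v} := by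
      ext G
      simp only [Set.mem_singleton_iff, Set.mem_iInter, Set.mem_ofPred_eq, SimpleGraph.ext_iff,
        funext_iff, eq_iff_iff]
    rw [this]
    refine MeasurableSet.iInter fun u => MeasurableSet.iInter fun v => ?_
    exact MeasurableSet.iff (measurableSet_setOfPred.2 (SimpleGraph.measurable_iff_adj.1 measurable_id u v))
      (MeasurableSet.const _)
  rw [← Set.biUnion_of_singleton s]
  exact MeasurableSet.biUnion (Set.to_countable s) fun H _ => hsing H

/-- The law of a random graph with independent edges. -/
noncomputable def graphLaw (p : Fin n → Fin n → ℝ) : Measure (SimpleGraph (Fin n)) :=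
  ∑ H, ENNReal.ofReal (bernoulliGraphProb p H) • Measure.dirac H

theorem graphLaw_singleton (p : Fin n → Fin n → ℝ) (H : SimpleGraph (Fin n)) :
    graphLaw p {H} = ENNReal.ofReal (bernoulliGraphProb p H) := by
  classical
  simp [graphLaw, Measure.finsetSum_apply, Set.indicator_apply]

/-- The law of a Bernoulli variable. -/
noncomputable def coinLaw (q : ℝ) : Measure Bool :=
  ENNReal.ofReal q • Measure.dirac true + ENNReal.ofReal (1 - q) • Measure.dirac false

theorem coinLaw_singleton (q : ℝ) (x : Bool) :
    coinLaw q {x} = ENNReal.ofReal (if x then q else 1 - q) := by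
  cases x <;> simp [coinLaw]

theorem isProbabilityMeasure_coinLaw {q : ℝ} (h0 : 0 ≤ q) (h1 : q ≤ 1) :
    IsProbabilityMeasure (coinLaw q) := by
  constructor
  simp only [coinLaw, Measure.coe_add, Measure.coe_smul, Pi.add_apply, Pi.smul_apply, measure_univ,
    smul_eq_mul, mul_one]
  rw [← ENNReal.ofReal_add h0 (by linarith)]
  simp

/-- The graph determined by a family of coins, of which those with index `(i, j)`, `i < j`,
are used. -/
def coinGraph (ω : Fin n × Fin n → Bool) : SimpleGraph (Fin n) where
  Adj i j := i ≠ j ∧ ω (min i j, max i j) = true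
  symm := ⟨fun i j h => ⟨h.1.symm, by rw [min_comm, max_comm]; exact h.2⟩⟩
  loopless := ⟨fun i h => h.1 rfl⟩

theorem coinGraph_eq_iff (ω : Fin n × Fin n → Bool) (H : SimpleGraph (Fin n)) :
    coinGraph ω = H ↔ ∀ i j, i < j → (ω (i, j) = true ↔ H.Adj i j) := by
  constructor
  · rintro rfl i j hij
    simp [coinGraph, hij.ne, min_eq_left hij.le, max_eq_right hij.le]
  · intro h
    ext i j
    rcases lt_trichotomy i j with hij | rfl | hij
    · simp [coinGraph, hij.ne, min_eq_left hij.le, max_eq_right hij.le, h i j hij]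
    · simp
    · simp [coinGraph, hij.ne', min_eq_right hij.le, max_eq_left hij.le, h j i hij, H.adj_comm i j]

/-- Only the coins above the diagonal matter, and the others contribute total mass one. Realizing
the graph by independent coins reduces probabilities of local events to products. -/
theorem map_coinGraph {p : Fin n → Fin n → ℝ} (h0 : ∀ i j, 0 ≤ p i j) (h1 : ∀ i j, p i j ≤ 1) :
    (Measure.pi fun q : Fin n × Fin n => coinLaw (p q.1 q.2)).map coinGraph = graphLaw p := by
  classical
  have := fun i j => isProbabilityMeasure_coinLaw (h0 i j) (h1 i j)
  refine Measure.ext_of_singleton fun H => ?_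
  rw [Measure.map_apply Measurable.of_discrete (measurableSet_singleton _), graphLaw_singleton]
  have : coinGraph ⁻¹' {H} = Set.univ.pi fun q : Fin n × Fin n =>
      if q.1 < q.2 then {decide (H.Adj q.1 q.2)} else Set.univ := by
    ext ω
    simp only [Set.mem_preimage, Set.mem_singleton_iff, coinGraph_eq_iff, Set.mem_pi, Set.mem_univ,
      true_implies, Prod.forall]
    refine forall_congr' fun i => forall_congr' fun j => ?_
    split_ifs with hij
    · cases h : ω (i, j) <;> simp [hij]
    · simp [hij]
  rw [this, Measure.pi_pi, bernoulliGraphProb, ENNReal.ofReal_prod_of_nonneg, Fintype.prod_prod_type]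
  · refine Finset.prod_congr rfl fun i _ => ?_
    rw [ENNReal.ofReal_prod_of_nonneg, ← Finset.prod_filter_mul_prod_filter_not _ (fun j => i < j)]
    · have hf : Finset.univ.filter (fun j => i < j) = Finset.Ioi i := by ext; simp
      rw [hf, Finset.prod_eq_one (s := Finset.univ.filter fun j => ¬ i < j), mul_one]
      · refine Finset.prod_congr rfl fun j hj => ?_
        rw [if_pos (Finset.mem_Ioi.1 hj), coinLaw_singleton]
        simp
      · intro j hj
        rw [if_neg (Finset.mem_filter.1 hj).2, measure_univ]
    · intro j _
      have := h0 i j; have := h1 i j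
      split_ifs <;> linarith
  · intro i _
    refine Finset.prod_nonneg fun j _ => ?_
    have := h0 i j; have := h1 i j
    split_ifs <;> linarith

theorem isProbabilityMeasure_graphLaw {p : Fin n → Fin n → ℝ} (h0 : ∀ i j, 0 ≤ p i j)
    (h1 : ∀ i j, p i j ≤ 1) : IsProbabilityMeasure (graphLaw p) := by
  have := fun i j => isProbabilityMeasure_coinLaw (h0 i j) (h1 i j)
  rw [← map_coinGraph h0 h1]
  exact Measure.isProbabilityMeasure_map Measurable.of_discrete.aemeasurable

/-- Repeating factors that are at most one only decreases a product. It is applied to non-edges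
between two vertices of `U`, which are counted once from each end. -/
theorem prod_comp_le_prod_image {ι κ : Type*} [DecidableEq κ] (s : Finset ι) (g : ι → κ)
    {f : κ → ℝ≥0∞} (hf : ∀ y, f y ≤ 1) : ∏ x ∈ s, f (g x) ≤ ∏ y ∈ s.image g, f y := by
  rw [← Finset.prod_fiberwise_of_maps_to (t := s.image g) (g := g)
    (fun x hx => Finset.mem_image_of_mem g hx)]
  refine Finset.prod_le_prod' fun y hy => ?_
  rw [Finset.prod_congr rfl (g := fun _ => f y)
    (fun x hx => by rw [(Finset.mem_filter.1 hx).2]), Finset.prod_const]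
  obtain ⟨x, hx, rfl⟩ := Finset.mem_image.1 hy
  refine pow_le_of_le_one zero_le (hf _) (Finset.card_ne_zero.2 ⟨x, Finset.mem_filter.2 ⟨hx, rfl⟩⟩)

/-- The edges `T` are present, and all the other edges at the vertices in `U` are absent. -/
def localEvent (U : Finset (Fin n)) (T : Finset (Fin n × Fin n)) : Set (SimpleGraph (Fin n)) :=
  {H | ∀ u ∈ U, ∀ w, H.Adj u w ↔ (u, w) ∈ T ∨ (w, u) ∈ T}

/-- The coins at `U` are prescribed exactly. The left side has in addition a superfluous factor `1 -
p` for each edge of `T` at `U` and counts pairs inside `U` twice; all this only makes it smaller,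
and it decouples the edges from the non-edges. By `hTi` an edge is listed in one direction only, so
its factor is not repeated. -/
theorem prod_le_graphLaw {p : Fin n → Fin n → ℝ} (h0 : ∀ i j, 0 ≤ p i j)
    (h1 : ∀ i j, p i j ≤ 1) (hp : ∀ i j, p i j = p j i) (U : Finset (Fin n))
    (T : Finset (Fin n × Fin n)) (hT : ∀ q ∈ T, q.1 ≠ q.2)
    (hTi : ∀ q ∈ T, (q.2, q.1) ∉ T) :
    (∏ q ∈ T, ENNReal.ofReal (p q.1 q.2)) *
      ∏ u ∈ U, ∏ w ∈ Finset.univ.erase u, ENNReal.ofReal (1 - p u w) ≤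
    graphLaw p (localEvent U T) := by
  classical
  have := fun i j => isProbabilityMeasure_coinLaw (h0 i j) (h1 i j)
  have hP : ∀ i j, ENNReal.ofReal (p i j) ≤ 1 := fun i j => ENNReal.ofReal_le_one.2 (h1 i j)
  have hN : ∀ i j, ENNReal.ofReal (1 - p i j) ≤ 1 := fun i j =>
    ENNReal.ofReal_le_one.2 (by linarith [h0 i j])
  let τ : Fin n × Fin n → Prop := fun q => q ∈ T ∨ (q.2, q.1) ∈ T
  let srt : Fin n × Fin n → Fin n × Fin n := fun q => (min q.1 q.2, max q.1 q.2)
  have hsrt : ∀ q : Fin n × Fin n, srt q = q ∨ srt q = (q.2, q.1) := by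
    intro q
    rcases le_total q.1 q.2 with h | h
    · exact Or.inl (Prod.ext (min_eq_left h) (max_eq_right h))
    · exact Or.inr (Prod.ext (min_eq_right h) (max_eq_left h))
  have hsrtlt : ∀ q : Fin n × Fin n, q.1 ≠ q.2 → (srt q).1 < (srt q).2 := fun q hq =>
    min_lt_max.2 hq
  have hpsrt : ∀ q : Fin n × Fin n, p (srt q).1 (srt q).2 = p q.1 q.2 := by
    intro q
    rcases hsrt q with h | h <;> rw [h]
    exact hp _ _
  let B : Fin n × Fin n → Set Bool := fun q =>
    if q.1 < q.2 ∧ (q.1 ∈ U ∨ q.2 ∈ U) then {decide (τ q)} else Set.univ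
  have hsub : coinGraph ⁻¹' localEvent U T ⊇ Set.univ.pi B := by
    intro ω hω u hu w
    by_cases huw : u = w
    · subst huw
      have : (u, u) ∉ T := fun h => hT _ h rfl
      simp [this]
    have hlt := hsrtlt (u, w) huw
    have hmem : (srt (u, w)).1 ∈ U ∨ (srt (u, w)).2 ∈ U := by
      rcases hsrt (u, w) with h | h <;> rw [h]
      · exact Or.inl hu
      · exact Or.inr hu
    have := hω (srt (u, w)) (Set.mem_univ _)
    simp only [B, if_pos (And.intro hlt hmem), Set.mem_singleton_iff] at this
    change u ≠ w ∧ ω (srt (u, w)) = true ↔ _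
    rw [this, decide_eq_true_eq]
    simp only [τ]
    rcases hsrt (u, w) with h | h <;> rw [h]
    · exact and_iff_right huw
    · exact (and_iff_right huw).trans or_comm
  rw [← map_coinGraph h0 h1, Measure.map_apply Measurable.of_discrete MeasurableSet.of_discrete]
  refine le_trans ?_ (measure_mono hsub)
  rw [Measure.pi_pi]
  let a : Fin n × Fin n → ℝ≥0∞ := fun q =>
    if q.1 < q.2 ∧ τ q then ENNReal.ofReal (p q.1 q.2) else 1
  let b : Fin n × Fin n → ℝ≥0∞ := fun q =>
    if q.1 < q.2 ∧ (q.1 ∈ U ∨ q.2 ∈ U) then ENNReal.ofReal (1 - p q.1 q.2) else 1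
  have ha1 : ∀ q, a q ≤ 1 := fun q => by simp only [a]; split_ifs; exacts [hP _ _, le_rfl]
  have hb1 : ∀ q, b q ≤ 1 := fun q => by simp only [b]; split_ifs; exacts [hN _ _, le_rfl]
  have hab : ∀ q ∈ Finset.univ, a q * b q ≤ coinLaw (p q.1 q.2) (B q) := by
    intro q _
    by_cases hq : q.1 < q.2 ∧ (q.1 ∈ U ∨ q.2 ∈ U)
    · simp only [B, if_pos hq, coinLaw_singleton]
      by_cases hτ : τ q
      · simp only [hτ, decide_true, if_true]
        refine (mul_le_of_le_one_right' (hb1 q)).trans ?_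
        simp only [a, hτ, hq.1, and_self, if_true, le_refl]
      · simp only [hτ, decide_false, Bool.false_eq_true, if_false]
        refine (mul_le_of_le_one_left' (ha1 q)).trans ?_
        simp only [b, if_pos hq, le_refl]
    · simp only [B, if_neg hq, measure_univ]
      exact mul_le_one' (ha1 q) (hb1 q)
  refine le_trans ?_ (Finset.prod_le_prod' hab)
  rw [Finset.prod_mul_distrib]
  refine mul_le_mul' (le_of_eq ?_) ?_
  · simp only [a]
    rw [← Finset.prod_filter]
    have himg : Finset.univ.filter (fun q : Fin n × Fin n => q.1 < q.2 ∧ τ q) = T.image srt := by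
      ext q
      simp only [Finset.mem_filter, Finset.mem_univ, true_and, Finset.mem_image]
      constructor
      · rintro ⟨h, h' | h'⟩
        · exact ⟨q, h', Prod.ext (min_eq_left h.le) (max_eq_right h.le)⟩
        · exact ⟨_, h', Prod.ext (min_eq_right h.le) (max_eq_left h.le)⟩
      · rintro ⟨q, hq, rfl⟩
        refine ⟨hsrtlt q (hT q hq), ?_⟩
        simp only [τ]
        rcases hsrt q with h | h <;> rw [h]
        · exact Or.inl hq
        · exact Or.inr hq
    rw [himg, Finset.prod_image]
    · exact Finset.prod_congr rfl fun q _ => by rw [hpsrt]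
    · intro q hq q' hq' h
      rcases hsrt q with h2 | h2 <;> rcases hsrt q' with h3 | h3 <;> simp only [h2, h3] at h
      · exact h
      · subst h; exact absurd hq (hTi q' hq')
      · subst h; exact absurd hq' (hTi q hq)
      · exact Prod.ext (congrArg Prod.snd h) (congrArg Prod.fst h)
  · simp only [b]
    rw [← Finset.prod_filter]
    let s : Finset (Fin n × Fin n) := (U ×ˢ Finset.univ).filter fun q => q.1 ≠ q.2
    have hs : ∏ u ∈ U, ∏ w ∈ Finset.univ.erase u, ENNReal.ofReal (1 - p u w) =
        ∏ q ∈ s, ENNReal.ofReal (1 - p (srt q).1 (srt q).2) := by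
      simp only [s, hpsrt]
      rw [Finset.prod_filter, Finset.prod_product]
      refine Finset.prod_congr rfl fun u _ => ?_
      rw [← Finset.prod_filter]
      refine Finset.prod_congr ?_ fun _ _ => rfl
      ext w; simp [eq_comm]
    rw [hs]
    refine (prod_comp_le_prod_image s srt (f := fun q => ENNReal.ofReal (1 - p q.1 q.2))
      fun q => hN _ _).trans (le_of_eq (Finset.prod_congr ?_ fun _ _ => rfl))
    ext q
    simp only [Finset.mem_image, Finset.mem_filter, Finset.mem_univ, true_and, s,
      Finset.mem_product, and_true]
    constructor
    · rintro ⟨q, ⟨hq, hne⟩, rfl⟩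
      refine ⟨hsrtlt q hne, ?_⟩
      rcases hsrt q with h | h <;> rw [h]
      · exact Or.inl hq
      · exact Or.inr hq
    · rintro ⟨h, h' | h'⟩
      · exact ⟨q, ⟨h', h.ne⟩, Prod.ext (min_eq_left h.le) (max_eq_right h.le)⟩
      · exact ⟨(q.2, q.1), ⟨h', h.ne'⟩, Prod.ext (min_eq_right h.le) (max_eq_left h.le)⟩

end BernoulliGraph

/-! ### Coupling of the inhomogeneous random graph and the label tree -/

section ChildOrder

variable {n : ℕ}

instance : MeasurableSpace (List (Fin n)) := ⊤

instance : DiscreteMeasurableSpace (List (Fin n)) := ⟨fun _ => trivial⟩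

/-- An ordering of every set of vertices, for every vertex. -/
abbrev ChildOrder (n : ℕ) := Fin n × Finset (Fin n) → List (Fin n)

/-- The orderings of a set of vertices. -/
noncomputable def orderings (C : Finset (Fin n)) : Finset (List (Fin n)) := C.toList.permutations.toFinset

theorem mem_orderings {C : Finset (Fin n)} {l : List (Fin n)} (hl : l.Nodup) (hC : l.toFinset = C) :
    l ∈ orderings C := by
  rw [orderings, List.mem_toFinset, List.mem_permutations]
  refine (List.perm_ext_iff_of_nodup hl C.nodup_toList).2 fun a => ?_
  rw [Finset.mem_toList, ← hC, List.mem_toFinset]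

theorem card_orderings (C : Finset (Fin n)) : (orderings C).card = C.card.factorial := by
  rw [orderings, List.toFinset_card_of_nodup (List.nodup_permutations _ C.nodup_toList),
    List.length_permutations, Finset.length_toList]

theorem orderings_nonempty (C : Finset (Fin n)) : (orderings C).Nonempty := by
  rw [← Finset.card_pos, card_orderings]
  exact Nat.factorial_pos _

/-- The law of independent uniform orderings. -/
noncomputable def orderLaw (n : ℕ) : Measure (ChildOrder n) :=
  Measure.infinitePi fun q => (PMF.uniformOfFinset (orderings q.2) (orderings_nonempty q.2)).toMeasure

instance : IsProbabilityMeasure (orderLaw n) := by unfold orderLaw; infer_instance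

/-- The labels of the children of a node, in their order. -/
def childList (t : TreeData (Fin n)) (i : List ℕ) : List (Fin n) :=
  (List.range (t i).1).map fun r => (t (r :: i)).2

/-- The vertex at the node `i`, and the set of the vertices at its children. -/
def childKey (t : TreeData (Fin n)) (i : List ℕ) : Fin n × Finset (Fin n) :=
  ((t i).2, (children t i).image fun j => (t j).2)

theorem childList_toFinset (t : TreeData (Fin n)) (i : List ℕ) :
    (childList t i).toFinset = (children t i).image fun j => (t j).2 := by
  ext u
  simp [childList, children]

variable {k : ℕ} {t : TreeData (Fin n)}

theorem children_subset {i : List ℕ} (hi : i ∈ nodes t k) : children t i ⊆ nodes t (k + 1) :=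
  fun _ hj => treeNbrs_subset hi (Finset.mem_union_left _ hj)

theorem childList_nodup (ht : Set.InjOn (fun i => (t i).2) (nodes t (k + 1))) {i : List ℕ}
    (hi : i ∈ nodes t k) : (childList t i).Nodup := by
  refine (List.nodup_range).map_on fun r hr q hq h => ?_
  have := ht (cons_mem_nodes.2 ⟨hi, List.mem_range.1 hr⟩)
    (cons_mem_nodes.2 ⟨hi, List.mem_range.1 hq⟩) h
  exact (List.cons.inj this).1

/-- Distinct labels give the nodes distinct keys, so their orderings are independent, and each
equals the prescribed one with probability one over the factorial of the number of children. -/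
theorem prod_factorial_le_orderLaw (ht : Set.InjOn (fun i => (t i).2) (nodes t (k + 1))) :
    ∏ i ∈ nodes t k, (((t i).1.factorial : ℕ) : ℝ≥0∞)⁻¹ ≤
      orderLaw n {o | ∀ i ∈ nodes t k, o (childKey t i) = childList t i} := by
  have hinj : Set.InjOn (childKey t) (nodes t k) := by
    intro i hi j hj hij
    exact ht (nodes_mono t (Nat.le_succ k) hi) (nodes_mono t (Nat.le_succ k) hj)
      (congrArg Prod.fst hij)
  let B : Fin n × Finset (Fin n) → Set (List (Fin n)) := fun q =>
    {l | ∀ i ∈ nodes t k, childKey t i = q → l = childList t i}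
  have hsub : Set.pi ((nodes t k).image (childKey t)) B ⊆
      {o | ∀ i ∈ nodes t k, o (childKey t i) = childList t i} := by
    intro o ho i hi
    exact ho (childKey t i) (Finset.mem_image_of_mem _ hi) i hi rfl
  refine le_trans (le_of_eq ?_) (measure_mono hsub)
  rw [orderLaw, Measure.infinitePi_pi _ fun _ _ => MeasurableSet.of_discrete,
    Finset.prod_image hinj]
  refine Finset.prod_congr rfl fun i hi => ?_
  have hB : B (childKey t i) = {childList t i} := by
    ext l
    simp only [B, Set.mem_ofPred_eq, Set.mem_singleton_iff]
    refine ⟨fun h => h i hi rfl, ?_⟩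
    rintro rfl j hj hji
    rw [hinj hj hi hji]
  rw [hB, PMF.toMeasure_apply_singleton _ _ (measurableSet_singleton _),
    PMF.uniformOfFinset_apply, if_pos (show childList t i ∈ orderings (childKey t i).2 from
      mem_orderings (childList_nodup ht hi) (childList_toFinset t i)),
    card_orderings]
  congr 3
  rw [childKey, Finset.card_image_of_injOn
    (ht.mono (Finset.coe_subset.2 (children_subset hi))), card_children]

/-- The graph `x.1` matches the tree, and the children have the order `x.2`. -/
structure OrderedMatch (k : ℕ) (v : Fin n) (x : SimpleGraph (Fin n) × ChildOrder n)
    (t : TreeData (Fin n)) : Prop where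
  toMatches : Matches k (simpleMult x.1) v t
  order : ∀ i ∈ nodes t k, x.2 (childKey t i) = childList t i

/-- The first `k + 1` generations of the tree, with the offspring numbers of the first `k`
generations. -/
def treeShape (k : ℕ) (t : TreeData (Fin n)) : Finset (List ℕ × ℕ × Fin n) :=
  (nodes t (k + 1)).image fun i => (i, (if i.length ≤ k then (t i).1 else 0), (t i).2)

theorem mem_treeShape {p : List ℕ × ℕ × Fin n} :
    p ∈ treeShape k t ↔ p.1 ∈ nodes t (k + 1) ∧ (if p.1.length ≤ k then (t p.1).1 else 0) = p.2.1 ∧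
      (t p.1).2 = p.2.2 := by
  simp only [treeShape, Finset.mem_image]
  constructor
  · rintro ⟨i, h1, rfl⟩
    exact ⟨h1, rfl, rfl⟩
  · rintro ⟨h1, h2, h3⟩
    exact ⟨p.1, h1, Prod.ext rfl (Prod.ext h2 h3)⟩

theorem agree_of_treeShape_eq {t' : TreeData (Fin n)} (h : treeShape k t = treeShape k t') :
    Agree k t t' := by
  have key : ∀ i ∈ nodes t (k + 1), (if i.length ≤ k then (t' i).1 else 0) =
      (if i.length ≤ k then (t i).1 else 0) ∧ (t' i).2 = (t i).2 := by
    intro i hi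
    have h1 : (i, (if i.length ≤ k then (t i).1 else 0), (t i).2) ∈ treeShape k t :=
      Finset.mem_image_of_mem _ hi
    rw [h, mem_treeShape] at h1
    exact h1.2
  refine ⟨fun i hi => ?_, fun i hi => (key i hi).2⟩
  have := (key i (nodes_mono t (Nat.le_succ k) hi)).1
  rwa [if_pos (mem_nodes.1 hi).2, if_pos (mem_nodes.1 hi).2] at this

theorem measurable_treeShape (k : ℕ) [MeasurableSpace (Finset (List ℕ × ℕ × Fin n))] :
    Measurable (treeShape k : TreeData (Fin n) → Finset (List ℕ × ℕ × Fin n)) := by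
  refine measurable_to_countable' fun F => ?_
  have : treeShape k ⁻¹' {F} = ⋂ p : List ℕ × ℕ × Fin n, {t : TreeData (Fin n) |
      (p.1 ∈ nodes t (k + 1) ∧ (if p.1.length ≤ k then (t p.1).1 else 0) = p.2.1 ∧
        (t p.1).2 = p.2.2) ↔ p ∈ F} := by
    ext t
    simp only [Set.mem_preimage, Set.mem_singleton_iff, Finset.ext_iff, mem_treeShape,
      Set.mem_iInter, Set.mem_ofPred_eq]
  rw [this]
  refine MeasurableSet.iInter fun p => MeasurableSet.iff ?_ (MeasurableSet.const _)
  refine (measurableSet_mem_nodes (k + 1) p.1).inter (MeasurableSet.inter ?_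
    (measurableSet_eq_fun (measurable_label p.1) measurable_const))
  split_ifs
  · exact measurableSet_eq_fun (measurable_offspring p.1) measurable_const
  · exact MeasurableSet.const _

/-- The right side involves only the graph, the vertex of the node and that of its parent. Thus the
set of children can be read off the graph while the tree is being uncovered. -/
theorem Matches.childSet_eq {e : Fin n → Fin n → ℕ} {v : Fin n} (h : Matches k e v t)
    {i : List ℕ} (hi : i ∈ nodes t k) : ((children t i).image fun j => (t j).2) =
      (Finset.univ.filter fun w => e (t i).2 w ≠ 0) \ (parentSet i).image fun j => (t j).2 := by
  ext w
  have hdisj : ∀ j ∈ children t i, ∀ l ∈ parentSet i, (t j).2 ≠ (t l).2 := by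
    intro j hj l hl hjl
    have := h.inj (children_subset hi hj) (treeNbrs_subset hi (Finset.mem_union_right _ hl)) hjl
    subst this
    obtain ⟨r, -, rfl⟩ := mem_children.1 hj
    obtain ⟨q, hq⟩ := mem_parentSet.1 hl
    have := congrArg List.length hq
    simp only [List.length_cons] at this
    omega
  simp only [Finset.mem_sdiff, Finset.mem_filter, Finset.mem_univ, true_and, h.edge_eq hi, treeNbrs,
    Finset.image_union, Finset.mem_union, ne_eq, ite_eq_right_iff, one_ne_zero, imp_false, not_not]
  constructor
  · intro hw
    refine ⟨Or.inl hw, fun hw' => ?_⟩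
    obtain ⟨j, hj, rfl⟩ := Finset.mem_image.1 hw
    obtain ⟨l, hl, hlj⟩ := Finset.mem_image.1 hw'
    exact hdisj j hj l hl hlj.symm
  · rintro ⟨hw | hw, hw'⟩
    · exact hw
    · exact absurd hw hw'

/-- Going down the generations, the degree of a vertex gives the number of children, its remaining
neighbours give the set of their labels, and the ordering assigns these labels to the children. The
claim about parents is carried along because the set of children depends on the parent. -/
theorem OrderedMatch.agree {v : Fin n} {x : SimpleGraph (Fin n) × ChildOrder n}
    {t' : TreeData (Fin n)} (h : OrderedMatch k v x t) (h' : OrderedMatch k v x t') (i : List ℕ)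
    (hi : i ∈ nodes t (k + 1)) : i ∈ nodes t' (k + 1) ∧ (t' i).2 = (t i).2 ∧
      (∀ j ∈ parentSet i, (t' j).2 = (t j).2) ∧ (i ∈ nodes t k → (t' i).1 = (t i).1) := by
  have hoff : ∀ {i : List ℕ}, i ∈ nodes t (k + 1) → i ∈ nodes t' (k + 1) → (t' i).2 = (t i).2 →
      i ∈ nodes t k → (t' i).1 = (t i).1 := by
    intro i hi hi' hl hik
    have hik' : i ∈ nodes t' k := mem_nodes.2 ⟨(mem_nodes.1 hi').1, (mem_nodes.1 hik).2⟩
    have h1 := h.toMatches.deg i hik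
    have h2 := h'.toMatches.deg i hik'
    rw [hl, h1] at h2
    cases i with
    | nil => exact h2.symm
    | cons r i => simpa [nodeMark] using h2.symm
  induction i with
  | nil =>
    refine ⟨nil_mem_nodes _ _, h'.toMatches.root.trans h.toMatches.root.symm, by simp [parentSet],
      hoff (nil_mem_nodes _ _) (nil_mem_nodes _ _) (h'.toMatches.root.trans h.toMatches.root.symm)⟩
  | cons r i ih =>
    obtain ⟨hik, hr⟩ := cons_mem_nodes.1 hi
    obtain ⟨hi1, hi2, hi3, hi4⟩ := ih (nodes_mono _ (Nat.le_succ k) hik)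
    have hik' : i ∈ nodes t' k := mem_nodes.2 ⟨(mem_nodes.1 hi1).1, (mem_nodes.1 hik).2⟩
    have hN := hi4 hik
    have hm : r :: i ∈ nodes t' (k + 1) := cons_mem_nodes.2 ⟨hik', by rwa [hN]⟩
    have hkey : childKey t' i = childKey t i := by
      refine Prod.ext hi2 ?_
      rw [childKey, childKey, h.toMatches.childSet_eq hik, h'.toMatches.childSet_eq hik', hi2]
      rw [Finset.image_congr fun j hj => hi3 j hj]
    have hlist : childList t' i = childList t i := by
      rw [← h.order i hik, ← h'.order i hik', hkey]
    have hlab : (t' (r :: i)).2 = (t (r :: i)).2 := by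
      have h1 : r < (childList t' i).length := by simpa [childList, hN] using hr
      have h2 : r < (childList t i).length := by simpa [childList] using hr
      have h3 : (childList t' i)[r] = (childList t i)[r] := by simp only [hlist]
      simpa [childList] using h3
    exact ⟨hm, hlab, by simpa [parentSet] using hi2, hoff hi hm hlab⟩

theorem OrderedMatch.shape_eq {v : Fin n} {x : SimpleGraph (Fin n) × ChildOrder n}
    {t' : TreeData (Fin n)} (h : OrderedMatch k v x t) (h' : OrderedMatch k v x t') :
    treeShape k t = treeShape k t' := by
  have key : ∀ {t t' : TreeData (Fin n)}, OrderedMatch k v x t → OrderedMatch k v x t' →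
      treeShape k t ⊆ treeShape k t' := by
    intro t t' h h' p hp
    rw [mem_treeShape] at hp ⊢
    obtain ⟨h1, h2, -, h3⟩ := h.agree h' p.1 hp.1
    refine ⟨h1, ?_, h2.trans hp.2.2⟩
    rw [← hp.2.1]
    split_ifs with hk
    · exact h3 (mem_nodes.2 ⟨(mem_nodes.1 hp.1).1, hk⟩)
    · rfl
  exact Finset.Subset.antisymm (key h h') (key h' h)

/-- The edges of the tree of the first `k + 1` generations. -/
def treeEdges (k : ℕ) (t : TreeData (Fin n)) : Finset (Fin n × Fin n) :=
  ((nodes t k).sigma (children t)).image fun x => ((t x.1).2, (t x.2).2)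

/-- On this event every edge at a vertex of the first `k` generations is a tree edge, so degrees are
numbers of tree neighbours. -/
theorem matches_of_localEvent {v : Fin n} (hv : (t []).2 = v)
    (ht : Set.InjOn (fun i => (t i).2) (nodes t (k + 1))) {H : SimpleGraph (Fin n)}
    (hH : H ∈ localEvent ((nodes t k).image fun i => (t i).2) (treeEdges k t)) :
    Matches k (simpleMult H) v t := by
  classical
  have hadj : ∀ i ∈ nodes t k, ∀ w, H.Adj (t i).2 w ↔ w ∈ (treeNbrs t i).image fun j => (t j).2 := by
    intro i hi w
    rw [hH _ (Finset.mem_image_of_mem _ hi) w]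
    simp only [treeEdges, Finset.mem_image, Finset.mem_sigma, Sigma.exists, Prod.mk.injEq]
    constructor
    · rintro (⟨j, l, ⟨hj, hl⟩, h1, rfl⟩ | ⟨j, l, ⟨hj, hl⟩, rfl, h1⟩)
      · obtain rfl := ht (nodes_mono t (Nat.le_succ k) hj) (nodes_mono t (Nat.le_succ k) hi) h1
        exact ⟨l, Finset.mem_union_left _ hl, rfl⟩
      · obtain rfl := ht (children_subset hj hl) (nodes_mono t (Nat.le_succ k) hi) h1
        obtain ⟨r, -, rfl⟩ := mem_children.1 hl
        exact ⟨j, Finset.mem_union_right _ (mem_parentSet.2 ⟨r, rfl⟩), rfl⟩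
    · rintro ⟨j, hj, rfl⟩
      rcases Finset.mem_union.1 hj with hj | hj
      · exact Or.inl ⟨i, j, ⟨hi, hj⟩, rfl, rfl⟩
      · obtain ⟨r, rfl⟩ := mem_parentSet.1 hj
        have := mem_nodes.1 hi
        simp only [IsNode, List.length_cons] at this
        exact Or.inr ⟨j, r :: j, ⟨mem_nodes.2 ⟨this.1.1, by omega⟩,
          mem_children.2 ⟨r, this.1.2, rfl⟩⟩, rfl, rfl⟩
  refine ⟨fun i j => ?_, hv, ht, fun i hi => ?_, fun i hi r hr => ?_⟩
  · simp only [simpleMult, H.adj_comm]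
  · rw [degree, ← card_treeNbrs, ← Finset.card_image_of_injOn
      (ht.mono (Finset.coe_subset.2 (treeNbrs_subset hi)))]
    simp only [simpleMult, hadj i hi]
    have h0 : (t i).2 ∉ (treeNbrs t i).image fun j => (t j).2 := by
      rw [← hadj i hi]; exact H.irrefl
    rw [if_neg h0, add_zero, Finset.sum_ite_mem, Finset.univ_inter, Finset.card_eq_sum_ones]
  · have : H.Adj (t i).2 (t (r :: i)).2 := by
      rw [hadj i hi]
      exact Finset.mem_image_of_mem _ (Finset.mem_union_left _ (mem_children.2 ⟨r, hr, rfl⟩))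
    simp [simpleMult, this]

theorem prod_le_orderedMatch {p : Fin n → Fin n → ℝ} (h0 : ∀ i j, 0 ≤ p i j)
    (h1 : ∀ i j, p i j ≤ 1) (hp : ∀ i j, p i j = p j i)
    (ht : Set.InjOn (fun i => (t i).2) (nodes t (k + 1))) {v : Fin n} (hv : (t []).2 = v) :
    ∏ i ∈ nodes t k, ((∏ j ∈ children t i, ENNReal.ofReal (p (t i).2 (t j).2)) *
      (∏ w ∈ Finset.univ.erase (t i).2, ENNReal.ofReal (1 - p (t i).2 w)) *
      (((t i).1.factorial : ℕ) : ℝ≥0∞)⁻¹) ≤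
    ((graphLaw p).prod (orderLaw n)) {x | OrderedMatch k v x t} := by
  have := isProbabilityMeasure_graphLaw h0 h1
  have hs := nodes_mono t (Nat.le_succ k)
  have hsub : (localEvent ((nodes t k).image fun i => (t i).2) (treeEdges k t)) ×ˢ
      {o | ∀ i ∈ nodes t k, o (childKey t i) = childList t i} ⊆ {x | OrderedMatch k v x t} :=
    fun x hx => ⟨matches_of_localEvent hv ht hx.1, hx.2⟩
  refine le_trans ?_ (measure_mono hsub)
  rw [Measure.prod_prod, Finset.prod_mul_distrib, Finset.prod_mul_distrib]
  refine mul_le_mul' (le_trans (le_of_eq ?_) (prod_le_graphLaw h0 h1 hp _ _ ?_ ?_))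
    (prod_factorial_le_orderLaw ht)
  · rw [Finset.prod_image (fun i hi j hj h => ht (hs hi) (hs hj) h), treeEdges, Finset.prod_image,
      Finset.prod_sigma]
    rintro ⟨i, j⟩ hij ⟨i', j'⟩ hij' h
    simp only [Finset.coe_sigma, Set.mem_sigma_iff, Finset.mem_coe] at hij hij'
    obtain rfl := ht (hs hij.1) (hs hij'.1) (congrArg Prod.fst h)
    obtain rfl := ht (children_subset hij.1 hij.2) (children_subset hij'.1 hij'.2)
      (congrArg (fun q : Fin n × Fin n => q.2) h)
    rfl
  · intro q hq hne
    obtain ⟨⟨i, j⟩, hij, rfl⟩ := Finset.mem_image.1 hq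
    rw [Finset.mem_sigma] at hij
    have := ht (hs hij.1) (children_subset hij.1 hij.2) hne
    obtain ⟨r, -, h⟩ := mem_children.1 hij.2
    have := congrArg List.length (this.trans h.symm)
    simp only [List.length_cons] at this
    omega
  · intro q hq hq'
    obtain ⟨⟨i, j⟩, hij, rfl⟩ := Finset.mem_image.1 hq
    obtain ⟨⟨i', j'⟩, hij', h⟩ := Finset.mem_image.1 hq'
    rw [Finset.mem_sigma] at hij hij'
    simp only [Prod.mk.injEq] at h
    have e1 := ht (hs hij'.1) (children_subset hij.1 hij.2) h.1
    have e2 := ht (children_subset hij'.1 hij'.2) (hs hij.1) h.2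
    obtain ⟨r, -, h1⟩ := mem_children.1 hij.2
    obtain ⟨r', -, h2⟩ := mem_children.1 hij'.2
    have l1 := congrArg List.length h1
    have l2 := congrArg List.length h2
    have l3 := congrArg List.length e1
    have l4 := congrArg List.length e2
    simp only [List.length_cons] at l1 l2 l3 l4
    omega

end ChildOrder

/-! ### Measurable dependence of the laws on parameters. -/

section MeasurableLaws

variable {Θ A : Type*} [MeasurableSpace Θ] [MeasurableSpace A]

theorem measurable_of_singleton {β : Type*} [MeasurableSpace β] [Countable β]
    [DiscreteMeasurableSpace β] {μ : Θ → Measure β} (h : ∀ b, Measurable fun θ => μ θ {b}) :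
    Measurable μ := by
  refine Measure.measurable_of_measurable_coe _ fun s hs => ?_
  simp_rw [← fun θ => Measure.tsum_indicator_apply_singleton (μ θ) s hs]
  refine Measurable.tsum fun b => ?_
  by_cases hb : b ∈ s
  · simpa [hb] using h b
  · simp [hb]

theorem measurable_treeLaw {root node : Θ → Measure (ℕ × A)} (hr : Measurable root)
    (hn : Measurable node) [∀ θ, IsProbabilityMeasure (root θ)]
    [∀ θ, IsProbabilityMeasure (node θ)] : Measurable fun θ => treeLaw (root θ) (node θ) := by
  refine Measurable.measure_of_isPiSystem_of_isProbabilityMeasure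
    (generateFrom_squareCylinders (α := fun _ : List ℕ => ℕ × A)).symm
    (isPiSystem_squareCylinders (fun _ => MeasurableSpace.isPiSystem_measurableSet) (by simp)) ?_
  rintro _ ⟨s, t, ht, rfl⟩
  have ht' : ∀ i ∈ s, MeasurableSet (t i) := fun i _ => ht i (Set.mem_univ i)
  have : ∀ θ, treeLaw (root θ) (node θ) (Set.pi s t) =
      ∏ i ∈ s, (if i = [] then root θ else node θ) (t i) := fun θ => by
    rw [← treeLaw_box _ _ s ht']
    congr 1
  simp_rw [this]
  refine Finset.measurable_prod _ fun i hi => ?_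
  by_cases h : i = []
  · simp only [h, if_true]
    exact (Measure.measurable_coe (h ▸ ht' i hi)).comp hr
  · simp only [h, if_false]
    exact (Measure.measurable_coe (ht' i hi)).comp hn

theorem measurable_poissonMeasure : Measurable poissonMeasure := by
  refine measurable_of_singleton fun b => ?_
  simp_rw [poissonMeasure_singleton]
  fun_prop

theorem measurable_graphLaw {n : ℕ} {p : Θ → Fin n → Fin n → ℝ}
    (hp : ∀ i j, Measurable fun θ => p θ i j) : Measurable fun θ => graphLaw (p θ) := by
  classical
  refine measurable_of_singleton fun H => ?_
  simp_rw [graphLaw_singleton]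
  refine ENNReal.measurable_ofReal.comp ?_
  refine Finset.measurable_prod _ fun i _ => Finset.measurable_prod _ fun j _ => ?_
  split_ifs
  · exact hp i j
  · exact measurable_const.sub (hp i j)

end MeasurableLaws

/-! ### Probabilities of tree shapes with Poisson offspring, compared with the graph. -/

section PoissonTree

variable {n : ℕ}

/-- The labelled version of the law of the root `v` in the inhomogeneous random graph. -/
noncomputable def labelRootIR (m : Fin n → ℝ≥0) (v : Fin n) : Measure (ℕ × Fin n) :=
  (poissonMeasure (m v)).map fun x => (x, v)

/-- The labelled version of `nodeLawIR`. -/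
noncomputable def labelLawIR (m : Fin n → ℝ≥0) (q : Fin n → ℝ≥0∞) : Measure (ℕ × Fin n) :=
  ∑ j, q j • (poissonMeasure (m j)).map fun x => (x, j)

instance (m : Fin n → ℝ≥0) (v : Fin n) : IsProbabilityMeasure (labelRootIR m v) :=
  Measure.isProbabilityMeasure_map Measurable.of_discrete.aemeasurable

theorem isProbabilityMeasure_labelLawIR (m : Fin n → ℝ≥0) {q : Fin n → ℝ≥0∞} (hq : ∑ j, q j = 1) :
    IsProbabilityMeasure (labelLawIR m q) := by
  constructor
  rw [labelLawIR, Measure.finsetSum_apply, ← hq]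
  refine Finset.sum_congr rfl fun j _ => ?_
  have : IsProbabilityMeasure ((poissonMeasure (m j)).map fun x => (x, j)) :=
    Measure.isProbabilityMeasure_map Measurable.of_discrete.aemeasurable
  rw [Measure.smul_apply, measure_univ, smul_eq_mul, mul_one]

theorem map_prodMk_apply (ν : Measure ℕ) (j u : Fin n) (s : Set ℕ) :
    ν.map (fun x => (x, j)) {x | x.1 ∈ s ∧ x.2 = u} = if j = u then ν s else 0 := by
  rw [Measure.map_apply Measurable.of_discrete MeasurableSet.of_discrete]
  split_ifs with h
  · congr 1; ext; simp [h]
  · simp [h]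

theorem labelLawIR_apply (m : Fin n → ℝ≥0) (q : Fin n → ℝ≥0∞) (u : Fin n) (s : Set ℕ) :
    labelLawIR m q {x | x.1 ∈ s ∧ x.2 = u} = q u * poissonMeasure (m u) s := by
  rw [labelLawIR, Measure.finsetSum_apply]
  simp only [Measure.smul_apply, map_prodMk_apply, smul_eq_mul, mul_ite, mul_zero]
  simp

variable {k : ℕ} {m : Fin n → ℝ≥0} {q : Fin n → ℝ≥0∞}

/-- Nodes of generation `k + 1` contribute their labels but not their offspring numbers. The label
factors are then regrouped by parents. There is only an inequality since the root of `t` need not be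
`v`. -/
theorem treeLaw_shape_le (hq : ∑ j, q j = 1) (v : Fin n) (t : TreeData (Fin n)) :
    treeLaw (labelRootIR m v) (labelLawIR m q) (treeShape k ⁻¹' {treeShape k t}) ≤
      ∏ i ∈ nodes t k, (poissonMeasure (m (t i).2) {(t i).1} *
        ∏ j ∈ children t i, q (t j).2) := by
  have := isProbabilityMeasure_labelLawIR m hq
  let B : List ℕ → Set (ℕ × Fin n) := fun i =>
    {x | x.1 ∈ (if i.length ≤ k then {(t i).1} else Set.univ : Set ℕ) ∧ x.2 = (t i).2}
  have hsub : treeShape k ⁻¹' {treeShape k t} ⊆ {t' | ∀ i ∈ nodes t (k + 1), t' i ∈ B i} := by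
    intro t' ht' i hi
    have hag := agree_of_treeShape_eq (Eq.symm ht')
    refine ⟨?_, hag.2 i hi⟩
    split_ifs with h
    · exact hag.1 i (mem_nodes.2 ⟨(mem_nodes.1 hi).1, h⟩)
    · trivial
  have hs := nodes_mono t (Nat.le_succ k)
  refine (measure_mono hsub).trans ?_
  rw [treeLaw_box _ _ _ fun _ _ => MeasurableSet.of_discrete]
  have hle : ∀ i ∈ nodes t (k + 1), (if i = [] then labelRootIR m v else labelLawIR m q) (B i) ≤
      (if i ∈ nodes t k then poissonMeasure (m (t i).2) {(t i).1} else 1) *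
        (if i = [] then 1 else q (t i).2) := by
    intro i hi
    have hik : i ∈ nodes t k ↔ i.length ≤ k := by
      rw [mem_nodes]; exact and_iff_right (mem_nodes.1 hi).1
    by_cases h : i = []
    · subst h
      simp only [B, if_true, labelRootIR, map_prodMk_apply, nil_mem_nodes, List.length_nil,
        Nat.zero_le, mul_one]
      split_ifs with hv
      · rw [hv]
      · exact zero_le
    · simp only [B, if_neg h, labelLawIR_apply, hik]
      split_ifs
      · rw [mul_comm]
      · rw [measure_univ, mul_comm]
  refine (Finset.prod_le_prod' hle).trans (le_of_eq ?_)
  rw [Finset.prod_mul_distrib, Finset.prod_mul_distrib, Finset.prod_ite_mem,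
    Finset.inter_eq_right.2 hs]
  congr 1
  have hnil : [] ∉ (nodes t k).biUnion (children t) := by
    simp only [Finset.mem_biUnion, mem_children, not_exists, not_and]
    intro i _ r _ h
    simp at h
  rw [nodes, Finset.prod_insert hnil, if_pos rfl, one_mul, Finset.prod_biUnion]
  · refine Finset.prod_congr rfl fun i _ => Finset.prod_congr rfl fun j hj => ?_
    obtain ⟨r, -, rfl⟩ := mem_children.1 hj
    simp
  · intro i _ j _ hij
    refine Finset.disjoint_left.2 fun l hl hl' => hij ?_
    obtain ⟨r, -, rfl⟩ := mem_children.1 hl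
    obtain ⟨r', -, h⟩ := mem_children.1 hl'
    exact (List.cons.inj h).2.symm

/-- The trees whose nodes in the first `k + 1` generations are distinct vertices and lie in `S`,
and for which exploring the graph is, up to a factor `a` per step, at least as likely as growing
the tree. -/
def goodTrees (k : ℕ) (a : ℝ≥0∞) (S : Finset (List ℕ)) (p : Fin n → Fin n → ℝ) (m : Fin n → ℝ≥0)
    (q : Fin n → ℝ≥0∞) : Set (TreeData (Fin n)) :=
  {t | Set.InjOn (fun i => (t i).2) (nodes t (k + 1)) ∧ nodes t (k + 1) ⊆ S ∧
    ∀ i ∈ nodes t k, a * ENNReal.ofReal (Real.exp (-m (t i).2)) ≤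
        ∏ w ∈ Finset.univ.erase (t i).2, ENNReal.ofReal (1 - p (t i).2 w) ∧
      ∀ j ∈ children t i, a * (m (t i).2 * q (t j).2) ≤ ENNReal.ofReal (p (t i).2 (t j).2)}

theorem poissonMeasure_singleton_eq (r : ℝ≥0) (x : ℕ) :
    poissonMeasure r {x} = ENNReal.ofReal (Real.exp (-r)) * (r : ℝ≥0∞) ^ x *
      ((x.factorial : ℕ) : ℝ≥0∞)⁻¹ := by
  rw [poissonMeasure_singleton, ENNReal.ofReal_div_of_pos (by positivity),
    ENNReal.ofReal_mul (Real.exp_nonneg _), ENNReal.ofReal_pow r.coe_nonneg, ENNReal.ofReal_natCast,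
    div_eq_mul_inv, ENNReal.ofReal_coe_nnreal]

/-- This counts the factors `a` lost in the comparison: one per node for its missing edges and one
per child for the edge to it. -/
theorem sum_children_card (t : TreeData (Fin n)) (S : Finset (List ℕ)) (hS : nodes t (k + 1) ⊆ S) :
    ∑ i ∈ nodes t k, ((t i).1 + 1) ≤ 2 * S.card := by
  rw [Finset.sum_add_distrib, Finset.sum_const, smul_eq_mul, mul_one]
  have h1 : (nodes t k).card ≤ S.card :=
    Finset.card_le_card ((nodes_mono t (Nat.le_succ k)).trans hS)
  have h2 : ∑ i ∈ nodes t k, (t i).1 = ((nodes t k).biUnion (children t)).card := by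
    rw [Finset.card_biUnion]
    · simp only [card_children]
    · intro i _ j _ hij
      refine Finset.disjoint_left.2 fun l hl hl' => hij ?_
      obtain ⟨r, -, rfl⟩ := mem_children.1 hl
      obtain ⟨r', -, h⟩ := mem_children.1 hl'
      exact (List.cons.inj h).2.symm
  have h3 : ((nodes t k).biUnion (children t)).card ≤ S.card :=
    Finset.card_le_card ((Finset.subset_insert _ _).trans hS)
  omega

/-- At each node the Poisson weight times the label weights is the product of `exp (-m)`, the
numbers `m * q` of the children, and the inverse factorial. Up to factors `a` these are dominated by
the probabilities of no edges, of the tree edges, and of the right ordering. -/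
theorem goodTrees_le {p : Fin n → Fin n → ℝ} (h0 : ∀ i j, 0 ≤ p i j)
    (h1 : ∀ i j, p i j ≤ 1) (hp : ∀ i j, p i j = p j i) (hq : ∑ j, q j = 1) {a : ℝ≥0∞} (ha : a ≤ 1)
    {S : Finset (List ℕ)} {t : TreeData (Fin n)} (ht : t ∈ goodTrees k a S p m q) :
    a ^ (2 * S.card) *
      treeLaw (labelRootIR m (t []).2) (labelLawIR m q) (treeShape k ⁻¹' {treeShape k t}) ≤
      ((graphLaw p).prod (orderLaw n)) {x | OrderedMatch k (t []).2 x t} := by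
  obtain ⟨hinj, hS, hgood⟩ := ht
  calc a ^ (2 * S.card) *
        treeLaw (labelRootIR m (t []).2) (labelLawIR m q) (treeShape k ⁻¹' {treeShape k t})
      ≤ (∏ i ∈ nodes t k, a ^ ((t i).1 + 1)) *
          ∏ i ∈ nodes t k, (poissonMeasure (m (t i).2) {(t i).1} *
            ∏ j ∈ children t i, q (t j).2) := by
        refine mul_le_mul' ?_ (treeLaw_shape_le hq _ t)
        rw [Finset.prod_pow_eq_pow_sum]
        exact pow_le_pow_right_of_le_one' ha (sum_children_card t S hS)
    _ = ∏ i ∈ nodes t k, (a ^ ((t i).1 + 1) * (poissonMeasure (m (t i).2) {(t i).1} *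
            ∏ j ∈ children t i, q (t j).2)) := Finset.prod_mul_distrib.symm
    _ ≤ _ := ?_
  refine le_trans (Finset.prod_le_prod' fun i hi => ?_) (prod_le_orderedMatch h0 h1 hp hinj rfl)
  obtain ⟨hv, he⟩ := hgood i hi
  rw [poissonMeasure_singleton_eq]
  have hedges : ∏ j ∈ children t i, (a * (m (t i).2 * q (t j).2)) =
      a ^ (t i).1 * ((m (t i).2 : ℝ≥0∞) ^ (t i).1 * ∏ j ∈ children t i, q (t j).2) := by
    rw [Finset.prod_mul_distrib, Finset.prod_mul_distrib, Finset.prod_const, Finset.prod_const,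
      card_children]
  refine le_trans (le_of_eq ?_) (mul_le_mul' (mul_le_mul' (Finset.prod_le_prod' he) hv) le_rfl)
  rw [hedges]
  ring

end PoissonTree

/-! ### The coupling for given edge probabilities, as a kernel. -/

section CouplingIR

variable {n : ℕ} {Θ : Type*} [MeasurableSpace Θ]

theorem measurable_labelRootIR {m : Θ → Fin n → ℝ≥0} (hm : ∀ j, Measurable fun θ => m θ j)
    (v : Fin n) : Measurable fun θ => labelRootIR (m θ) v :=
  (Measure.measurable_map _ Measurable.of_discrete).comp (measurable_poissonMeasure.comp (hm v))

theorem measurable_labelLawIR {m : Θ → Fin n → ℝ≥0} (hm : ∀ j, Measurable fun θ => m θ j)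
    {q : Θ → Fin n → ℝ≥0∞} (hq : ∀ j, Measurable fun θ => q θ j) :
    Measurable fun θ => labelLawIR (m θ) (q θ) := by
  refine Measure.measurable_of_measurable_coe _ fun s hs => ?_
  simp only [labelLawIR, Measure.finsetSum_apply, Measure.smul_apply, smul_eq_mul]
  exact Finset.measurable_sum _ fun j _ => (hq j).mul
    ((Measure.measurable_coe hs).comp (measurable_labelRootIR hm j))

/-- The graph together with the independent orderings of children matches at most one shape, so
`exists_coupling_of_relation` applies with the ratio from `goodTrees_le`; afterwards the orderings
are forgotten. A kernel in `θ` is built since the weights are not discrete. -/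
theorem exists_coupling_IR {p : Θ → Fin n → Fin n → ℝ} (hpm : ∀ i j, Measurable fun θ => p θ i j)
    (h0 : ∀ θ i j, 0 ≤ p θ i j) (h1 : ∀ θ i j, p θ i j ≤ 1) (hp : ∀ θ i j, p θ i j = p θ j i)
    {m : Θ → Fin n → ℝ≥0} (hm : ∀ j, Measurable fun θ => m θ j) {q : Θ → Fin n → ℝ≥0∞}
    (hqm : ∀ j, Measurable fun θ => q θ j) (hq : ∀ θ, ∑ j, q θ j = 1) (k : ℕ) :
    ∃ π : Kernel (Θ × Fin n) (SimpleGraph (Fin n) × TreeData (Fin n)), IsMarkovKernel π ∧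
      (∀ x, (π x).map Prod.fst = graphLaw (p x.1)) ∧
      (∀ x, (π x).map Prod.snd =
        treeLaw (labelRootIR (m x.1) x.2) (labelLawIR (m x.1) (q x.1))) ∧
      ∀ x (a : ℝ≥0∞) (S : Finset (List ℕ)), a ≤ 1 →
        a ^ (2 * S.card) * treeLaw (labelRootIR (m x.1) x.2) (labelLawIR (m x.1) (q x.1))
          (goodTrees k a S (p x.1) (m x.1) (q x.1)) ≤
        π x {y | Matches k (simpleMult y.1) x.2 y.2} := by
  have := fun θ => isProbabilityMeasure_labelLawIR (m θ) (hq θ)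
  have := fun θ => isProbabilityMeasure_graphLaw (h0 θ) (h1 θ)
  let _ : MeasurableSpace (Finset (List ℕ × ℕ × Fin n)) := ⊤
  have _ : DiscreteMeasurableSpace (Finset (List ℕ × ℕ × Fin n)) := ⟨fun _ => trivial⟩
  let Γ : Kernel Θ (SimpleGraph (Fin n)) := ⟨fun θ => graphLaw (p θ), measurable_graphLaw hpm⟩
  have : IsMarkovKernel Γ := ⟨fun θ => inferInstanceAs (IsProbabilityMeasure (graphLaw (p θ)))⟩
  let μ : Kernel Θ (SimpleGraph (Fin n) × ChildOrder n) := Γ ×ₖ Kernel.const Θ (orderLaw n)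
  let ν : Fin n → Kernel Θ (TreeData (Fin n)) := fun v =>
    ⟨fun θ => treeLaw (labelRootIR (m θ) v) (labelLawIR (m θ) (q θ)),
      measurable_treeLaw (measurable_labelRootIR hm v) (measurable_labelLawIR hm hqm)⟩
  have : ∀ v, IsMarkovKernel (ν v) := fun v => ⟨fun θ => inferInstanceAs
    (IsProbabilityMeasure (treeLaw (labelRootIR (m θ) v) (labelLawIR (m θ) (q θ))))⟩
  have hμ : ∀ θ, μ θ = (graphLaw (p θ)).prod (orderLaw n) := fun θ => by
    simp only [μ, Kernel.prod_apply, Kernel.const_apply]; rfl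
  choose π hπ1 hπ2 hπ3 hπ4 using fun v => exists_coupling_of_relation μ (ν v)
    (measurable_treeShape k) (OrderedMatch k v) (fun x y y' => OrderedMatch.shape_eq)
  let ρ : Kernel (Θ × Fin n) ((SimpleGraph (Fin n) × ChildOrder n) × TreeData (Fin n)) :=
    ⟨fun x => π x.2 x.1, measurable_from_prod_countable_left fun v => (π v).measurable⟩
  have : IsMarkovKernel ρ := ⟨fun x => inferInstanceAs (IsProbabilityMeasure (π x.2 x.1))⟩
  have hfm : Measurable (Prod.map Prod.fst id :
      (SimpleGraph (Fin n) × ChildOrder n) × TreeData (Fin n) → _) :=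
    measurable_fst.prodMap measurable_id
  have hρ : ∀ x, ρ.map (Prod.map Prod.fst id) x = (π x.2 x.1).map (Prod.map Prod.fst id) :=
    fun x => Kernel.map_apply _ hfm _
  refine ⟨ρ.map (Prod.map Prod.fst id), Kernel.IsMarkovKernel.map _ hfm, fun x => ?_, fun x => ?_,
    fun x a S ha => ?_⟩
  · rw [hρ, Measure.map_map measurable_fst hfm]
    have : (Prod.fst ∘ Prod.map Prod.fst id : (SimpleGraph (Fin n) × ChildOrder n) ×
        TreeData (Fin n) → _) = Prod.fst ∘ Prod.fst := rfl
    rw [this, ← Measure.map_map measurable_fst measurable_fst, hπ2, hμ, Measure.map_fst_prod,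
      measure_univ, one_smul]
  · rw [hρ, Measure.map_map measurable_snd hfm]
    exact hπ3 x.2 x.1
  · obtain ⟨θ, v⟩ := x
    rw [hρ]
    refine le_trans ?_ (Measure.le_map_apply hfm.aemeasurable _)
    -- Good trees may have any label at the root; under the tree law it is `v` almost surely.
    let R : Set (TreeData (Fin n)) := {t | (t []).2 = v}
    have hR : treeLaw (labelRootIR (m θ) v) (labelLawIR (m θ) (q θ)) Rᶜ = 0 := by
      have h := treeLaw_apply (labelRootIR (m θ) v) (labelLawIR (m θ) (q θ)) []
        (B := {x | x.2 ≠ v}) MeasurableSet.of_discrete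
      refine h.trans ?_
      rw [if_pos rfl, labelRootIR, Measure.map_apply Measurable.of_discrete MeasurableSet.of_discrete]
      simp
    have key := hπ4 v θ (a ^ (2 * S.card)) (goodTrees k a S (p θ) (m θ) (q θ) ∩ R)
      (pow_le_one' ha _) ?_
    · refine le_trans ?_ (key.trans (measure_mono ?_))
      · refine mul_le_mul' le_rfl ?_
        refine (measure_mono (Set.inter_union_compl _ R).symm.subset).trans
          ((measure_union_le _ _).trans ?_)
        refine (add_le_add le_rfl ((measure_mono Set.inter_subset_right).trans hR.le)).trans ?_
        rw [add_zero]
        exact le_rfl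
      · rintro ⟨x, t⟩ ⟨t', ht', hs⟩
        exact ht'.toMatches.congr (agree_of_treeShape_eq hs)
    · rintro t ⟨ht, hv⟩
      change (t []).2 = v at hv
      subst hv
      rw [hμ]
      exact goodTrees_le (h0 θ) (h1 θ) (hp θ) (hq θ) ha ht

end CouplingIR

/-! ### Asymptotics of the label trees -/

theorem measure_eq_sum_label {n : ℕ} (L : Measure (ℕ × Fin n)) (s : Set (ℕ × Fin n)) :
    L s = ∑ u, L {x | x ∈ s ∧ x.2 = u} := by
  have hU : s = ⋃ u ∈ (Finset.univ : Finset (Fin n)), {x | x ∈ s ∧ x.2 = u} := by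
    ext x; simp
  conv_lhs => rw [hU]
  refine measure_biUnion_finset (fun u _ w _ huw => ?_) fun _ _ => MeasurableSet.of_discrete
  exact Set.disjoint_left.2 fun x hx hx' => huw (hx.2.symm.trans hx'.2)

theorem measure_label_mem_le {n : ℕ} (L : Measure (ℕ × Fin n)) (B : Finset (Fin n)) :
    L {x | x.2 ∈ B} ≤ ∑ u ∈ B, L {x | x.2 = u} := by
  have hU : {x : ℕ × Fin n | x.2 ∈ B} = ⋃ u ∈ B, {x | x.2 = u} := by
    ext x; simp
  rw [hU]
  exact measure_biUnion_finset_le _ _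

/-- The mean of `f` over the vertices. -/
noncomputable def vertexMean {n : ℕ} (f : Fin n → ℝ≥0∞) : ℝ≥0∞ := (∑ u, f u) / n

theorem vertexMean_mono {n : ℕ} {f g : Fin n → ℝ≥0∞} (h : ∀ u, f u ≤ g u) :
    vertexMean f ≤ vertexMean g :=
  ENNReal.div_le_div_right (Finset.sum_le_sum fun u _ => h u) _

/-! ### Tightness of the tree and distinctness of its labels. -/

section Tight

variable {Ξ : Type*} {𝓕 : Filter Ξ} {N : Ξ → ℕ} {W : ∀ ξ, Fin (N ξ) → ℝ≥0}
  {L : ∀ ξ, Measure (ℕ × Fin (N ξ))}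

/-- Uniform integrability of the weights along the filter. -/
def UniformTail (𝓕 : Filter Ξ) (N : Ξ → ℕ) (W : ∀ ξ, Fin (N ξ) → ℝ≥0) : Prop :=
  ∀ ε : ℝ≥0∞, 0 < ε → ∃ K : ℝ≥0, ∀ᶠ ξ in 𝓕,
    vertexMean (fun u => if K < W ξ u then (1 + W ξ u : ℝ≥0∞) else 0) ≤ ε

/-- The random label has at most `C (1 + W u) / n` mass at the vertex `u`, and given this label the
mean offspring is at most `C W u`. -/
structure TightLabels (𝓕 : Filter Ξ) (N : Ξ → ℕ) (W : ∀ ξ, Fin (N ξ) → ℝ≥0)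
    (L : ∀ ξ, Measure (ℕ × Fin (N ξ))) : Prop where
  prob : ∀ ξ, IsProbabilityMeasure (L ξ)
  label : ∃ C : ℝ≥0, ∀ᶠ ξ in 𝓕, ∀ u, L ξ {x | x.2 = u} ≤ C * ((1 + W ξ u) / N ξ)
  offspring : ∃ C : ℝ≥0, ∀ᶠ ξ in 𝓕, ∀ u,
    ∫⁻ x in {x | x.2 = u}, (x.1 : ℝ≥0∞) ∂(L ξ) ≤ C * W ξ u * L ξ {x | x.2 = u}

theorem exists_pos_mul_le (C : ℝ≥0) {ε : ℝ≥0∞} (hε : 0 < ε) : ∃ δ : ℝ≥0∞, 0 < δ ∧ C * δ ≤ ε := by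
  refine ⟨ε / (C + 1), ENNReal.div_pos hε.ne' (by finiteness), ?_⟩
  calc (C : ℝ≥0∞) * (ε / (C + 1)) ≤ (C + 1) * (ε / (C + 1)) := by gcongr; exact le_self_add
    _ ≤ ε := ENNReal.mul_div_le

theorem TightLabels.weight_le (h : TightLabels 𝓕 N W L) (hW : UniformTail 𝓕 N W) {ε : ℝ≥0∞}
    (hε : 0 < ε) : ∃ K : ℝ≥0, ∀ᶠ ξ in 𝓕, L ξ {x | K < W ξ x.2} ≤ ε := by
  obtain ⟨C, hC⟩ := h.label
  obtain ⟨δ, hδ, hδε⟩ := exists_pos_mul_le C hε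
  obtain ⟨K, hK⟩ := hW δ hδ
  refine ⟨K, ?_⟩
  filter_upwards [hC, hK] with ξ h1 h2
  refine le_trans ?_ ((mul_le_mul_right h2 (C : ℝ≥0∞)).trans hδε)
  rw [measure_eq_sum_label, vertexMean, div_eq_mul_inv, Finset.sum_mul, Finset.mul_sum]
  refine Finset.sum_le_sum fun u _ => ?_
  split_ifs with hu
  · refine (measure_mono fun x hx => hx.2).trans ((h1 u).trans (le_of_eq ?_))
    rw [div_eq_mul_inv]
  · have : {x : ℕ × Fin (N ξ) | x ∈ {x | K < W ξ x.2} ∧ x.2 = u} = ∅ := by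
      ext x
      simp only [Set.mem_ofPred_eq, Set.mem_empty_iff_false, iff_false, not_and]
      rintro hx rfl
      exact hu hx
    rw [this, measure_empty]
    exact zero_le

/-- On vertices of weight at most `K` the label law is bounded by a constant times the uniform law,
so a function with vanishing vertex mean also has vanishing mean under the label law. -/
theorem TightLabels.sum_label_mul_le (h : TightLabels 𝓕 N W L) {f : ∀ ξ, Fin (N ξ) → ℝ≥0∞}
    (hf : Tendsto (fun ξ => vertexMean (f ξ)) 𝓕 (𝓝 0)) (K : ℝ≥0) {ε : ℝ≥0∞} (hε : 0 < ε) :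
    ∀ᶠ ξ in 𝓕, ∑ u, (if W ξ u ≤ K then L ξ {x | x.2 = u} * f ξ u else 0) ≤ ε := by
  obtain ⟨C, hC⟩ := h.label
  obtain ⟨δ, hδ, hδε⟩ := exists_pos_mul_le (C * (1 + K)) hε
  filter_upwards [hC, hf.eventually (ge_mem_nhds hδ)] with ξ h1 h2
  refine le_trans ?_ ((mul_le_mul_right h2 ((C * (1 + K) : ℝ≥0) : ℝ≥0∞)).trans hδε)
  rw [vertexMean, div_eq_mul_inv, Finset.sum_mul, Finset.mul_sum]
  refine Finset.sum_le_sum fun u _ => ?_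
  split_ifs with hu
  · refine (mul_le_mul_left (h1 u) _).trans ?_
    have : (1 + W ξ u : ℝ≥0∞) ≤ 1 + K := by gcongr
    calc (C : ℝ≥0∞) * ((1 + W ξ u) / N ξ) * f ξ u ≤ C * ((1 + K) / N ξ) * f ξ u := by gcongr
      _ = _ := by push_cast; rw [div_eq_mul_inv]; ring
  · exact zero_le

theorem TightLabels.label_mem_le (h : TightLabels 𝓕 N W L) (hW : UniformTail 𝓕 N W)
    {B : ∀ ξ, Finset (Fin (N ξ))} (hB : Tendsto (fun ξ => ((B ξ).card : ℝ≥0∞) / N ξ) 𝓕 (𝓝 0))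
    {ε : ℝ≥0∞} (hε : 0 < ε) : ∀ᶠ ξ in 𝓕, L ξ {x | x.2 ∈ B ξ} ≤ ε := by
  classical
  obtain ⟨K, hK⟩ := h.weight_le hW (ENNReal.half_pos hε.ne')
  have hf : Tendsto (fun ξ => vertexMean fun u => if u ∈ B ξ then (1 : ℝ≥0∞) else 0) 𝓕 (𝓝 0) := by
    refine hB.congr fun ξ => ?_
    simp [vertexMean]
  filter_upwards [hK, h.sum_label_mul_le hf K (ENNReal.half_pos hε.ne')] with ξ h1 h2
  have hsub : {x : ℕ × Fin (N ξ) | x.2 ∈ B ξ} ⊆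
      {x | K < W ξ x.2} ∪ {x | x.2 ∈ (B ξ).filter fun u => W ξ u ≤ K} := by
    intro x hx
    by_cases hxK : K < W ξ x.2
    · exact Or.inl hxK
    · exact Or.inr (Finset.mem_filter.2 ⟨hx, not_lt.1 hxK⟩)
  refine (measure_mono hsub).trans ((measure_union_le _ _).trans ?_)
  rw [← ENNReal.add_halves ε]
  refine add_le_add h1 (le_trans ?_ h2)
  refine (measure_label_mem_le _ _).trans ?_
  rw [Finset.sum_filter, ← Finset.sum_filter_add_sum_filter_not Finset.univ (fun u => u ∈ B ξ)]
  refine le_add_right (le_of_eq ?_)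
  rw [Finset.filter_mem_eq_inter, Finset.univ_inter]
  exact Finset.sum_congr rfl fun u hu => by simp [hu]

/-- Heavy labels are improbable, and on light labels the mean offspring is bounded by `C * K`, so
Markov's inequality applies. -/
theorem TightLabels.offspring_le (h : TightLabels 𝓕 N W L) (hW : UniformTail 𝓕 N W) {ε : ℝ≥0∞}
    (hε : 0 < ε) : ∃ M : ℕ, ∀ᶠ ξ in 𝓕, L ξ {x | M ≤ x.1} ≤ ε := by
  obtain ⟨K, hK⟩ := h.weight_le hW (ENNReal.half_pos hε.ne')
  obtain ⟨C, hC⟩ := h.offspring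
  have hpos := ENNReal.half_pos hε.ne'
  obtain ⟨M, hM⟩ : ∃ M : ℕ, (C * K : ℝ≥0∞) / (ε / 2) ≤ M := by
    obtain ⟨M, hM⟩ := ENNReal.exists_nat_gt (r := (C * K : ℝ≥0∞) / (ε / 2))
      (ENNReal.div_lt_top (by finiteness) hpos.ne').ne
    exact ⟨M, hM.le⟩
  refine ⟨M + 1, ?_⟩
  filter_upwards [hK, hC] with ξ h1 h2
  have := h.prob ξ
  have hsub : {x : ℕ × Fin (N ξ) | M + 1 ≤ x.1} ⊆
      {x | K < W ξ x.2} ∪ {x | M + 1 ≤ x.1 ∧ W ξ x.2 ≤ K} := by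
    intro x hx
    by_cases hxK : K < W ξ x.2
    · exact Or.inl hxK
    · exact Or.inr ⟨hx, not_lt.1 hxK⟩
  refine (measure_mono hsub).trans ((measure_union_le _ _).trans ?_)
  rw [← ENNReal.add_halves ε]
  refine add_le_add h1 ?_
  have hmul : ((M + 1 : ℕ) : ℝ≥0∞) * L ξ {x | M + 1 ≤ x.1 ∧ W ξ x.2 ≤ K} ≤ C * K := by
    rw [measure_eq_sum_label, Finset.mul_sum]
    calc ∑ u, ((M + 1 : ℕ) : ℝ≥0∞) * L ξ {x | x ∈ {x | M + 1 ≤ x.1 ∧ W ξ x.2 ≤ K} ∧ x.2 = u}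
        ≤ ∑ u, C * K * L ξ {x | x.2 = u} := by
          refine Finset.sum_le_sum fun u _ => ?_
          by_cases hu : W ξ u ≤ K
          · calc ((M + 1 : ℕ) : ℝ≥0∞) *
                  L ξ {x | x ∈ {x | M + 1 ≤ x.1 ∧ W ξ x.2 ≤ K} ∧ x.2 = u}
                = ∫⁻ x in {x | x ∈ {x : ℕ × Fin (N ξ) | M + 1 ≤ x.1 ∧ W ξ x.2 ≤ K} ∧ x.2 = u},
                    ((M + 1 : ℕ) : ℝ≥0∞) ∂(L ξ) := by rw [setLIntegral_const]
              _ ≤ ∫⁻ x in {x | x ∈ {x : ℕ × Fin (N ξ) | M + 1 ≤ x.1 ∧ W ξ x.2 ≤ K} ∧ x.2 = u},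
                    (x.1 : ℝ≥0∞) ∂(L ξ) :=
                  setLIntegral_mono' MeasurableSet.of_discrete fun x hx =>
                    Nat.cast_le.2 hx.1.1
              _ ≤ ∫⁻ x in {x | x.2 = u}, (x.1 : ℝ≥0∞) ∂(L ξ) :=
                  lintegral_mono_set fun x hx => hx.2
              _ ≤ _ := (h2 u).trans (by gcongr)
          · have : {x : ℕ × Fin (N ξ) | x ∈ {x | M + 1 ≤ x.1 ∧ W ξ x.2 ≤ K} ∧ x.2 = u} = ∅ := by
              ext x
              simp only [Set.mem_ofPred_eq, Set.mem_empty_iff_false, iff_false, not_and]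
              rintro hx rfl
              exact hu hx.2
            rw [this, measure_empty, mul_zero]
            exact zero_le
      _ = C * K * L ξ Set.univ := by
          rw [measure_eq_sum_label (L ξ) Set.univ, Finset.mul_sum]
          simp
      _ = C * K := by rw [measure_univ, mul_one]
  have hM0 : ((M + 1 : ℕ) : ℝ≥0∞) ≠ 0 := by simp
  calc L ξ {x | M + 1 ≤ x.1 ∧ W ξ x.2 ≤ K} ≤ C * K / ((M + 1 : ℕ) : ℝ≥0∞) := by
        rw [ENNReal.le_div_iff_mul_le (Or.inl hM0) (Or.inl (ENNReal.natCast_ne_top _)), mul_comm]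
        exact hmul
    _ ≤ ε / 2 := by
        by_cases htop : ε / 2 = ∞
        · rw [htop]; exact le_top
        refine ENNReal.div_le_of_le_mul ?_
        rw [ENNReal.div_le_iff hpos.ne' htop] at hM
        refine hM.trans ?_
        rw [mul_comm]
        gcongr
        exact Nat.le_succ M

/-- A heavy vertex is a single summand of the uniformly small tail mean, and for a light one `(1 +
K) / N ξ` tends to zero. -/
theorem TightLabels.label_le (h : TightLabels 𝓕 N W L) (hW : UniformTail 𝓕 N W)
    (hN : Tendsto N 𝓕 atTop) {ε : ℝ≥0∞} (hε : 0 < ε) :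
    ∀ᶠ ξ in 𝓕, ∀ u, L ξ {x | x.2 = u} ≤ ε := by
  obtain ⟨C, hC⟩ := h.label
  obtain ⟨δ, hδ, hδε⟩ := exists_pos_mul_le C hε
  obtain ⟨K, hK⟩ := hW δ hδ
  have hlim : Tendsto (fun ξ => (1 + K : ℝ≥0∞) / N ξ) 𝓕 (𝓝 0) :=
    (ENNReal.Tendsto.const_div (b := ⊤) (ENNReal.tendsto_nat_nhds_top.comp hN)
      (Or.inr (by finiteness))).trans (by simp)
  filter_upwards [hC, hK, hlim.eventually (ge_mem_nhds hδ)] with ξ h1 h2 h3 u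
  refine (h1 u).trans ((mul_le_mul_right ?_ (C : ℝ≥0∞)).trans hδε)
  by_cases hu : K < W ξ u
  · refine le_trans (ENNReal.div_le_div_right ?_ _) h2
    have := Finset.single_le_sum (f := fun u => if K < W ξ u then (1 + W ξ u : ℝ≥0∞) else 0)
      (fun i _ => zero_le) (Finset.mem_univ u)
    simpa [hu] using this
  · refine le_trans (ENNReal.div_le_div_right ?_ _) h3
    have := not_lt.1 hu
    gcongr

variable {L₀ L₁ : ∀ ξ, Measure (ℕ × Fin (N ξ))}

/-- If the nodes of generation at most `k` lie in a finite set and each of these labels has fewer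
than `M` children with high probability, the next generation also lies in a finite set. The set does
not depend on `ξ`, which later makes union bounds possible. -/
theorem exists_nodes_subset (h₀ : TightLabels 𝓕 N W L₀) (h₁ : TightLabels 𝓕 N W L₁)
    (hW : UniformTail 𝓕 N W) (k : ℕ) {ε : ℝ≥0∞} (hε : 0 < ε) :
    ∃ S : Finset (List ℕ), ∀ᶠ ξ in 𝓕,
      treeLaw (L₀ ξ) (L₁ ξ) {t | ¬ nodes t k ⊆ S} ≤ ε := by
  induction k generalizing ε with
  | zero => exact ⟨{[]}, Eventually.of_forall fun ξ => by simp [nodes]⟩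
  | succ k ih =>
    obtain ⟨S, hS⟩ := ih (ENNReal.half_pos hε.ne')
    have hpos : 0 < ε / 2 / (S.card + 1 : ℕ) :=
      ENNReal.div_pos (ENNReal.half_pos hε.ne').ne' (ENNReal.natCast_ne_top _)
    obtain ⟨M₀, hM₀⟩ := h₀.offspring_le hW hpos
    obtain ⟨M₁, hM₁⟩ := h₁.offspring_le hW hpos
    let M := max M₀ M₁
    refine ⟨insert [] (S.biUnion fun i => (Finset.range M).image (· :: i)), ?_⟩
    filter_upwards [hS, hM₀, hM₁] with ξ h2 h3 h4
    have := h₀.prob ξ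
    have := h₁.prob ξ
    have hsub : {t : TreeData (Fin (N ξ)) | ¬ nodes t (k + 1) ⊆
        insert [] (S.biUnion fun i => (Finset.range M).image (· :: i))} ⊆
        {t | ¬ nodes t k ⊆ S} ∪ ⋃ i ∈ S, {t | t i ∈ {x : ℕ × Fin (N ξ) | M ≤ x.1}} := by
      intro t ht
      by_contra hc
      simp only [Set.mem_union, Set.mem_ofPred_eq, not_or, not_not, Set.mem_iUnion, not_exists,
        not_le] at hc
      refine ht (Finset.insert_subset_insert _ ?_)
      intro j hj
      obtain ⟨i, hi, hj⟩ := Finset.mem_biUnion.1 hj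
      obtain ⟨r, hr, rfl⟩ := mem_children.1 hj
      refine Finset.mem_biUnion.2 ⟨i, hc.1 hi, Finset.mem_image.2 ⟨r, ?_, rfl⟩⟩
      exact Finset.mem_range.2 (hr.trans (hc.2 i (hc.1 hi)))
    refine (measure_mono hsub).trans ((measure_union_le _ _).trans ?_)
    rw [← ENNReal.add_halves ε]
    refine add_le_add h2 ((measure_biUnion_finset_le _ _).trans ?_)
    have hle : ∀ i ∈ S, treeLaw (L₀ ξ) (L₁ ξ) {t | t i ∈ {x : ℕ × Fin (N ξ) | M ≤ x.1}} ≤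
        ε / 2 / (S.card + 1 : ℕ) := by
      intro i _
      rw [treeLaw_apply _ _ _ MeasurableSet.of_discrete]
      split_ifs
      · exact (measure_mono fun x hx => le_trans (le_max_left M₀ M₁) hx).trans h3
      · exact (measure_mono fun x hx => le_trans (le_max_right M₀ M₁) hx).trans h4
    refine (Finset.sum_le_sum hle).trans ?_
    rw [Finset.sum_const, nsmul_eq_mul]
    calc (S.card : ℝ≥0∞) * (ε / 2 / (S.card + 1 : ℕ))
        ≤ ((S.card + 1 : ℕ) : ℝ≥0∞) * (ε / 2 / (S.card + 1 : ℕ)) := by gcongr; exact Nat.le_succ _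
      _ ≤ ε / 2 := ENNReal.mul_div_le

/-- For independent labels the probability of coincidence is the sum of the products of their
masses, hence at most the largest mass. -/
theorem label_collision_le (h₀ : TightLabels 𝓕 N W L₀) (h₁ : TightLabels 𝓕 N W L₁)
    (hW : UniformTail 𝓕 N W) (hN : Tendsto N 𝓕 atTop) {i j : List ℕ} (hij : i ≠ j) {ε : ℝ≥0∞}
    (hε : 0 < ε) : ∀ᶠ ξ in 𝓕, treeLaw (L₀ ξ) (L₁ ξ) {t | (t i).2 = (t j).2} ≤ ε := by
  filter_upwards [h₀.label_le hW hN hε, h₁.label_le hW hN hε] with ξ h2 h3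
  have := h₀.prob ξ
  have := h₁.prob ξ
  have hsub : {t : TreeData (Fin (N ξ)) | (t i).2 = (t j).2} ⊆
      ⋃ u, {t | t i ∈ {x : ℕ × Fin (N ξ) | x.2 = u} ∧ t j ∈ {x : ℕ × Fin (N ξ) | x.2 = u}} :=
    fun t ht => Set.mem_iUnion.2 ⟨(t i).2, rfl, Eq.symm ht⟩
  refine (measure_mono hsub).trans ((measure_iUnion_fintype_le _ _).trans ?_)
  have hle : ∀ u, treeLaw (L₀ ξ) (L₁ ξ)
      {t | t i ∈ {x : ℕ × Fin (N ξ) | x.2 = u} ∧ t j ∈ {x : ℕ × Fin (N ξ) | x.2 = u}} ≤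
      (if i = [] then L₀ ξ else L₁ ξ) {x | x.2 = u} * ε := by
    intro u
    rw [treeLaw_apply_pair _ _ hij MeasurableSet.of_discrete MeasurableSet.of_discrete]
    gcongr
    split_ifs
    · exact h2 u
    · exact h3 u
  refine (Finset.sum_le_sum fun u _ => hle u).trans ?_
  rw [← Finset.sum_mul]
  refine mul_le_of_le_one_left' (le_of_eq ?_)
  have := measure_eq_sum_label (if i = [] then L₀ ξ else L₁ ξ) Set.univ
  rw [measure_univ] at this
  simpa using this.symm

theorem not_injOn_le (h₀ : TightLabels 𝓕 N W L₀) (h₁ : TightLabels 𝓕 N W L₁)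
    (hW : UniformTail 𝓕 N W) (hN : Tendsto N 𝓕 atTop) (k : ℕ) {ε : ℝ≥0∞} (hε : 0 < ε) :
    ∀ᶠ ξ in 𝓕, treeLaw (L₀ ξ) (L₁ ξ)
      {t | ¬ Set.InjOn (fun i => (t i).2) (nodes t k)} ≤ ε := by
  obtain ⟨S, hS⟩ := exists_nodes_subset h₀ h₁ hW k (ENNReal.half_pos hε.ne')
  have hpos : 0 < ε / 2 / (S.offDiag.card + 1 : ℕ) :=
    ENNReal.div_pos (ENNReal.half_pos hε.ne').ne' (ENNReal.natCast_ne_top _)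
  have hall : ∀ᶠ ξ in 𝓕, ∀ q ∈ S.offDiag,
      treeLaw (L₀ ξ) (L₁ ξ) {t | (t q.1).2 = (t q.2).2} ≤ ε / 2 / (S.offDiag.card + 1 : ℕ) := by
    rw [Filter.eventually_all_finset]
    intro q hq
    exact label_collision_le h₀ h₁ hW hN (Finset.mem_offDiag.1 hq).2.2 hpos
  filter_upwards [hS, hall] with ξ h2 h3
  have hsub : {t : TreeData (Fin (N ξ)) | ¬ Set.InjOn (fun i => (t i).2) (nodes t k)} ⊆
      {t | ¬ nodes t k ⊆ S} ∪ ⋃ q ∈ S.offDiag, {t | (t q.1).2 = (t q.2).2} := by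
    intro t ht
    by_contra hc
    simp only [Set.mem_union, Set.mem_ofPred_eq, not_or, not_not, Set.mem_iUnion,
      not_exists] at hc
    refine ht fun i hi j hj hij => ?_
    by_contra hne
    exact hc.2 (i, j) (Finset.mem_offDiag.2 ⟨hc.1 hi, hc.1 hj, hne⟩) hij
  refine (measure_mono hsub).trans ((measure_union_le _ _).trans ?_)
  rw [← ENNReal.add_halves ε]
  refine add_le_add h2 ((measure_biUnion_finset_le _ _).trans ((Finset.sum_le_sum h3).trans ?_))
  rw [Finset.sum_const, nsmul_eq_mul]
  calc (S.offDiag.card : ℝ≥0∞) * (ε / 2 / (S.offDiag.card + 1 : ℕ))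
      ≤ ((S.offDiag.card + 1 : ℕ) : ℝ≥0∞) * (ε / 2 / (S.offDiag.card + 1 : ℕ)) := by
        gcongr; exact Nat.le_succ _
    _ ≤ ε / 2 := ENNReal.mul_div_le

end Tight

/-! ### Atypical vertices and pairs in the inhomogeneous graph. -/

section GoodVertices

theorem exp_le_one_sub {x : ℝ} (h1 : x ≤ 1 / 2) :
    Real.exp (-x - 2 * x ^ 2) ≤ 1 - x := by
  have hpos : 0 < 1 - x := by linarith
  rw [← Real.le_log_iff_exp_le hpos]
  refine le_trans ?_ (Real.one_sub_inv_le_log_of_pos hpos)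
  have : (1 - x) * (1 - x)⁻¹ = 1 := mul_inv_cancel₀ hpos.ne'
  -- Indeed `(1 - x) * (1 + x + 2 * x ^ 2) = 1 + x ^ 2 * (1 - 2 * x)`.
  have hinv : (1 - x)⁻¹ ≤ 1 + x + 2 * x ^ 2 := by
    rw [inv_le_iff_one_le_mul₀ hpos]
    nlinarith [mul_nonneg (sq_nonneg x) (by linarith : (0 : ℝ) ≤ 1 - 2 * x)]
  linarith

/-- Taking logarithms, the product loses `∑ p`, at most `m + η`, and a quadratic term, at most `2 *
ρ * (m + η)` because each `p w` is at most `ρ`. -/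
theorem mul_exp_le_prod_one_sub {ι : Type*} (s : Finset ι) (p r : ι → ℝ) (hp : ∀ w ∈ s, 0 ≤ p w)
    {m η ρ δ : ℝ} (hr : ∑ w ∈ s, r w ≤ m) (hη : ∑ w ∈ s, |p w - r w| ≤ η)
    (hρ : ∀ w ∈ s, p w ≤ ρ) (hρ0 : 0 ≤ ρ) (hρ2 : ρ ≤ 1 / 2) (hδ : η + 2 * ρ * (m + η) ≤ δ) :
    (1 - δ) * Real.exp (-m) ≤ ∏ w ∈ s, (1 - p w) := by
  have hsum : ∑ w ∈ s, p w ≤ m + η := by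
    calc ∑ w ∈ s, p w ≤ ∑ w ∈ s, (r w + |p w - r w|) :=
          Finset.sum_le_sum fun w _ => by linarith [le_abs_self (p w - r w)]
      _ = ∑ w ∈ s, r w + ∑ w ∈ s, |p w - r w| := Finset.sum_add_distrib
      _ ≤ m + η := add_le_add hr hη
  have hsq : ∑ w ∈ s, 2 * p w ^ 2 ≤ 2 * ρ * (m + η) := by
    calc ∑ w ∈ s, 2 * p w ^ 2 ≤ ∑ w ∈ s, 2 * ρ * p w :=
          Finset.sum_le_sum fun w hw => by nlinarith [hp w hw, hρ w hw]
      _ = 2 * ρ * ∑ w ∈ s, p w := (Finset.mul_sum _ _ _).symm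
      _ ≤ _ := mul_le_mul_of_nonneg_left hsum (by linarith)
  calc (1 - δ) * Real.exp (-m) ≤ Real.exp (-δ) * Real.exp (-m) := by
        refine mul_le_mul_of_nonneg_right ?_ (Real.exp_nonneg _)
        linarith [Real.add_one_le_exp (-δ)]
    _ = Real.exp (-δ + -m) := (Real.exp_add _ _).symm
    _ ≤ Real.exp (∑ w ∈ s, (-p w - 2 * p w ^ 2)) := by
        rw [Real.exp_le_exp, Finset.sum_sub_distrib, Finset.sum_neg_distrib]
        linarith
    _ = ∏ w ∈ s, Real.exp (-p w - 2 * p w ^ 2) := Real.exp_sum _ _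
    _ ≤ _ := Finset.prod_le_prod (fun w _ => Real.exp_nonneg _) fun w hw =>
        exp_le_one_sub ((hρ w hw).trans hρ2)

variable {Ξ : Type*} {𝓕 : Filter Ξ} {N : Ξ → ℕ} {W : ∀ ξ, Fin (N ξ) → ℝ≥0}
  {p : ∀ ξ, Fin (N ξ) → Fin (N ξ) → ℝ} {r : ∀ ξ, Fin (N ξ) → Fin (N ξ) → ℝ≥0}
  {m : ∀ ξ, Fin (N ξ) → ℝ≥0}

/-- The total deviation of the probabilities of the edges at `u` from `r u w`. -/
noncomputable def deviation {n : ℕ} (p : Fin n → Fin n → ℝ) (r : Fin n → Fin n → ℝ≥0)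
    (u : Fin n) : ℝ≥0∞ := ∑ w ∈ Finset.univ.erase u, ENNReal.ofReal |p u w - r u w|

open Classical in
/-- The vertices `u` for which the probability of no edges at `u` is much smaller
than `exp (- m u)`. -/
noncomputable def badVertices {n : ℕ} (a : ℝ≥0∞) (p : Fin n → Fin n → ℝ) (m : Fin n → ℝ≥0) :
    Finset (Fin n) :=
  Finset.univ.filter fun u => ¬ a * ENNReal.ofReal (Real.exp (-m u)) ≤
    ∏ w ∈ Finset.univ.erase u, ENNReal.ofReal (1 - p u w)

/-- A vertex of weight at most `K` and of deviation at most `η` is not bad: its edge probabilities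
are uniformly small and sum to at most `m + η`. The uniform tail bounds the proportion of heavy
vertices, and Markov's inequality that of vertices with a large deviation. -/
theorem tendsto_card_badVertices (hp0 : ∀ ξ u w, 0 ≤ p ξ u w) (hp1 : ∀ ξ u w, p ξ u w ≤ 1)
    (hW : UniformTail 𝓕 N W) (hsum : ∀ ξ u, ∑ w, r ξ u w ≤ m ξ u)
    (hm : ∃ C : ℝ≥0, ∀ᶠ ξ in 𝓕, ∀ u, m ξ u ≤ C * W ξ u)
    (hr : ∀ K ρ : ℝ≥0, 0 < ρ → ∀ᶠ ξ in 𝓕, ∀ u w, W ξ u ≤ K → r ξ u w ≤ ρ)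
    (hdev : Tendsto (fun ξ => vertexMean (deviation (p ξ) (r ξ))) 𝓕 (𝓝 0)) {δ : ℝ} (hδ0 : 0 < δ)
    (hδ1 : δ < 1) :
    Tendsto (fun ξ => ((badVertices (ENNReal.ofReal (1 - δ)) (p ξ) (m ξ)).card : ℝ≥0∞) / N ξ)
      𝓕 (𝓝 0) := by
  classical
  obtain ⟨C, hC⟩ := hm
  refine ENNReal.tendsto_nhds_zero.2 fun ε hε => ?_
  obtain ⟨K, hK⟩ := hW _ (ENNReal.half_pos hε.ne')
  set M : ℝ := C * K
  have hM : 0 ≤ M := by positivity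
  -- With `M` bounding the means of light vertices, `η ≤ δ / 2` and `2 * ρ * (M + 1) ≤ δ / 2` add up
  -- to the loss `δ`. The bound `η ≤ ρ / 2` together with `r ≤ ρ / 2` gives `p ≤ ρ`.
  set ρ : ℝ := min (1 / 2) (δ / (4 * (M + 1))) with hρ
  have hρ0 : 0 < ρ := lt_min (by norm_num) (by positivity)
  set η : ℝ := min (ρ / 2) (δ / 2) with hη
  have hη0 : 0 < η := lt_min (by positivity) (by positivity)
  have hρM : ρ * (4 * (M + 1)) ≤ δ := by
    rw [← le_div_iff₀ (by positivity)]; exact min_le_right _ _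
  have hη1 : η ≤ 1 := by
    have : η ≤ δ / 2 := min_le_right _ _
    linarith
  have hbound : η + 2 * ρ * (M + η) ≤ δ := by
    have : η ≤ δ / 2 := min_le_right _ _
    have : 2 * ρ * (M + η) ≤ 2 * ρ * (M + 1) := by gcongr
    linarith
  have hlim : Tendsto (fun ξ => vertexMean (deviation (p ξ) (r ξ)) / ENNReal.ofReal η) 𝓕 (𝓝 0) := by
    have := ENNReal.Tendsto.div_const hdev (b := ENNReal.ofReal η)
      (Or.inr (ENNReal.ofReal_pos.2 hη0).ne')
    simpa using this
  filter_upwards [hK, hC, hr K (ρ / 2).toNNReal (Real.toNNReal_pos.2 (half_pos hρ0)), hlim.eventually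
      (ge_mem_nhds (ENNReal.half_pos hε.ne'))] with ξ h1 h2 h3 h4
  have hbad : badVertices (ENNReal.ofReal (1 - δ)) (p ξ) (m ξ) ⊆
      Finset.univ.filter (fun u => K < W ξ u) ∪
        Finset.univ.filter (fun u => ENNReal.ofReal η < deviation (p ξ) (r ξ) u) := by
    intro u hu
    by_contra hc
    simp only [Finset.mem_union, Finset.mem_filter, Finset.mem_univ, true_and, not_or,
      not_lt] at hc
    obtain ⟨hc1, hc2⟩ := hc
    refine (Finset.mem_filter.1 hu).2 ?_
    rw [deviation, ← ENNReal.ofReal_sum_of_nonneg fun _ _ => abs_nonneg _,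
      ENNReal.ofReal_le_ofReal_iff hη0.le] at hc2
    rw [← ENNReal.ofReal_mul (by linarith), ← ENNReal.ofReal_prod_of_nonneg fun w _ => by
      linarith [hp1 ξ u w]]
    refine ENNReal.ofReal_le_ofReal ?_
    have hmu : (m ξ u : ℝ) ≤ M := by
      have : m ξ u ≤ C * K := (h2 u).trans (by gcongr)
      exact_mod_cast this
    refine mul_exp_le_prod_one_sub _ (p ξ u) (fun w => (r ξ u w : ℝ)) (fun w _ => hp0 ξ u w) ?_ hc2
      (ρ := ρ) ?_ hρ0.le (min_le_left _ _) ?_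
    · have h5 : ∑ w ∈ Finset.univ.erase u, r ξ u w ≤ m ξ u :=
        (Finset.sum_le_sum_of_subset (Finset.erase_subset _ _)).trans (hsum ξ u)
      exact_mod_cast h5
    · intro w hw
      have h5 : |p ξ u w - r ξ u w| ≤ η :=
        (Finset.single_le_sum (f := fun w => |p ξ u w - r ξ u w|)
          (fun _ _ => abs_nonneg _) hw).trans hc2
      have h6 : (r ξ u w : ℝ) ≤ ρ / 2 :=
        (NNReal.coe_le_coe.2 (h3 u w hc1)).trans_eq (Real.coe_toNNReal _ (half_pos hρ0).le)
      have h7 : η ≤ ρ / 2 := min_le_left _ _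
      linarith [le_abs_self (p ξ u w - r ξ u w)]
    · refine le_trans ?_ hbound
      gcongr
  have hcard1 : ((Finset.univ.filter fun u => K < W ξ u).card : ℝ≥0∞) / N ξ ≤ ε / 2 := by
    refine le_trans (ENNReal.div_le_div_right ?_ _) h1
    rw [Finset.card_eq_sum_ones, Nat.cast_sum, Finset.sum_filter]
    refine Finset.sum_le_sum fun u _ => ?_
    split_ifs
    · rw [Nat.cast_one]; exact le_self_add
    · exact le_rfl
  have hcard2 : ((Finset.univ.filter fun u =>
      ENNReal.ofReal η < deviation (p ξ) (r ξ) u).card : ℝ≥0∞) / N ξ ≤ ε / 2 := by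
    refine le_trans ?_ h4
    have hη' : ENNReal.ofReal η ≠ 0 := (ENNReal.ofReal_pos.2 hη0).ne'
    rw [ENNReal.le_div_iff_mul_le (Or.inl hη') (Or.inl ENNReal.ofReal_ne_top), vertexMean,
      div_eq_mul_inv, mul_right_comm, ← div_eq_mul_inv]
    refine ENNReal.div_le_div_right ?_ _
    rw [Finset.card_eq_sum_ones, Nat.cast_sum, Finset.sum_mul, Finset.sum_filter]
    refine Finset.sum_le_sum fun u _ => ?_
    split_ifs with h
    · rw [Nat.cast_one, one_mul]; exact h.le
    · exact zero_le
  calc ((badVertices (ENNReal.ofReal (1 - δ)) (p ξ) (m ξ)).card : ℝ≥0∞) / N ξ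
      ≤ (((Finset.univ.filter fun u => K < W ξ u).card : ℝ≥0∞) +
          ((Finset.univ.filter fun u => ENNReal.ofReal η < deviation (p ξ) (r ξ) u).card : ℝ≥0∞)) /
            N ξ := by
        refine ENNReal.div_le_div_right ?_ _
        exact_mod_cast (Finset.card_le_card hbad).trans (Finset.card_union_le _ _)
    _ ≤ ε := by
        rw [ENNReal.add_div, ← ENNReal.add_halves ε]
        exact add_le_add hcard1 hcard2

variable {q : ∀ ξ, Fin (N ξ) → ℝ≥0∞} {L₀ L₁ : ∀ ξ, Measure (ℕ × Fin (N ξ))}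

/-- For a bad pair `u`, `w` the edge probability falls short of `m u * q w` by a proportion `δ`, so
`m u * q w ≤ |p u w - r u w| / δ`. The left side bounds the probability that a node at `u` has its
`l`-th child and this child is at `w`. Summing over `w` gives the deviation of `u` over `δ`, whose
mean under the label law vanishes on light vertices. Equal labels are left out because the deviation
has no diagonal term. -/
theorem bad_edge_le (h₀ : TightLabels 𝓕 N W L₀) (h₁ : TightLabels 𝓕 N W L₁)
    (hW : UniformTail 𝓕 N W) (hL₁ : ∀ ξ u, L₁ ξ {x | x.2 = u} = q ξ u)
    (hoff : ∀ ξ u l, L₀ ξ {x | l < x.1 ∧ x.2 = u} ≤ m ξ u * L₀ ξ {x | x.2 = u} ∧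
      L₁ ξ {x | l < x.1 ∧ x.2 = u} ≤ m ξ u * L₁ ξ {x | x.2 = u})
    (hq : ∀ ξ u w, (r ξ u w : ℝ≥0∞) = m ξ u * q ξ w)
    (hdev : Tendsto (fun ξ => vertexMean (deviation (p ξ) (r ξ))) 𝓕 (𝓝 0)) {δ : ℝ} (hδ0 : 0 < δ)
    (hδ1 : δ < 1) (i : List ℕ) (l : ℕ) {ε : ℝ≥0∞} (hε : 0 < ε) :
    ∀ᶠ ξ in 𝓕, treeLaw (L₀ ξ) (L₁ ξ) {t | l < (t i).1 ∧ (t i).2 ≠ (t (l :: i)).2 ∧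
      ¬ ENNReal.ofReal (1 - δ) * (m ξ (t i).2 * q ξ (t (l :: i)).2) ≤
        ENNReal.ofReal (p ξ (t i).2 (t (l :: i)).2)} ≤ ε := by
  classical
  let L : ∀ ξ, Measure (ℕ × Fin (N ξ)) := fun ξ => if i = [] then L₀ ξ else L₁ ξ
  have hL : TightLabels 𝓕 N W L := by
    by_cases h : i = []
    · simpa only [L, h, if_true] using h₀
    · simpa only [L, h, if_false] using h₁
  have hoffL : ∀ ξ u l, L ξ {x | l < x.1 ∧ x.2 = u} ≤ m ξ u * L ξ {x | x.2 = u} := by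
    intro ξ u l
    by_cases h : i = []
    · simpa only [L, h, if_true] using (hoff ξ u l).1
    · simpa only [L, h, if_false] using (hoff ξ u l).2
  obtain ⟨K, hK⟩ := hL.weight_le hW (ENNReal.half_pos hε.ne')
  have hf : Tendsto (fun ξ => vertexMean fun u => deviation (p ξ) (r ξ) u / ENNReal.ofReal δ)
      𝓕 (𝓝 0) := by
    have := ENNReal.Tendsto.div_const hdev (b := ENNReal.ofReal δ)
      (Or.inr (ENNReal.ofReal_pos.2 hδ0).ne')
    rw [ENNReal.zero_div] at this
    refine this.congr fun ξ => ?_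
    simp only [vertexMean, div_eq_mul_inv, Finset.sum_mul]
    exact Finset.sum_congr rfl fun u _ => by ring
  filter_upwards [hK, hL.sum_label_mul_le hf K (ENNReal.half_pos hε.ne')] with ξ h1 h2
  have := h₀.prob ξ
  have := h₁.prob ξ
  let bad : Fin (N ξ) → Fin (N ξ) → Prop := fun u w => u ≠ w ∧
    ¬ ENNReal.ofReal (1 - δ) * (m ξ u * q ξ w) ≤ ENNReal.ofReal (p ξ u w)
  have hbad : ∀ u w, bad u w →
      m ξ u * q ξ w ≤ ENNReal.ofReal |p ξ u w - r ξ u w| / ENNReal.ofReal δ := by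
    rintro u w ⟨-, hb⟩
    rw [← hq, ← ENNReal.ofReal_coe_nnreal, ← ENNReal.ofReal_mul (by linarith), not_le] at hb
    have hb' := lt_of_not_ge fun hle => hb.not_ge (ENNReal.ofReal_le_ofReal hle)
    rw [← hq, ← ENNReal.ofReal_coe_nnreal, ← ENNReal.ofReal_div_of_pos hδ0]
    refine ENNReal.ofReal_le_ofReal ?_
    rw [le_div_iff₀ hδ0]
    have := neg_abs_le (p ξ u w - r ξ u w)
    linarith
  have hsub : {t : TreeData (Fin (N ξ)) | l < (t i).1 ∧ (t i).2 ≠ (t (l :: i)).2 ∧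
      ¬ ENNReal.ofReal (1 - δ) * (m ξ (t i).2 * q ξ (t (l :: i)).2) ≤
        ENNReal.ofReal (p ξ (t i).2 (t (l :: i)).2)} ⊆
      {t | t i ∈ {x : ℕ × Fin (N ξ) | K < W ξ x.2}} ∪
        ⋃ u ∈ Finset.univ.filter (fun u => W ξ u ≤ K), ⋃ w ∈ Finset.univ.filter (bad u),
          {t | t i ∈ {x : ℕ × Fin (N ξ) | l < x.1 ∧ x.2 = u} ∧
            t (l :: i) ∈ {x : ℕ × Fin (N ξ) | x.2 = w}} := by
    rintro t ⟨ht1, ht2⟩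
    by_cases hKt : K < W ξ (t i).2
    · exact Or.inl hKt
    · refine Or.inr ?_
      simp only [Set.mem_iUnion, Finset.mem_filter, Finset.mem_univ, true_and]
      exact ⟨(t i).2, not_lt.1 hKt, (t (l :: i)).2, ht2, ⟨ht1, rfl⟩, rfl⟩
  refine (measure_mono hsub).trans ((measure_union_le _ _).trans ?_)
  rw [← ENNReal.add_halves ε]
  refine add_le_add ?_ (le_trans ?_ h2)
  · rw [treeLaw_apply _ _ _ MeasurableSet.of_discrete]
    exact h1
  · rw [← Finset.sum_filter]
    refine (measure_biUnion_finset_le _ _).trans (Finset.sum_le_sum fun u _ => ?_)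
    refine (measure_biUnion_finset_le _ _).trans ?_
    have hli : i ≠ l :: i := fun h => by simpa using congrArg List.length h
    have hle : ∀ w ∈ Finset.univ.filter (bad u), treeLaw (L₀ ξ) (L₁ ξ)
        {t | t i ∈ {x : ℕ × Fin (N ξ) | l < x.1 ∧ x.2 = u} ∧
            t (l :: i) ∈ {x : ℕ × Fin (N ξ) | x.2 = w}} ≤
        L ξ {x | x.2 = u} * (ENNReal.ofReal |p ξ u w - r ξ u w| / ENNReal.ofReal δ) := by
      intro w hw
      rw [treeLaw_apply_pair _ _ hli MeasurableSet.of_discrete MeasurableSet.of_discrete,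
        if_neg (List.cons_ne_nil l i), hL₁]
      refine (mul_le_mul_left (hoffL ξ u l) _).trans ?_
      rw [mul_comm (m ξ u : ℝ≥0∞), mul_assoc]
      exact mul_le_mul_right (hbad u w (Finset.mem_filter.1 hw).2) _
    refine (Finset.sum_le_sum hle).trans ?_
    rw [← Finset.mul_sum]
    refine mul_le_mul_right ?_ _
    simp only [deviation, div_eq_mul_inv]
    rw [← Finset.sum_mul]
    refine mul_le_mul_left (Finset.sum_le_sum_of_subset fun w hw => ?_) _
    exact Finset.mem_erase.2 ⟨(Finset.mem_filter.1 hw).2.1.symm, Finset.mem_univ _⟩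

/-- A union bound over the labels in `S`; the three `ε` are for coinciding vertices, bad vertices
and bad pairs. The event of leaving `S` is kept apart because `S` has to be fixed before `δ`, as the
loss in the comparison is a power with exponent `2 * S.card`. -/
theorem goodTrees_compl_le (h₀ : TightLabels 𝓕 N W L₀) (h₁ : TightLabels 𝓕 N W L₁)
    (hW : UniformTail 𝓕 N W) (hN : Tendsto N 𝓕 atTop)
    (hp0 : ∀ ξ u w, 0 ≤ p ξ u w) (hp1 : ∀ ξ u w, p ξ u w ≤ 1)
    (hsum : ∀ ξ u, ∑ w, r ξ u w ≤ m ξ u)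
    (hm : ∃ C : ℝ≥0, ∀ᶠ ξ in 𝓕, ∀ u, m ξ u ≤ C * W ξ u)
    (hr : ∀ K ρ : ℝ≥0, 0 < ρ → ∀ᶠ ξ in 𝓕, ∀ u w, W ξ u ≤ K → r ξ u w ≤ ρ)
    (hL₁ : ∀ ξ u, L₁ ξ {x | x.2 = u} = q ξ u)
    (hoff : ∀ ξ u l, L₀ ξ {x | l < x.1 ∧ x.2 = u} ≤ m ξ u * L₀ ξ {x | x.2 = u} ∧
      L₁ ξ {x | l < x.1 ∧ x.2 = u} ≤ m ξ u * L₁ ξ {x | x.2 = u})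
    (hq : ∀ ξ u w, (r ξ u w : ℝ≥0∞) = m ξ u * q ξ w)
    (hdev : Tendsto (fun ξ => vertexMean (deviation (p ξ) (r ξ))) 𝓕 (𝓝 0)) {δ : ℝ} (hδ0 : 0 < δ)
    (hδ1 : δ < 1) (k : ℕ) (S : Finset (List ℕ)) {ε : ℝ≥0∞} (hε : 0 < ε) :
    ∀ᶠ ξ in 𝓕, treeLaw (L₀ ξ) (L₁ ξ)
        (goodTrees k (ENNReal.ofReal (1 - δ)) S (p ξ) (m ξ) (q ξ))ᶜ ≤
      treeLaw (L₀ ξ) (L₁ ξ) {t | ¬ nodes t (k + 1) ⊆ S} + 3 * ε := by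
  have hpos : 0 < ε / (S.card + 1 : ℕ) := ENNReal.div_pos hε.ne' (ENNReal.natCast_ne_top _)
  have hbv := tendsto_card_badVertices hp0 hp1 hW hsum hm hr hdev hδ0 hδ1
  have hedge : ∀ᶠ ξ in 𝓕, ∀ j ∈ S, treeLaw (L₀ ξ) (L₁ ξ) {t | ∃ l i, j = l :: i ∧ l < (t i).1 ∧
      (t i).2 ≠ (t j).2 ∧ ¬ ENNReal.ofReal (1 - δ) * (m ξ (t i).2 * q ξ (t j).2) ≤
        ENNReal.ofReal (p ξ (t i).2 (t j).2)} ≤ ε / (S.card + 1 : ℕ) := by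
    rw [Filter.eventually_all_finset]
    intro j _
    cases j with
    | nil => exact Eventually.of_forall fun ξ => by simp
    | cons l i =>
      filter_upwards [bad_edge_le h₀ h₁ hW hL₁ hoff hq hdev hδ0 hδ1 i l hpos] with ξ h
      refine (measure_mono ?_).trans h
      rintro t ⟨l', i', h1, h2⟩
      obtain ⟨rfl, rfl⟩ := List.cons.inj h1
      exact h2
  filter_upwards [not_injOn_le h₀ h₁ hW hN (k + 1) hε, h₀.label_mem_le hW hbv hpos,
    h₁.label_mem_le hW hbv hpos, hedge] with ξ g1 g2 g3 g4
  have := h₀.prob ξ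
  have := h₁.prob ξ
  let a := ENNReal.ofReal (1 - δ)
  have hsub : (goodTrees k a S (p ξ) (m ξ) (q ξ))ᶜ ⊆
      {t | ¬ nodes t (k + 1) ⊆ S} ∪ ({t | ¬ Set.InjOn (fun i => (t i).2) (nodes t (k + 1))} ∪
        ((⋃ i ∈ S, {t | t i ∈ {x : ℕ × Fin (N ξ) | x.2 ∈ badVertices a (p ξ) (m ξ)}}) ∪
          ⋃ j ∈ S, {t | ∃ l i, j = l :: i ∧ l < (t i).1 ∧
            (t i).2 ≠ (t j).2 ∧ ¬ a * (m ξ (t i).2 * q ξ (t j).2) ≤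
              ENNReal.ofReal (p ξ (t i).2 (t j).2)})) := by
    intro t ht
    by_contra hc
    simp only [Set.mem_union, Set.mem_ofPred_eq, not_or, not_not, Set.mem_iUnion,
      not_exists] at hc
    obtain ⟨hS, hinj, hv, he⟩ := hc
    refine ht ⟨hinj, hS, fun i hi => ⟨?_, fun j hj => ?_⟩⟩
    · have := hv i (hS (nodes_mono t (Nat.le_succ k) hi))
      simpa [badVertices] using this
    · by_contra hb
      have hjn := children_subset hi hj
      obtain ⟨l, hl, rfl⟩ := mem_children.1 hj
      refine he _ (hS hjn) l i ⟨rfl, hl, fun h => ?_, hb⟩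
      have := hinj (nodes_mono t (Nat.le_succ k) hi) hjn h
      simpa using congrArg List.length this
  have hcard : (S.card : ℝ≥0∞) * (ε / (S.card + 1 : ℕ)) ≤ ε := by
    calc (S.card : ℝ≥0∞) * (ε / (S.card + 1 : ℕ))
        ≤ ((S.card + 1 : ℕ) : ℝ≥0∞) * (ε / (S.card + 1 : ℕ)) := by gcongr; exact Nat.le_succ _
      _ ≤ ε := ENNReal.mul_div_le
  refine (measure_mono hsub).trans ((measure_union_le _ _).trans ?_)
  refine add_le_add le_rfl ((measure_union_le _ _).trans ?_)
  rw [show (3 : ℝ≥0∞) * ε = ε + (ε + ε) by ring]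
  refine add_le_add g1 ((measure_union_le _ _).trans (add_le_add ?_ ?_))
  · refine (measure_biUnion_finset_le _ _).trans (le_trans (Finset.sum_le_sum
      (g := fun _ => ε / (S.card + 1 : ℕ)) fun i _ => ?_) ?_)
    · rw [treeLaw_apply _ _ _ MeasurableSet.of_discrete]
      split_ifs
      · exact g2
      · exact g3
    · rwa [Finset.sum_const, nsmul_eq_mul]
  · refine (measure_biUnion_finset_le _ _).trans ((Finset.sum_le_sum g4).trans ?_)
    rwa [Finset.sum_const, nsmul_eq_mul]

end GoodVertices

/-! ### Construction of the tree on an extension of the probability space -/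

section Isomorphism

/-- The isomorphisms of a neighbourhood and a tree, as injections of vertices into labels. -/
theorem iso_treeGraph_iff {A : Type*} {n k : ℕ} {e : Fin n → Fin n → ℕ} {a : Fin n → A} {v : Fin n}
    {t : TreeData A} : (nbhd k e a v).Iso (treeGraph k t) ↔
      ∃ f : {i : Fin n // hopDist e v i ≤ k} → List ℕ, Function.Injective f ∧
        f ⟨v, by simp [hopDist]⟩ = [] ∧ (∀ u w : {i : Fin n // hopDist e v i ≤ k}, e u w =
          open Classical in if ∃ r : ℕ, f u = r :: f w ∨ f w = r :: f u then 1 else 0) ∧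
        (∀ u, IsNode t (f u) ∧ (f u).length ≤ k) ∧
        (∀ i : List ℕ, IsNode t i ∧ i.length ≤ k → ∃ u, f u = i) ∧
        ∀ u, nodeMark t (f u) = (degree e u, a u) := by
  constructor
  · rintro ⟨σ, h1, h2, h3⟩
    refine ⟨fun u => (σ u).1, Subtype.val_injective.comp σ.injective, congrArg Subtype.val h1,
      fun u w => (h3 u w).symm, fun u => (σ u).2, fun i hi => ⟨σ.symm ⟨i, hi⟩, by simp⟩, h2⟩
  · rintro ⟨f, h1, h2, h3, h4, h5, h6⟩
    let g : {i : Fin n // hopDist e v i ≤ k} → {i : List ℕ // IsNode t i ∧ i.length ≤ k} :=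
      fun u => ⟨f u, h4 u⟩
    have hg : Function.Bijective g :=
      ⟨fun u w h => h1 (congrArg Subtype.val h), fun ⟨i, hi⟩ =>
        (h5 i hi).imp fun u hu => Subtype.ext hu⟩
    exact ⟨Equiv.ofBijective g hg, Subtype.ext h2, h6, fun u w => (h3 u w).symm⟩

variable {Ω A : Type*} [MeasurableSpace Ω] [MeasurableSpace A] {n : ℕ}

theorem measurable_nodeMark (i : List ℕ) : Measurable fun t : TreeData A => nodeMark t i := by
  cases i with
  | nil => exact measurable_pi_apply []
  | cons r i => exact ((measurable_offspring (r :: i)).add_const 1).prodMk (measurable_label (r :: i))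

/-- There are countably many values of the graph and root, and for each of them countably many
candidate maps of the finite neighbourhood into labels. For a fixed map the conditions concern
countably many coordinates; only the comparison of attributes needs a measurable diagonal in `A`. -/
theorem measurableSet_notIso [MeasurableEq A] (k : ℕ) {e : Ω → Fin n → Fin n → ℕ}
    {a : Ω → Fin n → A} {I : Ω → Fin n} (he : Measurable e) (ha : Measurable a)
    (hI : Measurable I) : MeasurableSet (notIso k e a I) := by
  have hset : notIso k e a I = (⋃ p : (Fin n → Fin n → ℕ) × Fin n,
      {x : Ω × TreeData A | (e x.1, I x.1) = p} ∩
        {x | (nbhd k p.1 (a x.1) p.2).Iso (treeGraph k x.2)})ᶜ := by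
    ext x
    simp only [notIso, Set.mem_ofPred_eq, Set.mem_compl_iff, Set.mem_iUnion, Set.mem_inter_iff]
    constructor
    · rintro h ⟨p, rfl, hp⟩
      exact h hp
    · exact fun h hp => h ⟨_, rfl, hp⟩
  rw [hset]
  refine (MeasurableSet.iUnion fun p => ?_).compl
  have hev : Measurable fun x : Ω × TreeData A => (e x.1, I x.1) :=
    (he.comp measurable_fst).prodMk (hI.comp measurable_fst)
  refine (hev (measurableSet_singleton p)).inter ?_
  simp only [iso_treeGraph_iff]
  refine measurableSet_setOfPred.2 (Measurable.exists fun f => ?_)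
  have hnode : ∀ i : List ℕ, Measurable fun x : Ω × TreeData A => IsNode x.2 i :=
    fun i => measurableSet_setOfPred.1 (measurable_snd (measurableSet_isNode i))
  refine Measurable.and measurable_const (Measurable.and measurable_const
    (Measurable.and measurable_const (Measurable.and ?_ (Measurable.and ?_ ?_))))
  · exact Measurable.forall fun u => (hnode _).and measurable_const
  · exact Measurable.forall fun i => ((hnode i).and measurable_const).imp measurable_const
  · refine Measurable.forall fun u => ?_
    have hm : Measurable fun x : Ω × TreeData A => nodeMark x.2 (f u) :=
      (measurable_nodeMark (f u)).comp measurable_snd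
    simp only [Prod.ext_iff]
    exact (measurableSet_setOfPred.1 (measurableSet_eq_fun hm.fst measurable_const)).and
      (measurableSet_setOfPred.1 (measurableSet_eq_fun hm.snd
        ((measurable_pi_apply u.1).comp (ha.comp measurable_fst))))

end Isomorphism

/-! ### From conditional probabilities of points to the joint law. -/

section ConditionalLaw

variable {Ω B Y : Type*} [MeasurableSpace Ω] [MeasurableSpace B] [MeasurableSpace Y] [Countable Y]
  [DiscreteMeasurableSpace Y] {P : Measure Ω} [IsProbabilityMeasure P]

/-- As `Y` is countable, the identities for single points hold simultaneously almost surely, and so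
identify the regular conditional distribution. -/
theorem map_eq_compProd_of_condLaw {a : Ω → B} (ha : Measurable a) {Z : Ω → Y} (hZ : Measurable Z)
    {η : Kernel B Y} [IsMarkovKernel η]
    (h : ∀ y, P⟦Z ⁻¹' {y} | MeasurableSpace.comap a inferInstance⟧ =ᵐ[P]
      fun ω => (η (a ω) {y}).toReal) :
    P.map (fun ω => (a ω, Z ω)) = P.map a ⊗ₘ η := by
  have : Nonempty Y := by
    obtain ⟨ω⟩ : Nonempty Ω := nonempty_of_isProbabilityMeasure P
    exact ⟨Z ω⟩
  rw [← compProd_map_condDistrib hZ.aemeasurable]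
  refine Measure.compProd_congr ?_
  have hae : ∀ᵐ ω ∂P, condDistrib Z a P (a ω) = η (a ω) := by
    have : ∀ᵐ ω ∂P, ∀ y, (condDistrib Z a P (a ω)).real {y} = (η (a ω) {y}).toReal :=
      ae_all_iff.2 fun y =>
        (condDistrib_ae_eq_condExp ha hZ (measurableSet_singleton y)).trans (h y)
    filter_upwards [this] with ω hω
    refine Measure.ext_of_singleton fun y => ?_
    exact (ENNReal.toReal_eq_toReal_iff' (measure_ne_top _ _) (measure_ne_top _ _)).1 (hω y)
  refine (ae_map_iff ha.aemeasurable ?_).2 hae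
  have : {b | condDistrib Z a P b = η b} = ⋂ y, {b | condDistrib Z a P b {y} = η b {y}} := by
    ext b
    simp only [Set.mem_ofPred_eq, Set.mem_iInter]
    exact ⟨fun h y => by rw [h], fun h => Measure.ext_of_singleton h⟩
  rw [this]
  exact MeasurableSet.iInter fun y => measurableSet_eq_fun
    (Kernel.measurable_coe _ (measurableSet_singleton y))
    (Kernel.measurable_coe _ (measurableSet_singleton y))

end ConditionalLaw

/-! ### Averaging over the root vertex. -/

section Mixture

variable {A : Type*} [MeasurableSpace A] {n : ℕ}

theorem sum_inv_natCast (hn : n ≠ 0) : ∑ _v : Fin n, (n : ℝ≥0∞)⁻¹ = 1 := by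
  rw [Finset.sum_const, Finset.card_univ, Fintype.card_fin, nsmul_eq_mul,
    ENNReal.mul_inv_cancel (by exact_mod_cast hn) (ENNReal.natCast_ne_top n)]

theorem isProbabilityMeasure_mixture {E : Type*} [MeasurableSpace E] (hn : n ≠ 0)
    (μ : Fin n → Measure E) [∀ v, IsProbabilityMeasure (μ v)] :
    IsProbabilityMeasure (∑ v, (n : ℝ≥0∞)⁻¹ • μ v) := by
  constructor
  rw [Measure.finsetSum_apply, ← sum_inv_natCast hn]
  simp

/-- Only the factor of the root depends on `v`, and a product measure is linear in each factor. -/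
theorem sum_smul_treeLaw (hn : n ≠ 0) (root : Fin n → Measure (ℕ × A)) (node : Measure (ℕ × A))
    [∀ v, IsProbabilityMeasure (root v)] [IsProbabilityMeasure node] :
    ∑ v, (n : ℝ≥0∞)⁻¹ • treeLaw (root v) node = treeLaw (∑ v, (n : ℝ≥0∞)⁻¹ • root v) node := by
  have := isProbabilityMeasure_mixture hn root
  refine Measure.eq_infinitePi _ fun s B hB => ?_
  have hset : (Set.pi s B : Set (TreeData A)) = {t | ∀ i ∈ s, t i ∈ B i} := by
    ext; simp [Set.mem_pi]
  simp only [Measure.finsetSum_apply, Measure.smul_apply, smul_eq_mul, hset,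
    treeLaw_box _ _ s fun i _ => hB i]
  by_cases h : [] ∈ s
  · have hprod : ∀ root : Measure (ℕ × A), ∏ i ∈ s, (if i = [] then root else node) (B i) =
        root (B []) * ∏ i ∈ s.erase [], node (B i) := by
      intro root
      rw [← Finset.mul_prod_erase s _ h, if_pos rfl]
      congr 1
      exact Finset.prod_congr rfl fun i hi => by rw [if_neg (Finset.ne_of_mem_erase hi)]
    simp only [hprod, Measure.finsetSum_apply, Measure.smul_apply, smul_eq_mul, ← mul_assoc,
      Finset.sum_mul]
  · have hprod : ∀ root : Measure (ℕ × A), ∏ i ∈ s, (if i = [] then root else node) (B i) =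
        ∏ i ∈ s, node (B i) := fun root =>
      Finset.prod_congr rfl fun i hi => by rw [if_neg fun h' : i = [] => h (h' ▸ hi)]
    simp only [hprod, ← Finset.sum_mul, sum_inv_natCast hn, one_mul]

end Mixture

/-! ### Gluing the tree to the given probability space. -/

section Extension

variable {Ω A 𝒢 : Type*} [MeasurableSpace Ω] [MeasurableSpace A] [MeasurableSpace 𝒢]
  {n : ℕ}

/-- The law of a uniform vertex and an independent graph with law `Γ α`. -/
noncomputable def vertexGraphKernel (Γ : Kernel (Fin n → A) 𝒢) :
    Kernel (Fin n → A) (Fin n × 𝒢) where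
  toFun α := ∑ v, (n : ℝ≥0∞)⁻¹ • (Γ α).map (Prod.mk v)
  measurable' := by
    refine Measure.measurable_of_measurable_coe _ fun s hs => ?_
    simp only [Measure.finsetSum_apply, Measure.smul_apply, smul_eq_mul]
    exact Finset.measurable_sum _ fun v _ => ((Measure.measurable_coe hs).comp
      ((Measure.measurable_map _ measurable_prodMk_left).comp Γ.measurable)).const_mul _

theorem vertexGraphKernel_apply (Γ : Kernel (Fin n → A) 𝒢) (α : Fin n → A) :
    vertexGraphKernel Γ α = ∑ v, (n : ℝ≥0∞)⁻¹ • (Γ α).map (Prod.mk v) := rfl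

theorem vertexGraphKernel_singleton [MeasurableSingletonClass 𝒢] (Γ : Kernel (Fin n → A) 𝒢) (α : Fin n → A) (v : Fin n)
    (M : 𝒢) : vertexGraphKernel Γ α {(v, M)} = (n : ℝ≥0∞)⁻¹ * Γ α {M} := by
  classical
  simp only [vertexGraphKernel_apply, Measure.finsetSum_apply, Measure.smul_apply, smul_eq_mul]
  rw [Finset.sum_eq_single v, Measure.map_apply measurable_prodMk_left (measurableSet_singleton _)]
  · congr 2; ext; simp
  · intro w _ hw
    rw [Measure.map_apply measurable_prodMk_left (measurableSet_singleton _)]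
    have : Prod.mk w ⁻¹' {(v, M)} = ∅ := by ext; simp [hw]
    rw [this, measure_empty, mul_zero]
  · simp

theorem isMarkovKernel_vertexGraphKernel (hn : n ≠ 0) (Γ : Kernel (Fin n → A) 𝒢)
    [IsMarkovKernel Γ] : IsMarkovKernel (vertexGraphKernel Γ) := by
  refine ⟨fun α => ?_⟩
  have : ∀ v : Fin n, IsProbabilityMeasure ((Γ α).map (Prod.mk v)) := fun v =>
    Measure.isProbabilityMeasure_map measurable_prodMk_left.aemeasurable
  exact isProbabilityMeasure_mixture hn fun v => (Γ α).map (Prod.mk v)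

theorem measurable_relabel : Measurable fun x : (Fin n → A) × TreeData (Fin n) =>
    relabel x.1 x.2 := by
  refine measurable_pi_lambda _ fun i => ?_
  refine Measurable.prodMk ((measurable_offspring i).comp measurable_snd) ?_
  have h : Measurable fun z : (Fin n → A) × Fin n => z.1 z.2 :=
    measurable_from_prod_countable_left fun v => measurable_pi_apply v
  exact h.comp (measurable_fst.prodMk ((measurable_label i).comp measurable_snd))

variable [Countable 𝒢] [DiscreteMeasurableSpace 𝒢]

theorem measurableSet_matches_prod (e : 𝒢 → Fin n → Fin n → ℕ) (k : ℕ) :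
    MeasurableSet {z : Fin n × (𝒢 × TreeData (Fin n)) | Matches k (e z.2.1) z.1 z.2.2} := by
  have hset : {z : Fin n × (𝒢 × TreeData (Fin n)) | Matches k (e z.2.1) z.1 z.2.2} =
      ⋃ p : Fin n × 𝒢, {z | (z.1, z.2.1) = p} ∩ {z | Matches k (e p.2) p.1 z.2.2} := by
    ext z
    simp only [Set.mem_ofPred_eq, Set.mem_iUnion, Set.mem_inter_iff]
    constructor
    · exact fun h => ⟨_, rfl, h⟩
    · rintro ⟨p, rfl, hp⟩
      exact hp
  rw [hset]
  refine MeasurableSet.iUnion fun p => MeasurableSet.inter ?_ ?_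
  · exact (measurable_fst.prodMk measurable_snd.fst) (measurableSet_singleton p)
  · exact measurable_snd.snd (measurableSet_matches k (e p.2) p.1)

theorem measure_not_matches_le {μ : Measure (𝒢 × TreeData (Fin n))} [IsProbabilityMeasure μ]
    {ν : Measure (TreeData (Fin n))} [IsProbabilityMeasure ν] (e : 𝒢 → Fin n → Fin n → ℕ) (k : ℕ)
    (v : Fin n) {s : Set (TreeData (Fin n))} (hs : MeasurableSet s)
    (h : ν s ≤ μ {y | Matches k (e y.1) v y.2}) :
    μ {y | ¬ Matches k (e y.1) v y.2} ≤ ν sᶜ := by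
  have hm : MeasurableSet {y : 𝒢 × TreeData (Fin n) | Matches k (e y.1) v y.2} :=
    measurable_prodMk_left (measurableSet_matches_prod e k)
  rw [prob_compl_eq_one_sub hs]
  exact (prob_compl_eq_one_sub hm).le.trans (tsub_le_tsub_left h 1)

variable {P : Measure Ω} [IsProbabilityMeasure P] {a : Ω → Fin n → A} {G : Ω → 𝒢} {I : Ω → Fin n}
  {Γ : Kernel (Fin n → A) 𝒢} [IsMarkovKernel Γ]
  {π : Kernel ((Fin n → A) × Fin n) (𝒢 × TreeData (Fin n))} [IsMarkovKernel π]

/-- Given the attributes, the graph and the root vertex, draw a labelled tree from the conditional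
law of the tree given the graph. -/
noncomputable def treeKernel [Nonempty (Fin n)]
    (π : Kernel ((Fin n → A) × Fin n) (𝒢 × TreeData (Fin n)))
    [IsMarkovKernel π] (ha : Measurable a) (hG : Measurable G) (hI : Measurable I) :
    Kernel Ω (TreeData (Fin n)) :=
  π.condKernel.comap (fun ω => ((a ω, I ω), G ω)) ((ha.prodMk hI).prodMk hG)

instance [Nonempty (Fin n)] (ha : Measurable a) (hG : Measurable G) (hI : Measurable I) :
    IsMarkovKernel (treeKernel π ha hG hI) := by
  unfold treeKernel; infer_instance

/-- Given the attributes, the root is uniform and the graph has law `Γ`, the first marginal of `π`.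
Drawing the tree from the conditional kernel of `π` therefore restores `π`, and the integral becomes
an average over roots. -/
theorem lintegral_treeKernel [Nonempty (Fin n)] (hn : n ≠ 0) (ha : Measurable a)
    (hG : Measurable G) (hI : Measurable I)
    (hlaw : ∀ v M, P⟦{ω | I ω = v ∧ G ω = M} | attrSigma a⟧ =ᵐ[P]
      fun ω => (n : ℝ)⁻¹ * (Γ (a ω) {M}).toReal)
    (hfst : ∀ x, (π x).map Prod.fst = Γ x.1)
    {H : ((Fin n → A) × Fin n) × (𝒢 × TreeData (Fin n)) → ℝ≥0∞} (hH : Measurable H) :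
    ∫⁻ x, H ((a x.1, I x.1), (G x.1, x.2)) ∂(P ⊗ₘ treeKernel π ha hG hI) =
      ∫⁻ ω, ∑ v, (n : ℝ≥0∞)⁻¹ * ∫⁻ y, H ((a ω, v), y) ∂(π (a ω, v)) ∂P := by
  have := isMarkovKernel_vertexGraphKernel hn Γ
  let F : (Fin n → A) × (Fin n × 𝒢) → ℝ≥0∞ := fun x =>
    ∫⁻ τ, H ((x.1, x.2.1), (x.2.2, τ)) ∂(π.condKernel ((x.1, x.2.1), x.2.2))
  have hF : Measurable F := by
    have h1 : Measurable fun z : ((Fin n → A) × Fin n) × 𝒢 =>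
        ∫⁻ τ, H (z.1, (z.2, τ)) ∂(π.condKernel z) := by
      refine Measurable.lintegral_kernel_prod_right (κ := π.condKernel) ?_
      exact hH.comp (by fun_prop)
    exact h1.comp (g := fun z : ((Fin n → A) × Fin n) × 𝒢 =>
        ∫⁻ τ, H (z.1, (z.2, τ)) ∂(π.condKernel z))
      (f := fun x : (Fin n → A) × (Fin n × 𝒢) => ((x.1, x.2.1), x.2.2)) (by fun_prop)
  have hmap := map_eq_compProd_of_condLaw (P := P) ha (hI.prodMk hG) (η := vertexGraphKernel Γ)
    (by
      rintro ⟨v, M⟩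
      have hset : (fun ω => (I ω, G ω)) ⁻¹' {(v, M)} = {ω | I ω = v ∧ G ω = M} := by
        ext; simp
      rw [hset]
      refine (hlaw v M).trans (Eventually.of_forall fun ω => ?_)
      simp only [vertexGraphKernel_singleton, ENNReal.toReal_mul, ENNReal.toReal_inv,
        ENNReal.toReal_natCast])
  have hHm : Measurable fun x : Ω × TreeData (Fin n) => H ((a x.1, I x.1), (G x.1, x.2)) :=
    hH.comp (by fun_prop)
  rw [Measure.lintegral_compProd hHm]
  calc ∫⁻ ω, ∫⁻ τ, H ((a ω, I ω), (G ω, τ)) ∂(treeKernel π ha hG hI ω) ∂P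
      = ∫⁻ ω, F (a ω, (I ω, G ω)) ∂P := rfl
    _ = ∫⁻ x, F x ∂(P.map a ⊗ₘ vertexGraphKernel Γ) := by
        rw [← hmap, lintegral_map hF (ha.prodMk (hI.prodMk hG))]
    _ = ∫⁻ ω, ∫⁻ y, F (a ω, y) ∂(vertexGraphKernel Γ (a ω)) ∂P := by
        rw [Measure.lintegral_compProd hF, lintegral_map _ ha]
        exact hF.lintegral_kernel_prod_right'
    _ = _ := by
        refine lintegral_congr fun ω => ?_
        rw [vertexGraphKernel_apply, lintegral_finsetSum_measure]
        refine Finset.sum_congr rfl fun v _ => ?_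
        rw [lintegral_smul_measure, smul_eq_mul, lintegral_map (by fun_prop) measurable_prodMk_left]
        congr 1
        have hd : ∫⁻ y, H ((a ω, v), y) ∂(π (a ω, v)) =
            ∫⁻ y, H ((a ω, v), y) ∂((π.fst ⊗ₖ π.condKernel) (a ω, v)) := by
          rw [Kernel.disintegrate]
        rw [hd, Kernel.lintegral_compProd _ _ _ (by fun_prop), Kernel.fst_apply, hfst]

/-- The labelled tree is drawn given attributes, graph and root, and then relabelled by the
attributes. Given only the attributes, its law is an average over the root of tree laws, which is
again a product by `sum_smul_treeLaw`. Non-isomorphism implies that the matching failed, also at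
every smaller depth. -/
theorem exists_isTreeCoupling [MeasurableEq A] (hn : n ≠ 0) (ha : Measurable a) (hG : Measurable G)
    (hI : Measurable I)
    (hlaw : ∀ v M, P⟦{ω | I ω = v ∧ G ω = M} | attrSigma a⟧ =ᵐ[P]
      fun ω => (n : ℝ)⁻¹ * (Γ (a ω) {M}).toReal)
    (hfst : ∀ x, (π x).map Prod.fst = Γ x.1)
    {root : (Fin n → A) → Fin n → Measure (ℕ × Fin n)} {node : (Fin n → A) → Measure (ℕ × Fin n)}
    [∀ α v, IsProbabilityMeasure (root α v)] [∀ α, IsProbabilityMeasure (node α)]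
    (hrootv : ∀ α v, root α v {x | x.2 ≠ v} = 0)
    (hsnd : ∀ x, (π x).map Prod.snd = treeLaw (root x.1 x.2) (node x.1))
    {rootLaw nodeLaw : Ω → Measure (ℕ × A)}
    (hrootLaw : ∀ ω, rootLaw ω =
      (∑ v, (n : ℝ≥0∞)⁻¹ • root (a ω) v).map fun x => (x.1, a ω x.2))
    (hnodeLaw : ∀ ω, nodeLaw ω = (node (a ω)).map fun x => (x.1, a ω x.2))
    (e : 𝒢 → Fin n → Fin n → ℕ) (k : ℕ) :
    ∃ Q : Measure (Ω × TreeData A), IsTreeCoupling P a I rootLaw nodeLaw Q ∧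
      ∀ j ≤ k, Q (notIso j (fun ω => e (G ω)) a I) ≤
        ∫⁻ ω, ∑ v, (n : ℝ≥0∞)⁻¹ * π (a ω, v) {y | ¬ Matches k (e y.1) v y.2} ∂P := by
  have : Nonempty (Fin n) := ⟨⟨0, Nat.pos_of_ne_zero hn⟩⟩
  have he : Measurable e := Measurable.of_discrete
  let R : Measure (Ω × TreeData (Fin n)) := P ⊗ₘ treeKernel π ha hG hI
  let f : Ω × TreeData (Fin n) → Ω × TreeData A := fun x => (x.1, relabel (a x.1) x.2)
  have hf : Measurable f := measurable_fst.prodMk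
    (measurable_relabel.comp ((ha.comp measurable_fst).prodMk measurable_snd))
  have hR : ∀ s : Set (((Fin n → A) × Fin n) × (𝒢 × TreeData (Fin n))), MeasurableSet s →
      R {x | ((a x.1, I x.1), (G x.1, x.2)) ∈ s} =
        ∫⁻ ω, ∑ v, (n : ℝ≥0∞)⁻¹ * π (a ω, v) {y | ((a ω, v), y) ∈ s} ∂P := by
    intro s hs
    have h := lintegral_treeKernel (π := π) hn ha hG hI hlaw hfst
      (H := s.indicator 1) (measurable_one.indicator hs)
    have hm : Measurable fun x : Ω × TreeData (Fin n) => ((a x.1, I x.1), (G x.1, x.2)) := by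
      fun_prop
    have h1 : ∀ x : Ω × TreeData (Fin n),
        s.indicator (1 : ((Fin n → A) × Fin n) × (𝒢 × TreeData (Fin n)) → ℝ≥0∞) ((a x.1, I x.1), (G x.1, x.2)) =
          ({x | ((a x.1, I x.1), (G x.1, x.2)) ∈ s} : Set (Ω × TreeData (Fin n))).indicator 1 x :=
      fun _ => rfl
    have h2 : ∀ ω v (y : 𝒢 × TreeData (Fin n)), s.indicator (1 : ((Fin n → A) × Fin n) × (𝒢 × TreeData (Fin n)) → ℝ≥0∞) ((a ω, v), y) =
        ({y | ((a ω, v), y) ∈ s} : Set (𝒢 × TreeData (Fin n))).indicator 1 y := fun _ _ _ => rfl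
    simp only [h1, h2] at h
    have hms : MeasurableSet {x : Ω × TreeData (Fin n) |
      ((a x.1, I x.1), (G x.1, x.2)) ∈ s} := hm hs
    have hms' : ∀ ω v, MeasurableSet {y : 𝒢 × TreeData (Fin n) | ((a ω, v), y) ∈ s} :=
      fun ω v => measurable_prodMk_left hs
    rw [lintegral_indicator_one hms] at h
    refine h.trans (lintegral_congr fun ω => Finset.sum_congr rfl fun v _ => ?_)
    rw [lintegral_indicator_one (hms' ω v)]
  have htree : ∀ (α : Fin n → A) (s : Finset (List ℕ)) (B : List ℕ → Set (ℕ × A)),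
      (∀ i ∈ s, MeasurableSet (B i)) →
      ∑ v, (n : ℝ≥0∞)⁻¹ * π (α, v) {y | ∀ i ∈ s, relabel α y.2 i ∈ B i} =
        ∏ i ∈ s, (if i = [] then (∑ v, (n : ℝ≥0∞)⁻¹ • root α v).map fun x => (x.1, α x.2)
          else (node α).map fun x => (x.1, α x.2)) (B i) := by
    intro α s B hB
    have := isProbabilityMeasure_mixture hn (root α)
    have hg : Measurable fun x : ℕ × Fin n => (x.1, α x.2) := Measurable.of_discrete
    have h1 : ∀ v, π (α, v) {y | ∀ i ∈ s, relabel α y.2 i ∈ B i} =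
        treeLaw (root α v) (node α) {t | ∀ i ∈ s, t i ∈ (fun x => (x.1, α x.2)) ⁻¹' B i} := by
      intro v
      have hms : MeasurableSet
          {t : TreeData (Fin n) | ∀ i ∈ s, t i ∈ (fun x : ℕ × Fin n => (x.1, α x.2)) ⁻¹' B i} := by
        have : {t : TreeData (Fin n) | ∀ i ∈ s, t i ∈ (fun x : ℕ × Fin n => (x.1, α x.2)) ⁻¹' B i} =
            ⋂ i ∈ s, {t | t i ∈ (fun x : ℕ × Fin n => (x.1, α x.2)) ⁻¹' B i} := by
          ext; simp
        rw [this]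
        exact Finset.measurableSet_biInter _ fun i hi => measurable_pi_apply i (hg (hB i hi))
      rw [← hsnd (α, v), Measure.map_apply measurable_snd hms]
      rfl
    simp only [h1, ← smul_eq_mul]
    have h2 := sum_smul_treeLaw hn (root α) (node α)
    have h3 := congrArg (fun μ => μ {t : TreeData (Fin n) |
      ∀ i ∈ s, t i ∈ (fun x : ℕ × Fin n => (x.1, α x.2)) ⁻¹' B i}) h2
    simp only [Measure.finsetSum_apply, Measure.smul_apply] at h3
    rw [h3, treeLaw_box _ _ s fun i hi => hg (hB i hi)]
    refine Finset.prod_congr rfl fun i hi => ?_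
    split_ifs
    · rw [Measure.map_apply hg (hB i hi)]
    · rw [Measure.map_apply hg (hB i hi)]
  have hRP : R.map Prod.fst = P := Measure.fst_compProd _ _
  have hQP : (R.map f).map Prod.fst = P := by
    rw [Measure.map_map measurable_fst hf]
    exact hRP
  have : IsProbabilityMeasure (R.map f) := Measure.isProbabilityMeasure_map hf.aemeasurable
  refine ⟨R.map f, ⟨hQP, ?_, ?_⟩, ?_⟩
  · intro s B hB
    let S : Set (Ω × TreeData A) := {x | ∀ i ∈ s, x.2 i ∈ B i}
    let D : Set (((Fin n → A) × Fin n) × (𝒢 × TreeData (Fin n))) :=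
      {z | ∀ i ∈ s, relabel z.1.1 z.2.2 i ∈ B i}
    have hS : MeasurableSet S := by
      have : S = ⋂ i ∈ s, {x | x.2 i ∈ B i} := by ext; simp [S]
      rw [this]
      exact Finset.measurableSet_biInter _ fun i hi =>
        ((measurable_pi_apply i).comp measurable_snd) (hB i hi)
    have hD : MeasurableSet D := by
      have : D = ⋂ i ∈ s, {z | relabel z.1.1 z.2.2 i ∈ B i} := by ext; simp [D]
      rw [this]
      exact Finset.measurableSet_biInter _ fun i hi => ((measurable_pi_apply i).comp
        (measurable_relabel.comp (measurable_fst.fst.prodMk measurable_snd.snd))) (hB i hi)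
    let g : (Fin n → A) → ℝ≥0∞ := fun α =>
      ∑ v, (n : ℝ≥0∞)⁻¹ * π (α, v) {y | ∀ i ∈ s, relabel α y.2 i ∈ B i}
    have hg : Measurable g := Finset.measurable_sum _ fun v _ =>
      ((Kernel.measurable_kernel_prodMk_left hD).comp measurable_prodMk_right).const_mul _
    have hg1 : ∀ α, g α ≤ 1 := fun α => by
      rw [← sum_inv_natCast hn]
      exact Finset.sum_le_sum fun v _ => mul_le_of_le_one_right' prob_le_one
    have hg2 : (fun x : Ω × TreeData A =>
        ∏ i ∈ s, ((if i = [] then rootLaw x.1 else nodeLaw x.1) (B i)).toReal) =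
        fun x => (g (a x.1)).toReal := by
      ext x
      simp only [g, htree (a x.1) s B hB, ENNReal.toReal_prod, hrootLaw, hnodeLaw]
    have hax : Measurable fun x : Ω × TreeData A => a x.1 := ha.comp measurable_fst
    have hga : Measurable fun x : Ω × TreeData A => g (a x.1) := hg.comp hax
    rw [hg2]
    -- The conditional probability is identified by its integrals over the sets `a ⁻¹' E`, which are
    -- computed from `hR`.
    refine (ae_eq_condExp_of_forall_setIntegral_eq hax.comap_le
      ((integrable_const _).indicator hS) (fun t _ _ => ?_) ?_ ?_).symm
    · refine Integrable.integrableOn (Integrable.of_bound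
        (hg.comp hax).ennreal_toReal.aestronglyMeasurable 1 (Eventually.of_forall fun x => ?_))
      rw [Real.norm_of_nonneg ENNReal.toReal_nonneg]
      exact ENNReal.toReal_le_of_le_ofReal zero_le_one (by simpa using hg1 _)
    · rintro _ ⟨E, hE, rfl⟩ -
      rw [setIntegral_indicator hS, setIntegral_const, smul_eq_mul, mul_one,
        integral_toReal hga.aemeasurable
          (Eventually.of_forall fun x => (hg1 _).trans_lt ENNReal.one_lt_top), Measure.real]
      congr 1
      have hE1 : MeasurableSet ((fun x : Ω × TreeData A => a x.1) ⁻¹' E) := hax hE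
      have h1 : ∫⁻ x in (fun x : Ω × TreeData A => a x.1) ⁻¹' E, g (a x.1) ∂(R.map f) =
          ∫⁻ ω in a ⁻¹' E, g (a ω) ∂P := by
        conv_rhs => rw [← hQP]
        exact (setLIntegral_map (f := fun ω => g (a ω)) (ha hE) (hg.comp ha)
          measurable_fst).symm
      refine h1.trans ?_
      rw [Measure.map_apply hf (hE1.inter hS)]
      have h2 := hR (D ∩ {z | z.1.1 ∈ E}) (hD.inter (measurable_fst.fst hE))
      have h3 : f ⁻¹' ((fun x : Ω × TreeData A => a x.1) ⁻¹' E ∩ S) =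
          {x | ((a x.1, I x.1), (G x.1, x.2)) ∈ D ∩ {z | z.1.1 ∈ E}} :=
        Set.inter_comm _ _
      rw [h3, h2, ← lintegral_indicator (ha hE)]
      refine lintegral_congr fun ω => ?_
      by_cases hω : a ω ∈ E
      · rw [Set.indicator_of_mem (by exact hω)]
        refine Finset.sum_congr rfl fun v _ => ?_
        congr 2
        ext y
        exact (and_iff_left hω).symm
      · rw [Set.indicator_of_notMem (by exact hω)]
        refine (Finset.sum_eq_zero fun v _ => ?_).symm
        have : {y : 𝒢 × TreeData (Fin n) | ((a ω, v), y) ∈ D ∩ {z | z.1.1 ∈ E}} = ∅ :=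
          Set.eq_empty_of_forall_notMem fun y hy => hω hy.2
        rw [this, measure_empty, mul_zero]
    · exact (hg.ennreal_toReal.comp (comap_measurable _)).stronglyMeasurable.aestronglyMeasurable
  · have hm : MeasurableSet {x : Ω × TreeData A | (x.2 []).2 = a x.1 (I x.1)} := by
      refine measurableSet_eq_fun ((measurable_label []).comp measurable_snd) ?_
      have h : Measurable fun z : (Fin n → A) × Fin n => z.1 z.2 :=
        measurable_from_prod_countable_left fun v => measurable_pi_apply v
      exact h.comp ((ha.comp measurable_fst).prodMk (hI.comp measurable_fst))
    refine (ae_map_iff hf.aemeasurable hm).2 ?_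
    -- The root label has law concentrated at the given root vertex, so before relabelling it is `I`
    -- itself.
    have hz : R {x | (x.2 []).2 ≠ I x.1} = 0 := by
      refine (hR {z | (z.2.2 []).2 ≠ z.1.2} (measurableSet_eq_fun ((measurable_label []).comp
        measurable_snd.snd) measurable_fst.snd).compl).trans ?_
      refine (lintegral_congr fun ω => ?_).trans lintegral_zero
      refine Finset.sum_eq_zero fun v _ => ?_
      have h1 : π (a ω, v) {y | (y.2 []).2 ≠ v} = 0 := by
        have h2 := treeLaw_apply (root (a ω) v) (node (a ω)) [] (B := {x | x.2 ≠ v})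
          MeasurableSet.of_discrete
        rw [if_pos rfl, hrootv, ← hsnd (a ω, v)] at h2
        exact (Measure.map_apply measurable_snd
          ((measurable_pi_apply []) MeasurableSet.of_discrete)).symm.trans h2
      exact (congrArg _ h1).trans (mul_zero _)
    filter_upwards [measure_eq_zero_iff_ae_notMem.1 hz] with x hx
    have hx' : (x.2 []).2 = I x.1 := not_not.1 hx
    exact congrArg (a x.1) hx'
  · intro j hj
    have hnot : MeasurableSet (notIso j (fun ω => e (G ω)) a I) :=
      measurableSet_notIso j (he.comp hG) ha hI
    have hmatch : MeasurableSet {z : ((Fin n → A) × Fin n) × (𝒢 × TreeData (Fin n)) |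
        ¬ Matches k (e z.2.1) z.1.2 z.2.2} :=
      ((measurable_fst.snd.prodMk measurable_snd) (measurableSet_matches_prod e k)).compl
    refine le_trans ?_ (hR _ hmatch).le
    rw [Measure.map_apply hf hnot]
    exact measure_mono fun x hx hM => hx ((Matches.mono hM hj).iso (a x.1))

end Extension

/-! ### Events with high probability -/

section HighProbability

variable {Ω : ℕ+ → Type*} [∀ n, MeasurableSpace (Ω n)] (P : ∀ n, Measure (Ω n))

/-- The filter of the events whose probability tends to one. -/
def highProb : Filter (Σ n, Ω n) where
  sets := {E | Tendsto (fun n => P n {ω | (⟨n, ω⟩ : Σ n, Ω n) ∉ E}) atTop (𝓝 0)}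
  univ_sets := by simp
  sets_of_superset {E F} hE hEF := by
    refine tendsto_of_tendsto_of_tendsto_of_le_of_le tendsto_const_nhds hE (fun _ => zero_le) ?_
    exact fun n => measure_mono fun ω hω h => hω (hEF h)
  inter_sets {E F} hE hF := by
    have h := Tendsto.add hE hF
    rw [add_zero] at h
    refine tendsto_of_tendsto_of_tendsto_of_le_of_le tendsto_const_nhds h (fun _ => zero_le) ?_
    refine fun n => le_trans (measure_mono ?_) (measure_union_le _ _)
    intro ω hω
    by_cases hE : (⟨n, ω⟩ : Σ n, Ω n) ∈ E
    · exact Or.inr fun hF => hω ⟨hE, hF⟩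
    · exact Or.inl hE

variable {P}

theorem eventually_highProb {p : (Σ n, Ω n) → Prop} :
    (∀ᶠ ξ in highProb P, p ξ) ↔ Tendsto (fun n => P n {ω | ¬ p ⟨n, ω⟩}) atTop (𝓝 0) := Iff.rfl

/-- Convergence in probability becomes ordinary convergence along `highProb P`, so several such
hypotheses can be combined as eventual properties. -/
theorem TendstoInProb.tendsto {E : Type*} {X : ∀ n, Ω n → E} {l : Filter E}
    (h : TendstoInProb P X l) : Tendsto (fun ξ : Σ n, Ω n => X ξ.1 ξ.2) (highProb P) l :=
  fun U hU => h U hU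

theorem eventually_highProb_of_ae {p : (Σ n, Ω n) → Prop} (h : ∀ n, ∀ᵐ ω ∂P n, p ⟨n, ω⟩) :
    ∀ᶠ ξ in highProb P, p ξ := by
  refine eventually_highProb.2 (tendsto_const_nhds.congr fun n => ?_)
  exact (ae_iff.1 (h n)).symm

theorem tendsto_size_highProb :
    Tendsto (fun ξ : Σ n, Ω n => (ξ.1 : ℕ)) (highProb P) atTop := by
  refine tendsto_atTop.2 fun m => eventually_highProb.2 ?_
  refine tendsto_const_nhds.congr' ?_
  filter_upwards [eventually_ge_atTop m.succPNat] with n hn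
  have : m ≤ (n : ℕ) := (Nat.le_succ m).trans (by exact_mod_cast hn)
  simp [this]

theorem tendsto_lintegral_of_highProb [∀ n, IsProbabilityMeasure (P n)] {f : (Σ n, Ω n) → ℝ≥0∞}
    (hf1 : ∀ ξ, f ξ ≤ 1) (hf : ∀ ε : ℝ≥0∞, 0 < ε → ∀ᶠ ξ in highProb P, f ξ ≤ ε) :
    Tendsto (fun n => ∫⁻ ω, f ⟨n, ω⟩ ∂P n) atTop (𝓝 0) := by
  classical
  refine ENNReal.tendsto_nhds_zero.2 fun ε hε => ?_
  have h := eventually_highProb.1 (hf _ (ENNReal.half_pos hε.ne'))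
  filter_upwards [h.eventually (ge_mem_nhds (ENNReal.half_pos hε.ne'))] with n hn
  calc ∫⁻ ω, f ⟨n, ω⟩ ∂P n
      ≤ ∫⁻ ω, (ε / 2 + {ω | ¬ f ⟨n, ω⟩ ≤ ε / 2}.indicator (fun _ => 1) ω) ∂P n := by
        refine lintegral_mono fun ω => ?_
        by_cases hω : f ⟨n, ω⟩ ≤ ε / 2
        · exact hω.trans le_self_add
        · rw [Set.indicator_of_mem (by exact hω)]
          exact (hf1 _).trans le_add_self
    _ ≤ ε / 2 + ε / 2 := by
        rw [lintegral_add_left measurable_const]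
        refine add_le_add (by simp) ((lintegral_indicator_const_le _ _).trans ?_)
        rwa [one_mul]
    _ = ε := ENNReal.add_halves ε

end HighProbability

/-! ### One coupling for all depths. -/

section Diagonal

/-- Take for `κ n` the largest `k ≤ n` whose threshold, beyond which `δ k` is at most `1 / (k + 1)`,
has been passed. -/
theorem exists_diagonal {δ : ℕ → ℕ+ → ℝ≥0∞} (hδ : ∀ k, Tendsto (δ k) atTop (𝓝 0)) :
    ∃ κ : ℕ+ → ℕ, Tendsto κ atTop atTop ∧ Tendsto (fun n => δ (κ n) n) atTop (𝓝 0) := by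
  have hN : ∀ k : ℕ, ∃ N : ℕ+, ∀ n ≥ N, δ k n ≤ ((k : ℝ≥0∞) + 1)⁻¹ := fun k =>
    eventually_atTop.1 ((hδ k).eventually (ge_mem_nhds (by simp)))
  choose N hN using hN
  classical
  let κ : ℕ+ → ℕ := fun n => Nat.findGreatest (fun k => N k ≤ n) n
  have hκ : Tendsto κ atTop atTop := by
    refine tendsto_atTop.2 fun k => ?_
    filter_upwards [eventually_ge_atTop (N k), eventually_ge_atTop k.succPNat] with n h1 h2
    exact Nat.le_findGreatest ((Nat.le_succ k).trans (by exact_mod_cast h2)) h1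
  refine ⟨κ, hκ, ?_⟩
  have hlim : Tendsto (fun n => ((κ n : ℝ≥0∞) + 1)⁻¹) atTop (𝓝 0) := by
    have h1 : Tendsto (fun m : ℕ => ((m : ℝ≥0∞))⁻¹) atTop (𝓝 0) :=
      ENNReal.tendsto_inv_nat_nhds_zero
    have := (h1.comp (tendsto_add_atTop_nat 1)).comp hκ
    refine this.congr fun n => ?_
    simp
  refine tendsto_of_tendsto_of_tendsto_of_le_of_le' tendsto_const_nhds hlim
    (Eventually.of_forall fun _ => zero_le) ?_
  filter_upwards [eventually_ge_atTop (N 0)] with n hn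
  exact hN _ n (Nat.findGreatest_spec (P := fun k => N k ≤ n) (Nat.zero_le _) hn)

/-- Markov's inequality for the conditional probability, whose mean is the probability of `s`. -/
theorem measure_condExp_le {X : Type*} {m m₀ : MeasurableSpace X} {Q : Measure X}
    [IsProbabilityMeasure Q] (hm : m ≤ m₀) {s : Set X} (hs : MeasurableSet s)
    {ε : ℝ} (hε : 0 < ε) :
    Q {x | (Q⟦s | m⟧) x ∉ Metric.ball (0 : ℝ) ε} ≤ Q s / ENNReal.ofReal ε := by
  have h0 : 0 ≤ᵐ[Q] Q⟦s | m⟧ := condExp_nonneg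
    (Eventually.of_forall fun x => Set.indicator_nonneg (fun _ _ => zero_le_one) x)
  have hint : ∫ x, (Q⟦s | m⟧) x ∂Q = Q.real s := by
    rw [integral_condExp hm, integral_indicator hs, setIntegral_const, smul_eq_mul, mul_one]
  have hmark := mul_meas_ge_le_integral_of_nonneg h0 integrable_condExp ε
  rw [hint] at hmark
  have hle : Q {x | (Q⟦s | m⟧) x ∉ Metric.ball (0 : ℝ) ε} ≤ Q {x | ε ≤ (Q⟦s | m⟧) x} := by
    refine measure_mono_ae ?_
    filter_upwards [h0] with x hx hx'
    have hx'' : ¬ |(Q⟦s | m⟧) x| < ε := by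
      intro h
      exact hx' (by rw [Metric.mem_ball, dist_zero_right, Real.norm_eq_abs]; exact h)
    rwa [abs_of_nonneg hx, not_lt] at hx''
  refine hle.trans ?_
  rw [ENNReal.le_div_iff_mul_le (Or.inl (ENNReal.ofReal_pos.2 hε).ne') (Or.inl ENNReal.ofReal_ne_top),
    mul_comm, ← ENNReal.toReal_le_toReal (by finiteness) (measure_ne_top _ _),
    ENNReal.toReal_mul, ENNReal.toReal_ofReal hε.le]
  exact hmark

/-- Each depth comes with its own coupling, but the extension may not depend on the depth. Using
depth `κ n` at stage `n`, with `κ` tending to infinity slowly enough, covers every fixed depth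
eventually. -/
theorem existsTreeCoupling_of_tendsto {Ω : ℕ+ → Type*} {A : Type*} [∀ n, MeasurableSpace (Ω n)]
    [MeasurableSpace A] {P : ∀ n, Measure (Ω n)} [∀ n, IsProbabilityMeasure (P n)]
    {a : ∀ n, Ω n → Fin (n : ℕ) → A} {e : ∀ n, Ω n → Fin (n : ℕ) → Fin (n : ℕ) → ℕ}
    {I : ∀ n, Ω n → Fin (n : ℕ)} {rootLaw nodeLaw : ∀ n, Ω n → Measure (ℕ × A)}
    (ha : ∀ n, Measurable (a n))
    (hmeas : ∀ k n, MeasurableSet (notIso k (e n) (a n) (I n)))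
    {δ : ℕ → ℕ+ → ℝ≥0∞} (hδ : ∀ k, Tendsto (δ k) atTop (𝓝 0))
    (hQ : ∀ k n, ∃ Q : Measure (Ω n × TreeData A),
      IsTreeCoupling (P n) (a n) (I n) (rootLaw n) (nodeLaw n) Q ∧
      ∀ j ≤ k, Q (notIso j (e n) (a n) (I n)) ≤ δ k n) :
    ExistsTreeCoupling P a e I rootLaw nodeLaw := by
  obtain ⟨κ, hκ, hκδ⟩ := exists_diagonal hδ
  choose Q hQ1 hQ2 using hQ
  refine ⟨fun n => Q (κ n) n, fun n => hQ1 _ _, fun k _ => ⟨hmeas k, fun U hU => ?_⟩⟩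
  have hprob : ∀ n, IsProbabilityMeasure (Q (κ n) n) := fun n => by
    have h : (Q (κ n) n).map Prod.fst Set.univ = 1 := by
      rw [(hQ1 (κ n) n).extends_P, measure_univ]
    rw [Measure.map_apply measurable_fst MeasurableSet.univ] at h
    exact ⟨h⟩
  obtain ⟨ε, hε, hεU⟩ := Metric.mem_nhds_iff.1 hU
  have hlim : Tendsto (fun n => δ (κ n) n / ENNReal.ofReal ε) atTop (𝓝 0) := by
    have := ENNReal.Tendsto.div_const hκδ (b := ENNReal.ofReal ε)
      (Or.inr (ENNReal.ofReal_pos.2 hε).ne')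
    simpa using this
  refine tendsto_of_tendsto_of_tendsto_of_le_of_le' tendsto_const_nhds hlim
    (Eventually.of_forall fun _ => zero_le) ?_
  filter_upwards [hκ.eventually_ge_atTop k] with n hn
  have := hprob n
  refine (measure_mono fun x (hx : _ ∉ U) h => hx (hεU h)).trans
    ((measure_condExp_le ((ha n).comp measurable_fst).comap_le (hmeas k n) hε).trans ?_)
  exact ENNReal.div_le_div_right (hQ2 (κ n) n k hn) _

end Diagonal

/-! ### Consequences of the convergence in the Wasserstein distance -/

theorem lintegral_empirical {R S : Type*} [MeasurableSpace R] [MeasurableSpace S] {n : ℕ} (a : Fin n → R × S) {φ : R → ℝ≥0∞} (hφ : Measurable φ) :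
    ∫⁻ x, φ x.1 ∂(empirical a) = vertexMean fun u => φ (a u).1 := by
  rw [empirical, lintegral_smul_measure, lintegral_finsetSum_measure, vertexMean, smul_eq_mul,
    mul_comm, ← div_eq_mul_inv]
  congr 1
  exact Finset.sum_congr rfl fun u _ => lintegral_dirac' _ (by fun_prop)

section Wasserstein

variable {R S : Type*} [PseudoEMetricSpace R] [MeasurableSpace R] [PseudoEMetricSpace S]
  [MeasurableSpace S]

/-- Integrate the pointwise inequality against any coupling and drop the cost of the second
coordinate. Truncated subtraction lets the bound pass to the infimum. -/
theorem lintegral_fst_le_W1 (μ ν : Measure (R × S)) {φ ψ : R → ℝ≥0∞} (hφ : Measurable φ)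
    (hψ : Measurable ψ) (h : ∀ x y, φ x ≤ ψ y + edist x y) :
    ∫⁻ x, φ x.1 ∂μ ≤ ∫⁻ x, ψ x.1 ∂ν + W1 μ ν := by
  refine tsub_le_iff_left.1 (le_iInf₂ fun γ hγ => tsub_le_iff_left.2 ?_)
  rw [← hγ.1, ← hγ.2, lintegral_map (by fun_prop) (by fun_prop),
    lintegral_map (by fun_prop) (by fun_prop), ← lintegral_add_left (by fun_prop)]
  exact lintegral_mono fun p => (h _ _).trans (add_le_add le_rfl le_self_add)

theorem lintegral_fst_le_W1' (μ ν : Measure (R × S)) {φ ψ : R → ℝ≥0∞} (hφ : Measurable φ)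
    (hψ : Measurable ψ) (h : ∀ x y, φ x ≤ ψ y + edist x y) :
    ∫⁻ x, φ x.1 ∂ν ≤ ∫⁻ x, ψ x.1 ∂μ + W1 μ ν := by
  refine tsub_le_iff_left.1 (le_iInf₂ fun γ hγ => tsub_le_iff_left.2 ?_)
  rw [← hγ.1, ← hγ.2, lintegral_map (by fun_prop) (by fun_prop),
    lintegral_map (by fun_prop) (by fun_prop), ← lintegral_add_left (by fun_prop)]
  refine lintegral_mono fun p => (h _ p.1.1).trans (add_le_add le_rfl ?_)
  rw [edist_comm]
  exact le_self_add

theorem tendsto_lintegral_sub {X : Type*} [MeasurableSpace X] (ν : Measure X) {f : X → ℝ≥0}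
    (hf : Measurable f) (hν : ∫⁻ x, f x ∂ν < ∞) :
    Tendsto (fun K : ℕ => ∫⁻ x, ((f x : ℝ≥0∞) - K) ∂ν) atTop (𝓝 0) := by
  have h := tendsto_lintegral_of_dominated_convergence (μ := ν) (fun x => (f x : ℝ≥0∞))
    (F := fun (K : ℕ) x => (f x : ℝ≥0∞) - K) (f := fun _ => 0) (fun K => by fun_prop)
    (fun K => Eventually.of_forall fun x => tsub_le_self) hν.ne
    (Eventually.of_forall fun x => ?_)
  · simpa using h
  · obtain ⟨M, hM⟩ := exists_nat_ge (f x)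
    refine tendsto_const_nhds.congr' ?_
    filter_upwards [eventually_ge_atTop M] with K hK
    refine (tsub_eq_zero_of_le ?_).symm
    have : f x ≤ K := hM.trans (by exact_mod_cast hK)
    exact_mod_cast this

variable {Ω : ℕ+ → Type*} [∀ n, MeasurableSpace (Ω n)] {P : ∀ n, Measure (Ω n)}
  {a : ∀ n, Ω n → Fin (n : ℕ) → R × S} {ν : Measure (R × S)} {val : R → ℝ≥0}

/-- The function `(val x - K)⁺` inherits the Lipschitz bound of `val`, so its empirical mean exceeds
its `ν`-mean by at most the Wasserstein distance, and the `ν`-mean is small for large `K`. -/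
theorem uniformTail_of_W1
    (hW : TendstoInProb P (fun n ω => W1 (empirical (a n ω)) ν) (𝓝 0)) (hval : Measurable val)
    (hdist : ∀ x y, (val x : ℝ≥0∞) ≤ val y + edist x y) (hν : ∫⁻ x, val x.1 ∂ν < ∞) :
    UniformTail (highProb P) (fun ξ => (ξ.1 : ℕ)) (fun ξ u => val (a ξ.1 ξ.2 u).1) := by
  intro ε hε
  have hpos : 0 < ε / 8 := ENNReal.div_pos hε.ne' (by norm_num)
  obtain ⟨K, hK, hK1⟩ := (((tendsto_lintegral_sub ν (hval.comp measurable_fst) hν).eventually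
    (ge_mem_nhds hpos)).and (eventually_ge_atTop 1)).exists
  refine ⟨2 * K, ?_⟩
  filter_upwards [hW.tendsto.eventually (ge_mem_nhds hpos)] with ξ hξ
  have hφ : Measurable fun x => (val x : ℝ≥0∞) - K := by fun_prop
  have h1 := lintegral_fst_le_W1 (empirical (a ξ.1 ξ.2)) ν hφ hφ fun x y => by
    rw [tsub_le_iff_right, add_right_comm]
    exact (hdist x y).trans (add_le_add le_tsub_add le_rfl)
  rw [lintegral_empirical _ hφ] at h1
  have h2 : vertexMean (fun u => (val (a ξ.1 ξ.2 u).1 : ℝ≥0∞) - K) ≤ ε / 8 + ε / 8 :=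
    h1.trans (add_le_add hK hξ)
  -- For `w > 2 * K` and `K ≥ 1` one has `3 * w > 6 * K ≥ 4 * K + 1`. The factor 4 and the two error
  -- terms explain the choice `ε / 8`.
  have h3 : ∀ w : ℝ≥0, (if 2 * (K : ℝ≥0) < w then (1 + w : ℝ≥0∞) else 0) ≤
      4 * ((w : ℝ≥0∞) - K) := by
    intro w
    split_ifs with hw
    · have h4 : (1 : ℝ≥0) + w ≤ 4 * (w - K) := by
        have hKw : (K : ℝ≥0) ≤ w := le_trans (by linarith [K.cast_nonneg (α := ℝ≥0)]) hw.le
        rw [← NNReal.coe_le_coe]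
        push_cast [NNReal.coe_sub hKw]
        have h5 : 2 * (K : ℝ) < w := by exact_mod_cast hw
        have h6 : (1 : ℝ) ≤ K := by exact_mod_cast hK1
        linarith
      exact_mod_cast h4
    · exact zero_le
  calc vertexMean (fun u => if 2 * (K : ℝ≥0) < val (a ξ.1 ξ.2 u).1 then
        (1 + val (a ξ.1 ξ.2 u).1 : ℝ≥0∞) else 0)
      ≤ vertexMean (fun u => 4 * ((val (a ξ.1 ξ.2 u).1 : ℝ≥0∞) - K)) :=
        vertexMean_mono fun u => h3 _
    _ = 4 * vertexMean (fun u => (val (a ξ.1 ξ.2 u).1 : ℝ≥0∞) - K) := by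
        rw [vertexMean, vertexMean, ← Finset.mul_sum, mul_div_assoc]
    _ ≤ 4 * (ε / 8 + ε / 8) := mul_le_mul_right h2 _
    _ = ε := by
        rw [ENNReal.div_add_div_same, ← mul_div_assoc, ← two_mul, ← mul_assoc,
          show (4 : ℝ≥0∞) * 2 = 8 by norm_num, mul_comm,
          ENNReal.mul_div_cancel_right (by norm_num) (by norm_num)]

end Wasserstein

/-! ### The configuration model -/

theorem map_sum_smul {X Y : Type*} [MeasurableSpace X] [MeasurableSpace Y] {n : ℕ}
    (c : Fin n → ℝ≥0∞) (μ : Fin n → Measure X) {f : X → Y} (hf : Measurable f) :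
    (∑ j, c j • μ j).map f = ∑ j, c j • (μ j).map f := by
  ext s hs
  simp only [Measure.map_apply hf hs, Measure.finsetSum_apply, Measure.smul_apply]

section ConfigurationModel

variable {n : ℕ}

theorem labelLawCM_apply (d : Fin n → ℕ) (u : Fin n) :
    labelLawCM d {x | x.2 = u} = sizeBias (fun j => (d j : ℝ≥0)) u := by
  classical
  simp [labelLawCM, Measure.finsetSum_apply, Set.indicator_apply]

theorem lintegral_labelLawCM (d : Fin n → ℕ) (u : Fin n) :
    ∫⁻ x in {x | x.2 = u}, (x.1 : ℝ≥0∞) ∂(labelLawCM d) =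
      sizeBias (fun j => (d j : ℝ≥0)) u * ((d u - 1 : ℕ) : ℝ≥0∞) := by
  classical
  rw [← lintegral_indicator MeasurableSet.of_discrete, labelLawCM, lintegral_finsetSum_measure]
  simp [lintegral_smul_measure, Set.indicator_apply]

/-- The labelled version of `rootLawCM`. -/
noncomputable def labelRootCM (d : Fin n → ℕ) : Measure (ℕ × Fin n) :=
  ∑ v, (n : ℝ≥0∞)⁻¹ • Measure.dirac (d v, v)

theorem labelRootCM_apply (d : Fin n → ℕ) (u : Fin n) :
    labelRootCM d {x | x.2 = u} = (n : ℝ≥0∞)⁻¹ := by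
  classical
  simp [labelRootCM, Measure.finsetSum_apply, Set.indicator_apply]

theorem lintegral_labelRootCM (d : Fin n → ℕ) (u : Fin n) :
    ∫⁻ x in {x | x.2 = u}, (x.1 : ℝ≥0∞) ∂(labelRootCM d) = (n : ℝ≥0∞)⁻¹ * (d u : ℝ≥0∞) := by
  classical
  rw [← lintegral_indicator MeasurableSet.of_discrete, labelRootCM, lintegral_finsetSum_measure]
  simp [lintegral_smul_measure, Set.indicator_apply]

theorem labelRootCM_offspring_le (d : Fin n → ℕ) :
    labelRootCM d {x | 0 < x.1} ≤ vertexMean fun u => (d u : ℝ≥0∞) := by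
  classical
  rw [vertexMean, div_eq_mul_inv, Finset.sum_mul, labelRootCM, Measure.finsetSum_apply]
  refine Finset.sum_le_sum fun u _ => ?_
  rw [Measure.smul_apply, smul_eq_mul, mul_comm, Measure.dirac_apply' _ MeasurableSet.of_discrete]
  refine mul_le_mul_left ?_ _
  rw [Set.indicator_apply]
  split_ifs with h
  · have : 1 ≤ d u := h
    rw [Pi.one_apply]
    exact_mod_cast this
  · exact zero_le

theorem isProbabilityMeasure_labelRootCM (hn : n ≠ 0) (d : Fin n → ℕ) :
    IsProbabilityMeasure (labelRootCM d) :=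
  isProbabilityMeasure_mixture hn fun v => Measure.dirac (d v, v)

theorem injOn_nodes_of_no_offspring {A B : Type*} {t : TreeData A} (ht : (t []).1 = 0) (k : ℕ)
    (f : List ℕ → B) : Set.InjOn f (nodes t k) := by
  have h : ∀ i : List ℕ, IsNode t i → i = [] := by
    intro i
    induction i with
    | nil => exact fun _ => rfl
    | cons r i ih =>
      rintro ⟨hi, hr⟩
      rw [ih hi, ht] at hr
      exact absurd hr (Nat.not_lt_zero r)
  intro i hi j hj _
  rw [h i (mem_nodes.1 hi).1, h j (mem_nodes.1 hj).1]

end ConfigurationModel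

/-! ### Asymptotics and conclusion for the configuration model. -/

section AsymptoticsCM

variable {Ω : ℕ+ → Type*} {S : Type*} [∀ n, MeasurableSpace (Ω n)] [MetricSpace S]
  [MeasurableSpace S] {P : ∀ n, Measure (Ω n)} {a : ∀ n, Ω n → Fin (n : ℕ) → ℕ × S}
  {ν : Measure (ℕ × S)}

theorem natCast_le_add_edist (x y : ℕ) : ((x : ℝ≥0) : ℝ≥0∞) ≤ ((y : ℝ≥0) : ℝ≥0∞) + edist x y := by
  rw [edist_nndist, ← ENNReal.coe_add, ENNReal.coe_le_coe, ← NNReal.coe_le_coe]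
  push_cast
  rw [Nat.dist_eq]
  linarith [le_abs_self ((x : ℝ) - y)]

/-- If the limiting mean degree is zero, the empirical mean degree vanishes, and it bounds the
probability that the root has offspring at all. Otherwise the number of stubs is at least a multiple
of `n`, so size-biased labels have mass at most a constant times `(1 + D) / n`, and the general
tightness argument applies. -/
theorem labelTree_not_injOn_le (hA : AssumptionCM P a ν) (k : ℕ) {ε : ℝ≥0∞} (hε : 0 < ε) :
    ∀ᶠ ξ in highProb P, treeLaw (labelRootCM fun u => (a ξ.1 ξ.2 u).1)
      (labelLawCM fun u => (a ξ.1 ξ.2 u).1)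
        {t | ¬ Set.InjOn (fun i => (t i).2) (nodes t k)} ≤ ε := by
  obtain ⟨b₀, hb₀⟩ := hA.moment
  have hval : Measurable fun x : ℕ => (x : ℝ≥0) := Measurable.of_discrete
  have hval' : Measurable fun x : ℕ => ((x : ℝ≥0) : ℝ≥0∞) := Measurable.of_discrete
  have hmean : ∫⁻ x, ((x.1 : ℝ≥0) : ℝ≥0∞) ∂ν < ∞ := by
    refine lt_of_le_of_lt (lintegral_mono fun x => ?_) hb₀
    simp
  have hW := hA.wasserstein.tendsto
  have hn0 : ∀ ξ : Σ n, Ω n, (ξ.1 : ℕ) ≠ 0 := fun ξ => ξ.1.ne_zero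
  by_cases h0 : ∫⁻ x, ((x.1 : ℝ≥0) : ℝ≥0∞) ∂ν = 0
  · filter_upwards [hW.eventually (ge_mem_nhds hε)] with ξ hξ
    have := isProbabilityMeasure_labelRootCM (hn0 ξ) fun u => (a ξ.1 ξ.2 u).1
    have := isProbabilityMeasure_labelLawCM (hn0 ξ) fun u => (a ξ.1 ξ.2 u).1
    have h1 := lintegral_fst_le_W1 (empirical (a ξ.1 ξ.2)) ν hval' hval' natCast_le_add_edist
    rw [lintegral_empirical _ hval', h0, zero_add] at h1
    have h2 := treeLaw_apply (labelRootCM fun u => (a ξ.1 ξ.2 u).1)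
      (labelLawCM fun u => (a ξ.1 ξ.2 u).1) [] (B := {x | 0 < x.1}) MeasurableSet.of_discrete
    rw [if_pos rfl] at h2
    refine (measure_mono fun t ht => ?_).trans
      (h2.le.trans ((labelRootCM_offspring_le _).trans ?_))
    · by_contra hc
      exact ht (injOn_nodes_of_no_offspring (Nat.eq_zero_of_not_pos hc) k _)
    · refine le_trans (le_of_eq ?_) (h1.trans hξ)
      simp
  · set D := ∫⁻ x, ((x.1 : ℝ≥0) : ℝ≥0∞) ∂ν with hD
    have hpos : 0 < D / 2 := ENNReal.half_pos h0
    have hlow : ∀ᶠ ξ in highProb P,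
        D / 2 ≤ vertexMean fun u => ((a ξ.1 ξ.2 u).1 : ℝ≥0∞) := by
      filter_upwards [hW.eventually (ge_mem_nhds hpos)] with ξ hξ
      have h1 := lintegral_fst_le_W1' (empirical (a ξ.1 ξ.2)) ν hval' hval' natCast_le_add_edist
      rw [lintegral_empirical _ hval', ← hD] at h1
      have h2 : D ≤ (vertexMean fun u => ((a ξ.1 ξ.2 u).1 : ℝ≥0∞)) + D / 2 := by
        refine h1.trans (add_le_add (le_of_eq ?_) hξ)
        simp
      rw [← ENNReal.sub_half hmean.ne]
      exact tsub_le_iff_right.2 h2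
    have hTW := uniformTail_of_W1 hA.wasserstein hval natCast_le_add_edist hmean
    refine not_injOn_le (W := fun ξ u => ((a ξ.1 ξ.2 u).1 : ℝ≥0)) (N := fun ξ => (ξ.1 : ℕ))
      ⟨fun ξ => isProbabilityMeasure_labelRootCM (hn0 ξ) _, ⟨1, ?_⟩, ⟨1, ?_⟩⟩
      ⟨fun ξ => isProbabilityMeasure_labelLawCM (hn0 ξ) _, ⟨((D / 2)⁻¹).toNNReal, ?_⟩, ⟨1, ?_⟩⟩
      hTW tendsto_size_highProb k hε
    · refine Eventually.of_forall fun ξ u => ?_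
      rw [labelRootCM_apply, ENNReal.coe_one, one_mul, ← one_div]
      exact ENNReal.div_le_div_right le_self_add _
    · refine Eventually.of_forall fun ξ u => ?_
      rw [lintegral_labelRootCM, labelRootCM_apply, mul_comm]
      simp
    · filter_upwards [hlow] with ξ hξ u
      rw [labelLawCM_apply]
      have hL : ∑ i, (a ξ.1 ξ.2 i).1 ≠ 0 := by
        intro h
        rw [vertexMean, ← Nat.cast_sum, h, Nat.cast_zero, ENNReal.zero_div] at hξ
        exact absurd (le_antisymm hξ zero_le) hpos.ne'
      rw [sizeBias_nat _ hL, ENNReal.coe_toNNReal (ENNReal.inv_ne_top.2 hpos.ne')]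
      have hn : ((ξ.1 : ℕ) : ℝ≥0∞) ≠ 0 := by exact_mod_cast hn0 ξ
      have hinv : ((∑ i, (a ξ.1 ξ.2 i).1 : ℕ) : ℝ≥0∞)⁻¹ ≤ (D / 2)⁻¹ * (ξ.1 : ℝ≥0∞)⁻¹ := by
        refine le_trans (le_of_eq ?_) (mul_le_mul_left (ENNReal.inv_le_inv.2 hξ) _)
        rw [vertexMean, ← Nat.cast_sum, ENNReal.inv_div (Or.inl (ENNReal.natCast_ne_top _))
          (Or.inl hn), mul_comm, div_eq_mul_inv, ← mul_assoc,
          ENNReal.inv_mul_cancel hn (ENNReal.natCast_ne_top _), one_mul]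
      calc ((a ξ.1 ξ.2 u).1 : ℝ≥0∞) * ((∑ i, (a ξ.1 ξ.2 i).1 : ℕ) : ℝ≥0∞)⁻¹
          ≤ (1 + (a ξ.1 ξ.2 u).1) * ((D / 2)⁻¹ * (ξ.1 : ℝ≥0∞)⁻¹) := by
            gcongr
            exact le_add_self
        _ = _ := by simp only [ENNReal.coe_natCast, div_eq_mul_inv (1 + ((a ξ.1 ξ.2 u).1 : ℝ≥0∞))]; ring
    · refine Eventually.of_forall fun ξ u => ?_
      rw [lintegral_labelLawCM, labelLawCM_apply, mul_comm, ENNReal.coe_one, one_mul]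
      refine mul_le_mul_left ?_ _
      have : (a ξ.1 ξ.2 u).1 - 1 ≤ (a ξ.1 ξ.2 u).1 := Nat.sub_le _ _
      push_cast
      exact tsub_le_self

theorem existsTreeCoupling_CM [TopologicalSpace.SeparableSpace S] [BorelSpace S]
    [∀ n, IsProbabilityMeasure (P n)] (pick : ∀ (n : ℕ+) (d : Fin (n : ℕ) → ℕ), PickRule d)
    {G : ∀ n, Ω n → Fin (n : ℕ) → Fin (n : ℕ) → ℕ} {I : ∀ n, Ω n → Fin (n : ℕ)}
    (hG : ∀ n, IsCM (P n) (pick n) (a n) (G n) (I n)) (hA : AssumptionCM P a ν) :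
    ExistsTreeCoupling P a G I (fun n ω => rootLawCM (a n ω)) (fun n ω => nodeLawCM (a n ω)) := by
  have : SecondCountableTopology S := UniformSpace.secondCountable_of_separable S
  have hn0 : ∀ n : ℕ+, (n : ℕ) ≠ 0 := fun n => n.ne_zero
  have hex : ∀ (k : ℕ) (n : ℕ+) (x : (Fin (n : ℕ) → ℕ) × Fin (n : ℕ)),
      ∃ π : Measure ((Fin (n : ℕ) → Fin (n : ℕ) → ℕ) × TreeData (Fin (n : ℕ))),
        IsProbabilityMeasure π ∧ π.map Prod.fst = (cmLaw (pick n x.1)).toMeasure ∧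
        π.map Prod.snd = treeLaw (Measure.dirac (x.1 x.2, x.2)) (labelLawCM x.1) ∧
        (Even (∑ i, x.1 i) → treeLaw (Measure.dirac (x.1 x.2, x.2)) (labelLawCM x.1)
          {t | Set.InjOn (fun i => (t i).2) (nodes t (k + 1))} ≤ π {y | Matches k y.1 x.2 y.2}) := by
    rintro k n ⟨d, v⟩
    by_cases hd : Even (∑ i, d i)
    · obtain ⟨π, h1, h2, h3, h4⟩ := exists_coupling_CM (pick n d) hd v k
      exact ⟨π, h1, h2, h3, fun _ => h4⟩
    -- Odd degree sums have probability zero; independence merely provides some coupling with the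
    -- right marginals.
    · have := isProbabilityMeasure_labelLawCM (hn0 n) d
      refine ⟨(cmLaw (pick n d)).toMeasure.prod
        (treeLaw (Measure.dirac (d v, v)) (labelLawCM d)), inferInstance, ?_, ?_, fun h => ?_⟩
      · rw [Measure.map_fst_prod, measure_univ, one_smul]
      · rw [Measure.map_snd_prod, measure_univ, one_smul]
      · exact absurd h hd
  choose π hπ1 hπ2 hπ3 hπ4 using hex
  let deg : ∀ n : ℕ+, (Fin (n : ℕ) → ℕ × S) → Fin (n : ℕ) → ℕ := fun n α i => (α i).1
  have hdeg : ∀ n, Measurable (deg n) := fun n =>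
    measurable_pi_lambda _ fun i => measurable_fst.comp (measurable_pi_apply i)
  let Γ : ∀ n : ℕ+, Kernel (Fin (n : ℕ) → ℕ × S) (Fin (n : ℕ) → Fin (n : ℕ) → ℕ) := fun n =>
    ⟨fun α => (cmLaw (pick n (deg n α))).toMeasure,
      (Measurable.of_discrete (f := fun d => (cmLaw (pick n d)).toMeasure)).comp (hdeg n)⟩
  have hΓ : ∀ n, IsMarkovKernel (Γ n) := fun n => ⟨fun α =>
    inferInstanceAs (IsProbabilityMeasure (cmLaw (pick n (deg n α))).toMeasure)⟩
  -- The degrees and the root take values in a countable discrete space, so an arbitrary choice of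
  -- couplings is a kernel.
  let κ : ∀ (_ : ℕ) (n : ℕ+), Kernel ((Fin (n : ℕ) → ℕ × S) × Fin (n : ℕ))
      ((Fin (n : ℕ) → Fin (n : ℕ) → ℕ) × TreeData (Fin (n : ℕ))) := fun k n =>
    ⟨fun x => π k n (deg n x.1, x.2), (Measurable.of_discrete (f := π k n)).comp
      (((hdeg n).comp measurable_fst).prodMk measurable_snd)⟩
  have hκ : ∀ k n, IsMarkovKernel (κ k n) := fun k n => ⟨fun x => hπ1 k n (deg n x.1, x.2)⟩
  have hnode : ∀ (n : ℕ+) (α : Fin (n : ℕ) → ℕ × S), IsProbabilityMeasure (labelLawCM (deg n α)) :=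
    fun n α => isProbabilityMeasure_labelLawCM (hn0 n) _
  refine existsTreeCoupling_of_tendsto (fun n => (hG n).measurable_a)
    (fun k n => measurableSet_notIso k (hG n).measurable_G (hG n).measurable_a (hG n).measurable_I)
    (δ := fun k n => ∫⁻ ω, ∑ v, (n : ℝ≥0∞)⁻¹ * κ k n (a n ω, v) {y | ¬ Matches k y.1 v y.2} ∂P n)
    (fun k => ?_) fun k n => ?_
  · refine tendsto_lintegral_of_highProb (f := fun ξ => ∑ v, (ξ.1 : ℝ≥0∞)⁻¹ *
      κ k ξ.1 (a ξ.1 ξ.2, v) {y | ¬ Matches k y.1 v y.2}) (fun ξ => ?_) fun ε hε => ?_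
    · rw [← sum_inv_natCast (hn0 ξ.1)]
      exact Finset.sum_le_sum fun v _ => mul_le_of_le_one_right' prob_le_one
    · filter_upwards [labelTree_not_injOn_le hA (k + 1) hε,
        eventually_highProb_of_ae (p := fun ξ => Even (∑ i, (a ξ.1 ξ.2 i).1))
          fun n => (hG n).even] with ξ h1 h2
      refine le_trans ?_ h1
      have : IsProbabilityMeasure (labelLawCM fun u => (a ξ.1 ξ.2 u).1) := hnode ξ.1 (a ξ.1 ξ.2)
      rw [labelRootCM, ← sum_smul_treeLaw (hn0 ξ.1), Measure.finsetSum_apply]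
      refine Finset.sum_le_sum fun v _ => ?_
      rw [Measure.smul_apply, smul_eq_mul]
      refine mul_le_mul_right ?_ _
      exact measure_not_matches_le id k v (measurableSet_injOn (k + 1))
        (hπ4 k ξ.1 (deg ξ.1 (a ξ.1 ξ.2), v) h2)
  · refine exists_isTreeCoupling (Γ := Γ n) (π := κ k n) (hn0 n) (hG n).measurable_a
      (hG n).measurable_G (hG n).measurable_I (fun v M => ?_)
      (fun x => hπ2 k n (deg n x.1, x.2))
      (root := fun α v => Measure.dirac (deg n α v, v)) (node := fun α => labelLawCM (deg n α))
      (fun α v => ?_) (fun x => hπ3 k n (deg n x.1, x.2)) (fun ω => ?_) (fun ω => ?_) id k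
    · refine ((hG n).law v M).trans (Eventually.of_forall fun ω => ?_)
      change _ = (n : ℝ)⁻¹ * ((cmLaw (pick n (deg n (a n ω)))).toMeasure {M}).toReal
      rw [PMF.toMeasure_apply_singleton _ _ (measurableSet_singleton M)]
    · rw [Measure.dirac_apply' _ MeasurableSet.of_discrete]
      simp
    · rw [map_sum_smul _ _ Measurable.of_discrete, rootLawCM]
      refine Finset.sum_congr rfl fun v _ => ?_
      rw [Measure.map_dirac' Measurable.of_discrete]
    · rw [labelLawCM, map_sum_smul _ _ Measurable.of_discrete, nodeLawCM]
      refine Finset.sum_congr rfl fun v _ => ?_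
      rw [Measure.map_dirac' Measurable.of_discrete]

end AsymptoticsCM

/-! ### The inhomogeneous random graph -/

section Poisson

/-- The weights satisfy `(x + 1) * P (x + 1) = r * P x`, so the mean is `r` times the total mass. -/
theorem lintegral_poissonMeasure (r : ℝ≥0) : ∫⁻ x, (x : ℝ≥0∞) ∂(poissonMeasure r) = r := by
  have hstep : ∀ x : ℕ, ((x + 1 : ℕ) : ℝ≥0∞) * poissonMeasure r {x + 1} =
      r * poissonMeasure r {x} := by
    intro x
    have hx : ((x + 1 : ℕ) : ℝ≥0∞) * ((x + 1 : ℕ) : ℝ≥0∞)⁻¹ = 1 :=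
      ENNReal.mul_inv_cancel (by simp) (ENNReal.natCast_ne_top _)
    rw [poissonMeasure_singleton_eq, poissonMeasure_singleton_eq, Nat.factorial_succ, Nat.cast_mul,
      ENNReal.mul_inv (Or.inl (by simp)) (Or.inl (ENNReal.natCast_ne_top _)), pow_succ]
    calc _ = (((x + 1 : ℕ) : ℝ≥0∞) * ((x + 1 : ℕ) : ℝ≥0∞)⁻¹) * (r * (ENNReal.ofReal
          (Real.exp (-r)) * (r : ℝ≥0∞) ^ x * ((x.factorial : ℕ) : ℝ≥0∞)⁻¹)) := by ring
      _ = _ := by rw [hx, one_mul]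
  rw [lintegral_countable', tsum_eq_zero_add' ENNReal.summable]
  simp only [hstep, Nat.cast_zero, zero_mul, zero_add]
  have hsum := Measure.tsum_indicator_apply_singleton (poissonMeasure r) Set.univ MeasurableSet.univ
  simp only [Set.indicator_univ, measure_univ] at hsum
  rw [ENNReal.tsum_mul_left, hsum, mul_one]

theorem poissonMeasure_pos_le (r : ℝ≥0) (l : ℕ) : poissonMeasure r {x | l < x} ≤ r := by
  refine le_trans (measure_mono fun x (hx : l < x) => ?_)
    ((mul_meas_ge_le_lintegral (μ := poissonMeasure r) (f := fun x : ℕ => (x : ℝ≥0∞))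
      Measurable.of_discrete 1).trans_eq (lintegral_poissonMeasure r) |> (one_mul _).symm.le.trans)
  have : 1 ≤ x := by omega
  have h1 : (1 : ℝ≥0∞) ≤ (x : ℝ≥0∞) := by exact_mod_cast this
  exact h1

variable {n : ℕ}

theorem labelLawIR_label (m : Fin n → ℝ≥0) (q : Fin n → ℝ≥0∞) (u : Fin n) :
    labelLawIR m q {x | x.2 = u} = q u := by
  have h := labelLawIR_apply m q u Set.univ
  simpa using h

theorem lintegral_labelLawIR (m : Fin n → ℝ≥0) (q : Fin n → ℝ≥0∞) (u : Fin n) :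
    ∫⁻ x in {x | x.2 = u}, (x.1 : ℝ≥0∞) ∂(labelLawIR m q) = q u * m u := by
  classical
  rw [← lintegral_indicator MeasurableSet.of_discrete, labelLawIR, lintegral_finsetSum_measure,
    Finset.sum_eq_single u]
  · rw [lintegral_smul_measure, lintegral_map Measurable.of_discrete Measurable.of_discrete]
    simp [lintegral_poissonMeasure]
  · intro v _ hv
    rw [lintegral_smul_measure, lintegral_map Measurable.of_discrete Measurable.of_discrete]
    simp [hv]
  · simp

theorem labelLawIR_offspring_le (m : Fin n → ℝ≥0) (q : Fin n → ℝ≥0∞) (u : Fin n) (l : ℕ) :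
    labelLawIR m q {x | l < x.1 ∧ x.2 = u} ≤ m u * labelLawIR m q {x | x.2 = u} := by
  rw [labelLawIR_label, mul_comm]
  exact (labelLawIR_apply m q u {x | l < x}).trans_le
    (mul_le_mul_right (poissonMeasure_pos_le _ _) _)

end Poisson

/-! ### Edge probabilities and their truncation. -/

section EdgeProbabilities

variable {n : ℕ} {θ : ℝ≥0} {φ : ℝ≥0 → ℝ≥0 → (Fin n → ℝ≥0) → ℝ}

theorem edgeProb_le_one (w : Fin n → ℝ≥0) (i j : Fin n) : edgeProb θ φ w i j ≤ 1 := by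
  rw [edgeProb]
  split_ifs
  · exact zero_le_one
  · exact min_le_left _ _

theorem edgeProb_comm (w : Fin n → ℝ≥0) (i j : Fin n) : edgeProb θ φ w i j = edgeProb θ φ w j i := by
  simp only [edgeProb, eq_comm (a := i), min_comm i, max_comm i, mul_comm (w i : ℝ)]

theorem edgeProb_nonneg {w : Fin n → ℝ≥0} (h : ∀ i j, i < j → -1 < φ (w i) (w j) w) (i j : Fin n) :
    0 ≤ edgeProb θ φ w i j := by
  rw [edgeProb]
  split_ifs with hij
  · exact le_rfl
  · have hlt : min i j < max i j := min_lt_max.2 hij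
    refine le_min zero_le_one (mul_nonneg (by positivity) ?_)
    linarith [h _ _ hlt]

theorem measurable_edgeProb
    (hφ : Measurable fun x : ℝ≥0 × ℝ≥0 × (Fin n → ℝ≥0) => φ x.1 x.2.1 x.2.2) (i j : Fin n) :
    Measurable fun w => edgeProb θ φ w i j := by
  unfold edgeProb
  split_ifs
  · exact measurable_const
  · have hw : ∀ l, Measurable fun w : Fin n → ℝ≥0 => w l := measurable_pi_apply
    have h : Measurable fun w : Fin n → ℝ≥0 => φ (w (min i j)) (w (max i j)) w :=
      hφ.comp ((hw _).prodMk ((hw _).prodMk measurable_id))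
    fun_prop

theorem bernoulliGraphProb_nonneg {p : Fin n → Fin n → ℝ} (h0 : ∀ i j, 0 ≤ p i j)
    (h1 : ∀ i j, p i j ≤ 1) (H : SimpleGraph (Fin n)) : 0 ≤ bernoulliGraphProb p H := by
  refine Finset.prod_nonneg fun i _ => Finset.prod_nonneg fun j _ => ?_
  split_ifs
  · exact h0 i j
  · linarith [h1 i j]

/-- The edge probabilities in which the weights are truncated at `b`. -/
noncomputable def truncProb (θ b : ℝ≥0) (w : Fin n → ℝ≥0) (i j : Fin n) : ℝ≥0 :=
  min (w i) b * min (w j) b / (θ * n)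

theorem sum_truncProb (b : ℝ≥0) (w : Fin n → ℝ≥0) (i : Fin n) :
    ∑ j, truncProb θ b w i j = poissonMean θ b w i := by
  simp only [truncProb, poissonMean]
  rw [← Finset.sum_div, ← Finset.mul_sum, mul_comm]

/-- This identity links tree and graph: the mean number of children of `i` with label `j` is the
truncated edge probability. If all truncated weights vanish, the mean offspring does too, and the
uniform convention is harmless. -/
theorem truncProb_eq (b : ℝ≥0) (w : Fin n → ℝ≥0) (i j : Fin n) :
    (truncProb θ b w i j : ℝ≥0∞) =
      poissonMean θ b w i * sizeBias (fun l => min (w l) b) j := by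
  by_cases h : ∑ l, min (w l) b = 0
  · have hi : ∀ i, min (w i) b = 0 := fun i => (Finset.sum_eq_zero_iff.1 h) i (Finset.mem_univ i)
    simp [truncProb, poissonMean, hi]
  · rw [sizeBias, if_neg h, ← ENNReal.coe_mul, ENNReal.coe_inj, truncProb, poissonMean]
    field_simp

theorem vertexMean_coe (hn : n ≠ 0) (f : Fin n → ℝ≥0) :
    vertexMean (fun u => (f u : ℝ≥0∞)) = ((∑ u, f u) / n : ℝ≥0) := by
  have hn' : (n : ℝ≥0) ≠ 0 := by exact_mod_cast hn
  rw [vertexMean, ENNReal.coe_div hn', ENNReal.ofNNReal_finsetSum, ENNReal.coe_natCast]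

/-- Since `b * b ≤ θ * n`, the truncated probability is at most one, so it lies below the minimum
with one. The gap is then at most the difference of the products of weights, which splits into the
truncation errors of the two endpoints. -/
theorem edge_deviation_le (hθ : 0 < θ) {b : ℝ≥0} (w : Fin n → ℝ≥0) (hb : b * b ≤ θ * n)
    (p : ℝ) (u v : Fin n) :
    ENNReal.ofReal |p - truncProb θ b w u v| ≤
      ENNReal.ofReal |p - min ((w u * w v : ℝ) / (θ * n)) 1| +
        (((w u - min (w u) b) * w v + w u * (w v - min (w v) b)) / (θ * n) : ℝ≥0) := by
  have hn : 0 < (n : ℝ) := by exact_mod_cast u.pos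
  have hθn : 0 < (θ : ℝ) * n := mul_pos (by exact_mod_cast hθ) hn
  rw [← ENNReal.ofReal_coe_nnreal, ← ENNReal.ofReal_add (abs_nonneg _) NNReal.zero_le_coe]
  refine ENNReal.ofReal_le_ofReal ?_
  have hu : (min (w u) b : ℝ≥0) ≤ w u := min_le_left _ _
  have hv : (min (w v) b : ℝ≥0) ≤ w v := min_le_left _ _
  have hub : (min (w u) b : ℝ≥0) ≤ b := min_le_right _ _
  have hvb : (min (w v) b : ℝ≥0) ≤ b := min_le_right _ _
  simp only [truncProb]
  push_cast [NNReal.coe_sub hu, NNReal.coe_sub hv]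
  rw [← NNReal.coe_min, ← NNReal.coe_min]
  set x : ℝ := (w u : ℝ)
  set y : ℝ := (w v : ℝ)
  set x' : ℝ := ((min (w u) b : ℝ≥0) : ℝ)
  set y' : ℝ := ((min (w v) b : ℝ≥0) : ℝ)
  have hx : x' ≤ x := by exact_mod_cast hu
  have hy : y' ≤ y := by exact_mod_cast hv
  have hx0 : 0 ≤ x' := NNReal.zero_le_coe
  have hy0 : 0 ≤ y' := NNReal.zero_le_coe
  have h1 : x' * y' / (θ * n) ≤ x * y / (θ * n) := by gcongr
  have h2 : x' * y' / (θ * n) ≤ 1 := by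
    rw [div_le_one hθn]
    have h3 : min (w u) b * min (w v) b ≤ θ * n := (mul_le_mul' hub hvb).trans hb
    exact_mod_cast h3
  have h3 : x * y / (θ * n) - x' * y' / (θ * n) ≤ ((x - x') * y + x * (y - y')) / (θ * n) := by
    rw [← sub_div]
    gcongr
    nlinarith
  have h4 : x' * y' / (θ * n) ≤ min (x * y / (θ * n)) 1 := le_min h1 h2
  have h5 : min (x * y / (θ * n)) 1 ≤ x * y / (θ * n) := min_le_left _ _
  have h6 := abs_sub_le p (min (x * y / (θ * n)) 1) (x' * y' / (θ * n))
  rw [abs_of_nonneg (sub_nonneg.2 h4)] at h6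
  linarith

/-- Summing the edgewise bound over all pairs factorizes the truncation errors; the two endpoints
contribute equally, whence the factor 2. -/
theorem vertexMean_deviation_le (hn : n ≠ 0) (hθ : 0 < θ) {b : ℝ≥0} (w : Fin n → ℝ≥0)
    (hb : b * b ≤ θ * n) :
    vertexMean (deviation (edgeProb θ φ w) (truncProb θ b w)) ≤
      ENNReal.ofReal (edgeError θ φ w) + 2 * (vertexMean fun u => ((w u - min (w u) b : ℝ≥0) : ℝ≥0∞)) *
        (vertexMean fun u => (w u : ℝ≥0∞)) / θ := by
  have hn' : (n : ℝ≥0) ≠ 0 := by exact_mod_cast hn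
  have hR : vertexMean (fun u => ∑ v ∈ Finset.univ.erase u,
      ENNReal.ofReal |edgeProb θ φ w u v - min ((w u * w v : ℝ) / (θ * n)) 1|) =
      ENNReal.ofReal (edgeError θ φ w) := by
    rw [edgeError, ENNReal.ofReal_mul (by positivity), vertexMean, mul_comm (ENNReal.ofReal _), div_eq_mul_inv,
      ENNReal.ofReal_inv_of_pos (by exact_mod_cast Nat.pos_of_ne_zero hn), ENNReal.ofReal_natCast,
      ENNReal.ofReal_sum_of_nonneg fun _ _ => Finset.sum_nonneg fun _ _ => abs_nonneg _]
    congr 1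
    exact Finset.sum_congr rfl fun u _ =>
      (ENNReal.ofReal_sum_of_nonneg fun _ _ => abs_nonneg _).symm
  have hD : vertexMean (fun u => ((∑ v, ((w u - min (w u) b) * w v + w u * (w v - min (w v) b)) /
      (θ * n) : ℝ≥0) : ℝ≥0∞)) = 2 * (vertexMean fun u => ((w u - min (w u) b : ℝ≥0) : ℝ≥0∞)) *
        (vertexMean fun u => (w u : ℝ≥0∞)) / θ := by
    rw [vertexMean_coe hn, vertexMean_coe hn, vertexMean_coe hn, ← ENNReal.coe_ofNat,
      ← ENNReal.coe_mul, ← ENNReal.coe_mul, ← ENNReal.coe_div hθ.ne', ENNReal.coe_inj]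
    simp only [← Finset.sum_div, Finset.sum_add_distrib, ← Finset.mul_sum, ← Finset.sum_mul]
    field_simp
    ring
  rw [← hR, ← hD, vertexMean, vertexMean, vertexMean, ← ENNReal.add_div, ← Finset.sum_add_distrib]
  refine ENNReal.div_le_div_right (Finset.sum_le_sum fun u _ => ?_) _
  rw [deviation]
  refine (Finset.sum_le_sum fun v _ => edge_deviation_le hθ w hb _ u v).trans ?_
  rw [Finset.sum_add_distrib]
  refine add_le_add le_rfl ?_
  rw [ENNReal.ofNNReal_finsetSum]
  exact Finset.sum_le_sum_of_subset (Finset.erase_subset _ _)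

end EdgeProbabilities

/-! ### Asymptotics of the inhomogeneous random graph. -/

section AsymptoticsIR

theorem tightLabels_labelLawIR {Ξ : Type*} {𝓕 : Filter Ξ} {N : Ξ → ℕ} {W : ∀ ξ, Fin (N ξ) → ℝ≥0}
    {m : ∀ ξ, Fin (N ξ) → ℝ≥0} {q : ∀ ξ, Fin (N ξ) → ℝ≥0∞} (hq1 : ∀ ξ, ∑ u, q ξ u = 1)
    (hq : ∃ C : ℝ≥0, ∀ᶠ ξ in 𝓕, ∀ u, q ξ u ≤ C * ((1 + W ξ u) / N ξ))
    (hm : ∃ C : ℝ≥0, ∀ᶠ ξ in 𝓕, ∀ u, m ξ u ≤ C * W ξ u) :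
    TightLabels 𝓕 N W fun ξ => labelLawIR (m ξ) (q ξ) := by
  obtain ⟨C, hC⟩ := hm
  refine ⟨fun ξ => isProbabilityMeasure_labelLawIR _ (hq1 ξ), ?_, ⟨C, ?_⟩⟩
  · simpa only [labelLawIR_label] using hq
  · filter_upwards [hC] with ξ h u
    rw [lintegral_labelLawIR, labelLawIR_label, mul_comm]
    refine mul_le_mul_left ?_ _
    exact_mod_cast h u

/-- The edge probabilities, made nonnegative on the null set where they might be negative. -/
noncomputable def posEdgeProb {n : ℕ} (θ : ℝ≥0) (φ : ℝ≥0 → ℝ≥0 → (Fin n → ℝ≥0) → ℝ)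
    (w : Fin n → ℝ≥0) (i j : Fin n) : ℝ := max 0 (edgeProb θ φ w i j)

theorem posEdgeProb_eq {n : ℕ} {θ : ℝ≥0} {φ : ℝ≥0 → ℝ≥0 → (Fin n → ℝ≥0) → ℝ}
    {w : Fin n → ℝ≥0} (h : ∀ i j, i < j → -1 < φ (w i) (w j) w) :
    posEdgeProb θ φ w = edgeProb θ φ w := by
  ext i j
  exact max_eq_right (edgeProb_nonneg h i j)

variable {Ω : ℕ+ → Type*} {S : Type*} [∀ n, MeasurableSpace (Ω n)] [MetricSpace S]
  [MeasurableSpace S] {P : ∀ n, Measure (Ω n)} {θ : ℝ≥0}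
  {φ : ∀ n : ℕ+, ℝ≥0 → ℝ≥0 → (Fin (n : ℕ) → ℝ≥0) → ℝ} {a : ∀ n, Ω n → Fin (n : ℕ) → ℝ≥0 × S}
  {ν : Measure (ℝ≥0 × S)} {b : ∀ n, Ω n → ℝ≥0}

theorem coe_le_add_edist (x y : ℝ≥0) : (x : ℝ≥0∞) ≤ y + edist x y := by
  rw [edist_nndist, ← ENNReal.coe_add, ENNReal.coe_le_coe, ← NNReal.coe_le_coe]
  push_cast
  rw [NNReal.dist_eq]
  linarith [le_abs_self ((x : ℝ) - y)]

theorem uniformTail_IR (hA : AssumptionIR P θ φ a ν) :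
    UniformTail (highProb P) (fun ξ => (ξ.1 : ℕ)) (fun ξ u => (a ξ.1 ξ.2 u).1) := by
  obtain ⟨b₀, hb₀⟩ := hA.moment
  refine uniformTail_of_W1 (val := fun x => x) hA.wasserstein measurable_id coe_le_add_edist ?_
  exact lt_of_le_of_lt (lintegral_mono fun x => le_self_add) hb₀

theorem tendsto_meanWeight (hA : AssumptionIR P θ φ a ν) :
    Tendsto (fun ξ : Σ n, Ω n => (∑ u, (a ξ.1 ξ.2 u).1) / (ξ.1 : ℝ≥0)) (highProb P) (𝓝 θ) := by
  refine hA.mean.tendsto.congr fun ξ => ?_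
  rw [div_eq_mul_inv, mul_comm]

/-- Once `b` exceeds `K`, truncation only affects weights above `K` and removes at most the whole
weight, so the loss is bounded by the uniform tail. -/
theorem tendsto_truncation (hA : AssumptionIR P θ φ a ν) (hb : TendstoInProb P b atTop) :
    Tendsto (fun ξ : Σ n, Ω n => (∑ u, ((a ξ.1 ξ.2 u).1 - min (a ξ.1 ξ.2 u).1 (b ξ.1 ξ.2))) /
      (ξ.1 : ℝ≥0)) (highProb P) (𝓝 0) := by
  rw [← ENNReal.tendsto_coe, ENNReal.coe_zero]
  refine ENNReal.tendsto_nhds_zero.2 fun ε hε => ?_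
  obtain ⟨K, hK⟩ := uniformTail_IR hA ε hε
  filter_upwards [hK, hb.tendsto.eventually_ge_atTop K] with ξ h1 h2
  have h3 := vertexMean_coe ξ.1.ne_zero
    (fun u => (a ξ.1 ξ.2 u).1 - min (a ξ.1 ξ.2 u).1 (b ξ.1 ξ.2))
  refine (h3.symm.le.trans (vertexMean_mono fun u => ?_)).trans h1
  split_ifs with hu
  · refine le_trans ?_ le_add_self
    exact ENNReal.coe_le_coe.2 tsub_le_self
  · rw [min_eq_left ((not_lt.1 hu).trans h2), tsub_self, ENNReal.coe_zero]

theorem eventually_le_sum_truncated (hA : AssumptionIR P θ φ a ν) (hb : TendstoInProb P b atTop) :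
    ∀ᶠ ξ in highProb P, θ / 2 * (ξ.1 : ℝ≥0) ≤ ∑ u, min (a ξ.1 ξ.2 u).1 (b ξ.1 ξ.2) := by
  have hθ := hA.theta_pos
  have h4 : 0 < θ / 4 := by positivity
  have h34 : θ - θ / 4 < θ := tsub_lt_self hθ h4
  filter_upwards [(tendsto_truncation hA hb).eventually (ge_mem_nhds h4),
    (tendsto_meanWeight hA).eventually (le_mem_nhds h34)] with ξ h1 h2
  have hn : 0 < (ξ.1 : ℝ≥0) := by exact_mod_cast ξ.1.pos
  rw [div_le_iff₀ hn] at h1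
  rw [le_div_iff₀ hn] at h2
  have hsum : ∑ u, (a ξ.1 ξ.2 u).1 = ∑ u, ((a ξ.1 ξ.2 u).1 - min (a ξ.1 ξ.2 u).1 (b ξ.1 ξ.2)) +
      ∑ u, min (a ξ.1 ξ.2 u).1 (b ξ.1 ξ.2) := by
    rw [← Finset.sum_add_distrib]
    exact Finset.sum_congr rfl fun u _ => (tsub_add_cancel_of_le (min_le_left _ _)).symm
  rw [hsum] at h2
  have hle : θ / 4 ≤ θ := by
    rw [← NNReal.coe_le_coe]; push_cast; linarith [θ.coe_nonneg]
  rw [← NNReal.coe_le_coe] at h1 h2 ⊢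
  rw [NNReal.coe_add, NNReal.coe_mul, NNReal.coe_sub hle] at h2
  rw [NNReal.coe_mul] at h1 ⊢
  push_cast at h1 h2 ⊢
  linarith

theorem eventually_poissonMean_le (hA : AssumptionIR P θ φ a ν) : ∀ᶠ ξ in highProb P, ∀ u,
    poissonMean θ (b ξ.1 ξ.2) (fun j => (a ξ.1 ξ.2 j).1) u ≤ 2 * (a ξ.1 ξ.2 u).1 := by
  have hθ := hA.theta_pos
  have h2 : θ < 2 * θ := lt_mul_of_one_lt_left hθ one_lt_two
  filter_upwards [(tendsto_meanWeight hA).eventually (ge_mem_nhds h2)] with ξ h1 u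
  have hn : 0 < (ξ.1 : ℝ≥0) := by exact_mod_cast ξ.1.pos
  rw [div_le_iff₀ hn] at h1
  rw [poissonMean, div_le_iff₀ (mul_pos hθ hn)]
  calc (∑ j, min (a ξ.1 ξ.2 j).1 (b ξ.1 ξ.2)) * min (a ξ.1 ξ.2 u).1 (b ξ.1 ξ.2)
      ≤ (∑ j, (a ξ.1 ξ.2 j).1) * (a ξ.1 ξ.2 u).1 :=
        mul_le_mul' (Finset.sum_le_sum fun _ _ => min_le_left _ _) (min_le_left _ _)
    _ ≤ 2 * θ * ξ.1 * (a ξ.1 ξ.2 u).1 := mul_le_mul_left h1 _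
    _ = _ := by ring

theorem eventually_sizeBias_le (hA : AssumptionIR P θ φ a ν) (hb : TendstoInProb P b atTop) :
    ∀ᶠ ξ in highProb P, ∀ u, sizeBias (fun j => min (a ξ.1 ξ.2 j).1 (b ξ.1 ξ.2)) u ≤
      ((2 / θ : ℝ≥0) : ℝ≥0∞) * ((1 + (a ξ.1 ξ.2 u).1) / (ξ.1 : ℕ)) := by
  have hθ := hA.theta_pos
  filter_upwards [eventually_le_sum_truncated hA hb] with ξ h u
  have hn : 0 < (ξ.1 : ℝ≥0) := by exact_mod_cast ξ.1.pos
  have hpos : 0 < ∑ j, min (a ξ.1 ξ.2 j).1 (b ξ.1 ξ.2) := lt_of_lt_of_le (by positivity) h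
  have key : min (a ξ.1 ξ.2 u).1 (b ξ.1 ξ.2) / ∑ j, min (a ξ.1 ξ.2 j).1 (b ξ.1 ξ.2) ≤
      2 / θ * ((1 + (a ξ.1 ξ.2 u).1) / (ξ.1 : ℝ≥0)) := by
    calc min (a ξ.1 ξ.2 u).1 (b ξ.1 ξ.2) / ∑ j, min (a ξ.1 ξ.2 j).1 (b ξ.1 ξ.2)
        ≤ (1 + (a ξ.1 ξ.2 u).1) / (θ / 2 * ξ.1) := by
          gcongr
          exact (min_le_left _ _).trans le_add_self
      _ = _ := by field_simp
  rw [sizeBias, if_neg hpos.ne']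
  refine (ENNReal.coe_le_coe.2 key).trans (le_of_eq ?_)
  rw [ENNReal.coe_mul, ENNReal.coe_div hn.ne']
  simp

theorem eventually_sq_le (hb : TendstoInProb P (fun n ω => (b n ω : ℝ) / √((n : ℕ) : ℝ)) (𝓝 0))
    {c : ℝ≥0} (hc : 0 < c) :
    ∀ᶠ ξ in highProb P, b ξ.1 ξ.2 * b ξ.1 ξ.2 ≤ c * (ξ.1 : ℝ≥0) := by
  have hc' : 0 < √(c : ℝ) := Real.sqrt_pos.2 (by exact_mod_cast hc)
  filter_upwards [hb.tendsto.eventually (ge_mem_nhds hc')] with ξ h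
  have hn : 0 < √((ξ.1 : ℕ) : ℝ) := Real.sqrt_pos.2 (by exact_mod_cast ξ.1.pos)
  rw [div_le_iff₀ hn] at h
  have h2 := mul_self_le_mul_self (NNReal.coe_nonneg (b ξ.1 ξ.2)) h
  rw [mul_mul_mul_comm, Real.mul_self_sqrt (NNReal.coe_nonneg _),
    Real.mul_self_sqrt (Nat.cast_nonneg _)] at h2
  exact_mod_cast h2

/-- One weight is at most `K` and the other at most `b ≤ √n`, so the probability is at most `K / (θ
√n)`. The inequality is checked in squared form, which is where the bound on `M` comes from. -/
theorem eventually_truncProb_le (hA : AssumptionIR P θ φ a ν)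
    (hb : TendstoInProb P (fun n ω => (b n ω : ℝ) / √((n : ℕ) : ℝ)) (𝓝 0)) (K ρ : ℝ≥0)
    (hρ : 0 < ρ) : ∀ᶠ ξ in highProb P, ∀ u v, (a ξ.1 ξ.2 u).1 ≤ K →
      truncProb θ (b ξ.1 ξ.2) (fun j => (a ξ.1 ξ.2 j).1) u v ≤ ρ := by
  have hθ := hA.theta_pos
  obtain ⟨M, hM⟩ := exists_nat_ge (K * K / (θ * ρ * (θ * ρ)))
  filter_upwards [eventually_sq_le hb one_pos,
    tendsto_size_highProb.eventually_ge_atTop M] with ξ h1 h2 u v hu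
  have hn : 0 < (ξ.1 : ℝ≥0) := by exact_mod_cast ξ.1.pos
  rw [truncProb, div_le_iff₀ (mul_pos hθ hn)]
  have h3 : min (a ξ.1 ξ.2 u).1 (b ξ.1 ξ.2) * min (a ξ.1 ξ.2 v).1 (b ξ.1 ξ.2) ≤
      K * b ξ.1 ξ.2 := mul_le_mul' ((min_le_left _ _).trans hu) (min_le_right _ _)
  refine h3.trans ?_
  have h4 : K * K ≤ θ * ρ * (θ * ρ) * (ξ.1 : ℝ≥0) := by
    rw [div_le_iff₀ (by positivity)] at hM
    refine hM.trans ((mul_comm _ _).trans_le (mul_le_mul_right ?_ _))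
    exact_mod_cast h2
  refine (mul_self_le_mul_self_iff zero_le zero_le).2 ?_
  calc K * b ξ.1 ξ.2 * (K * b ξ.1 ξ.2) = K * K * (b ξ.1 ξ.2 * b ξ.1 ξ.2) := by ring
    _ ≤ θ * ρ * (θ * ρ) * (ξ.1 : ℝ≥0) * (1 * (ξ.1 : ℝ≥0)) := mul_le_mul' h4 h1
    _ = _ := by ring

theorem tendsto_deviation_IR (hA : AssumptionIR P θ φ a ν) (hb : TendstoInProb P b atTop)
    (hb' : TendstoInProb P (fun n ω => (b n ω : ℝ) / √((n : ℕ) : ℝ)) (𝓝 0))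
    (hφ : ∀ n, ∀ᵐ ω ∂P n, ∀ i j, i < j → -1 < φ n (a n ω i).1 (a n ω j).1 fun l => (a n ω l).1) :
    Tendsto (fun ξ : Σ n, Ω n => vertexMean (deviation
      (posEdgeProb θ (φ ξ.1) fun j => (a ξ.1 ξ.2 j).1)
      (truncProb θ (b ξ.1 ξ.2) fun j => (a ξ.1 ξ.2 j).1))) (highProb P) (𝓝 0) := by
  have hθ := hA.theta_pos
  have h2 : θ < 2 * θ := lt_mul_of_one_lt_left hθ one_lt_two
  have h1 : Tendsto (fun ξ : Σ n, Ω n => ENNReal.ofReal (edgeError θ (φ ξ.1) fun i =>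
      (a ξ.1 ξ.2 i).1)) (highProb P) (𝓝 0) := by
    have := (ENNReal.continuous_ofReal.tendsto 0).comp hA.edges.tendsto
    rwa [ENNReal.ofReal_zero] at this
  -- The constant 4 is `2 * (2 * θ) / θ`, the mean weight being eventually at most `2 * θ`.
  have h3 : Tendsto (fun ξ : Σ n, Ω n => ((4 * ((∑ u, ((a ξ.1 ξ.2 u).1 -
      min (a ξ.1 ξ.2 u).1 (b ξ.1 ξ.2))) / (ξ.1 : ℝ≥0)) : ℝ≥0) : ℝ≥0∞)) (highProb P) (𝓝 0) := by
    rw [← ENNReal.coe_zero, ENNReal.tendsto_coe]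
    have := (tendsto_truncation hA hb).const_mul 4
    rwa [mul_zero] at this
  have h4 := h1.add h3
  rw [add_zero] at h4
  refine tendsto_of_tendsto_of_tendsto_of_le_of_le' tendsto_const_nhds h4
    (Eventually.of_forall fun _ => zero_le) ?_
  filter_upwards [eventually_sq_le hb' hθ, (tendsto_meanWeight hA).eventually (ge_mem_nhds h2),
    eventually_highProb_of_ae (p := fun ξ => ∀ i j, i < j →
      -1 < φ ξ.1 (a ξ.1 ξ.2 i).1 (a ξ.1 ξ.2 j).1 fun l => (a ξ.1 ξ.2 l).1) hφ] with ξ g1 g2 g3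
  rw [posEdgeProb_eq g3]
  refine (vertexMean_deviation_le ξ.1.ne_zero hθ _ g1).trans (add_le_add le_rfl ?_)
  rw [vertexMean_coe ξ.1.ne_zero, vertexMean_coe ξ.1.ne_zero, ← ENNReal.coe_ofNat, ← ENNReal.coe_mul,
    ← ENNReal.coe_mul, ← ENNReal.coe_div hθ.ne', ENNReal.coe_le_coe, div_le_iff₀ hθ]
  refine (mul_le_mul_right g2 _).trans (le_of_eq ?_)
  ring

theorem exists_goodTrees_IR (hA : AssumptionIR P θ φ a ν) (hb : TendstoInProb P b atTop)
    (hb' : TendstoInProb P (fun n ω => (b n ω : ℝ) / √((n : ℕ) : ℝ)) (𝓝 0))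
    (hφ : ∀ n, ∀ᵐ ω ∂P n, ∀ i j, i < j → -1 < φ n (a n ω i).1 (a n ω j).1 fun l => (a n ω l).1)
    (k : ℕ) {ε : ℝ≥0∞} (hε : 0 < ε) : ∃ (c : ℝ≥0∞) (T : Finset (List ℕ)), c ≤ 1 ∧
      1 - c ^ (2 * T.card) ≤ ε ∧ ∀ᶠ ξ in highProb P,
        treeLaw (labelLawIR (poissonMean θ (b ξ.1 ξ.2) fun j => (a ξ.1 ξ.2 j).1)
            fun _ => ((ξ.1 : ℕ) : ℝ≥0∞)⁻¹)
          (labelLawIR (poissonMean θ (b ξ.1 ξ.2) fun j => (a ξ.1 ξ.2 j).1)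
            (sizeBias fun j => min (a ξ.1 ξ.2 j).1 (b ξ.1 ξ.2)))
          (goodTrees k c T (posEdgeProb θ (φ ξ.1) fun j => (a ξ.1 ξ.2 j).1)
            (poissonMean θ (b ξ.1 ξ.2) fun j => (a ξ.1 ξ.2 j).1)
            (sizeBias fun j => min (a ξ.1 ξ.2 j).1 (b ξ.1 ξ.2)))ᶜ ≤ ε := by
  have hn0 : ∀ ξ : Σ n, Ω n, (ξ.1 : ℕ) ≠ 0 := fun ξ => ξ.1.ne_zero
  have hW := uniformTail_IR hA
  have hm : ∃ C : ℝ≥0, ∀ᶠ ξ in highProb P, ∀ u,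
      poissonMean θ (b ξ.1 ξ.2) (fun j => (a ξ.1 ξ.2 j).1) u ≤ C * (a ξ.1 ξ.2 u).1 :=
    ⟨2, eventually_poissonMean_le hA⟩
  have h₀ := tightLabels_labelLawIR (𝓕 := highProb P) (N := fun ξ => (ξ.1 : ℕ))
    (W := fun ξ u => (a ξ.1 ξ.2 u).1) (q := fun ξ _ => ((ξ.1 : ℕ) : ℝ≥0∞)⁻¹)
    (m := fun ξ => poissonMean θ (b ξ.1 ξ.2) fun j => (a ξ.1 ξ.2 j).1)
    (fun ξ => sum_inv_natCast (hn0 ξ)) ⟨1, Eventually.of_forall fun ξ u => by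
      rw [ENNReal.coe_one, one_mul, ← one_div]
      exact ENNReal.div_le_div_right le_self_add _⟩ hm
  have h₁ := tightLabels_labelLawIR (𝓕 := highProb P) (N := fun ξ => (ξ.1 : ℕ))
    (W := fun ξ u => (a ξ.1 ξ.2 u).1)
    (q := fun ξ => sizeBias fun j => min (a ξ.1 ξ.2 j).1 (b ξ.1 ξ.2))
    (m := fun ξ => poissonMean θ (b ξ.1 ξ.2) fun j => (a ξ.1 ξ.2 j).1)
    (fun ξ => sum_sizeBias (hn0 ξ) _) ⟨_, eventually_sizeBias_le hA hb⟩ hm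
  have hε4 : 0 < ε / 4 := ENNReal.div_pos hε.ne' (by norm_num)
  obtain ⟨T, hT⟩ := exists_nodes_subset h₀ h₁ hW (k + 1) hε4
  -- With the finite set `T` fixed, the total loss in the comparison tends to zero as `δ` does.
  obtain ⟨δ, ⟨hδ1, hδ2⟩, hδ0⟩ : ∃ δ : ℝ, (1 - ENNReal.ofReal (1 - δ) ^ (2 * T.card) ≤ ε ∧ δ < 1) ∧
      0 < δ := by
    have hcont : Continuous fun δ : ℝ => 1 - ENNReal.ofReal (1 - δ) ^ (2 * T.card) :=
      (ENNReal.continuous_sub_left ENNReal.one_ne_top).comp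
        ((ENNReal.continuous_pow _).comp (ENNReal.continuous_ofReal.comp (by fun_prop)))
    have hlim := hcont.tendsto 0
    simp only [sub_zero, ENNReal.ofReal_one, one_pow, tsub_self] at hlim
    have hev := (hlim.eventually (ge_mem_nhds hε)).and (Iio_mem_nhds (zero_lt_one' ℝ))
    exact ((hev.filter_mono (nhdsWithin_le_nhds (s := Set.Ioi 0))).and
      self_mem_nhdsWithin).exists
  refine ⟨ENNReal.ofReal (1 - δ), T, ENNReal.ofReal_le_one.2 (by linarith), hδ1, ?_⟩
  have hgood := goodTrees_compl_le (𝓕 := highProb P) (N := fun ξ => (ξ.1 : ℕ))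
      (W := fun ξ u => (a ξ.1 ξ.2 u).1)
      (m := fun ξ => poissonMean θ (b ξ.1 ξ.2) fun j => (a ξ.1 ξ.2 j).1)
      (q := fun ξ => sizeBias fun j => min (a ξ.1 ξ.2 j).1 (b ξ.1 ξ.2))
      (r := fun ξ => truncProb θ (b ξ.1 ξ.2) fun j =>
      (a ξ.1 ξ.2 j).1) (p := fun ξ => posEdgeProb θ (φ ξ.1) fun j => (a ξ.1 ξ.2 j).1)
      h₀ h₁ hW tendsto_size_highProb (fun ξ u w => le_max_left _ _)
      (fun ξ u w => max_le zero_le_one (edgeProb_le_one _ _ _))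
      (fun ξ u => (sum_truncProb _ _ _).le) hm (eventually_truncProb_le hA hb')
      (fun ξ u => labelLawIR_label _ _ _)
      (fun ξ u l => ⟨labelLawIR_offspring_le _ _ _ _, labelLawIR_offspring_le _ _ _ _⟩)
      (fun ξ u w => truncProb_eq _ _ _ _) (tendsto_deviation_IR hA hb hb' hφ) hδ0 hδ2 k T hε4
  filter_upwards [hT, hgood] with ξ g1 g2
  refine g2.trans ((add_le_add g1 le_rfl).trans (le_of_eq ?_))
  calc ε / 4 + 3 * (ε / 4) = 4 * (ε / 4) := by ring
    _ = ε := ENNReal.mul_div_cancel (by norm_num) (by norm_num)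

end AsymptoticsIR

/-! ### Conclusion for the inhomogeneous random graph. -/

section TreeCouplingIR

theorem measure_not_matches_le_add {𝒢 : Type*} [MeasurableSpace 𝒢] [Countable 𝒢]
    [DiscreteMeasurableSpace 𝒢] {n : ℕ} {μ : Measure (𝒢 × TreeData (Fin n))}
    [IsProbabilityMeasure μ] {ν : Measure (TreeData (Fin n))} [IsProbabilityMeasure ν]
    (e : 𝒢 → Fin n → Fin n → ℕ) (k : ℕ) (v : Fin n) {s : Set (TreeData (Fin n))} {c : ℝ≥0∞}
    (hc : c ≤ 1) (h : c * ν s ≤ μ {y | Matches k (e y.1) v y.2}) :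
    μ {y | ¬ Matches k (e y.1) v y.2} ≤ (1 - c) + ν sᶜ := by
  have hm : MeasurableSet {y : 𝒢 × TreeData (Fin n) | Matches k (e y.1) v y.2} :=
    measurable_prodMk_left (measurableSet_matches_prod e k)
  refine (prob_compl_eq_one_sub hm).le.trans (tsub_le_iff_right.2 ?_)
  have h1 : 1 ≤ ν s + ν sᶜ := by
    rw [← measure_univ (μ := ν), ← Set.union_compl_self s]
    exact measure_union_le _ _
  calc (1 : ℝ≥0∞) = (1 - c) + c * 1 := by rw [mul_one, tsub_add_cancel_of_le hc]
    _ ≤ (1 - c) + c * (ν s + ν sᶜ) := by gcongr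
    _ = (1 - c) + c * ν sᶜ + c * ν s := by ring
    _ ≤ (1 - c) + ν sᶜ + μ {y | Matches k (e y.1) v y.2} :=
        add_le_add (add_le_add le_rfl (mul_le_of_le_one_left' hc)) h

theorem measurable_sizeBias {Θ : Type*} [MeasurableSpace Θ] {n : ℕ} {w : Θ → Fin n → ℝ≥0}
    (hw : ∀ j, Measurable fun x => w x j) (i : Fin n) : Measurable fun x => sizeBias (w x) i := by
  have hsum : Measurable fun x => ∑ j, w x j := Finset.measurable_sum _ fun j _ => hw j
  refine Measurable.ite (hsum (measurableSet_singleton 0)) measurable_const ?_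
  exact ((hw i).div hsum).coe_nnreal_ennreal

variable {Ω : ℕ+ → Type*} {S : Type*} [∀ n, MeasurableSpace (Ω n)] [MetricSpace S]
  [MeasurableSpace S] {P : ∀ n, Measure (Ω n)} {θ : ℝ≥0}
  {φ : ∀ n : ℕ+, ℝ≥0 → ℝ≥0 → (Fin (n : ℕ) → ℝ≥0) → ℝ} {a : ∀ n, Ω n → Fin (n : ℕ) → ℝ≥0 × S}
  {ν : Measure (ℝ≥0 × S)} {b : ∀ n, Ω n → ℝ≥0}

theorem existsTreeCoupling_IR [TopologicalSpace.SeparableSpace S] [BorelSpace S]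
    [∀ n, IsProbabilityMeasure (P n)] {G : ∀ n, Ω n → SimpleGraph (Fin (n : ℕ))}
    {I : ∀ n, Ω n → Fin (n : ℕ)} (hG : ∀ n, IsIR (P n) θ (φ n) (a n) (G n) (I n))
    (hA : AssumptionIR P θ φ a ν) (hbm : ∀ n, Measurable[attrSigma (a n)] (b n))
    (hb : TendstoInProb P b atTop)
    (hb' : TendstoInProb P (fun n ω => (b n ω : ℝ) / √((n : ℕ) : ℝ)) (𝓝 0)) :
    ExistsTreeCoupling P a (fun n ω => simpleMult (G n ω)) I
      (fun n ω => rootLawIR θ (b n ω) (a n ω)) (fun n ω => nodeLawIR θ (b n ω) (a n ω)) := by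
  have : SecondCountableTopology S := UniformSpace.secondCountable_of_separable S
  have hn0 : ∀ n : ℕ+, (n : ℕ) ≠ 0 := fun n => n.ne_zero
  -- The truncation level is a measurable function of the attributes, so all laws become kernels on
  -- the space of attributes.
  choose β hβ hbβ using fun n => (hbm n).exists_eq_measurable_comp
  obtain rfl : b = fun n ω => β n (a n ω) := funext hbβ
  let wt : ∀ n : ℕ+, (Fin (n : ℕ) → ℝ≥0 × S) → Fin (n : ℕ) → ℝ≥0 := fun n α i => (α i).1
  have hwt : ∀ n i, Measurable fun α => wt n α i := fun n i =>
    measurable_fst.comp (measurable_pi_apply i)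
  let p : ∀ n : ℕ+, (Fin (n : ℕ) → ℝ≥0 × S) → Fin (n : ℕ) → Fin (n : ℕ) → ℝ :=
    fun n α => posEdgeProb θ (φ n) (wt n α)
  let m : ∀ n : ℕ+, (Fin (n : ℕ) → ℝ≥0 × S) → Fin (n : ℕ) → ℝ≥0 :=
    fun n α => poissonMean θ (β n α) (wt n α)
  let q : ∀ n : ℕ+, (Fin (n : ℕ) → ℝ≥0 × S) → Fin (n : ℕ) → ℝ≥0∞ :=
    fun n α => sizeBias fun j => min (wt n α j) (β n α)
  have hp0 : ∀ n α i j, 0 ≤ p n α i j := fun n α i j => le_max_left _ _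
  have hp1 : ∀ n α i j, p n α i j ≤ 1 := fun n α i j =>
    max_le zero_le_one (edgeProb_le_one _ _ _)
  have hpm : ∀ n i j, Measurable fun α => p n α i j := fun n i j =>
    measurable_const.max ((measurable_edgeProb (hG n).measurable_φ i j).comp
      (measurable_pi_lambda _ (hwt n)))
  have hmin : ∀ n j, Measurable fun α => min (wt n α j) (β n α) := fun n j => (hwt n j).min (hβ n)
  have hmm : ∀ n j, Measurable fun α => m n α j := fun n j =>
    ((Finset.measurable_sum _ fun i _ => hmin n i).mul (hmin n j)).div_const _
  have hqm : ∀ n j, Measurable fun α => q n α j := fun n j => measurable_sizeBias (hmin n) j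
  have hq1 : ∀ n α, ∑ j, q n α j = 1 := fun n α => sum_sizeBias (hn0 n) _
  choose π hπ1 hπ2 hπ3 hπ4 using fun (k : ℕ) (n : ℕ+) => exists_coupling_IR (hpm n) (hp0 n) (hp1 n)
    (fun α i j => congrArg (max 0) (edgeProb_comm (wt n α) i j)) (hmm n) (hqm n) (hq1 n) k
  have hgraph : ∀ n α, IsProbabilityMeasure (graphLaw (p n α)) := fun n α =>
    isProbabilityMeasure_graphLaw (hp0 n α) (hp1 n α)
  let Γ : ∀ n : ℕ+, Kernel (Fin (n : ℕ) → ℝ≥0 × S) (SimpleGraph (Fin (n : ℕ))) := fun n =>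
    ⟨fun α => graphLaw (p n α), measurable_graphLaw (hpm n)⟩
  have hΓ : ∀ n, IsMarkovKernel (Γ n) := fun n => ⟨hgraph n⟩
  have hnode : ∀ (n : ℕ+) (α : Fin (n : ℕ) → ℝ≥0 × S),
      IsProbabilityMeasure (labelLawIR (m n α) (q n α)) :=
    fun n α => isProbabilityMeasure_labelLawIR _ (hq1 n α)
  have hGm : ∀ n, Measurable (G n) := fun n => measurable_to_countable' (hG n).measurable_G
  have hem : ∀ n, Measurable fun ω => simpleMult (G n ω) := fun n =>
    (Measurable.of_discrete (f := fun H : SimpleGraph (Fin (n : ℕ)) => simpleMult H)).comp (hGm n)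
  refine existsTreeCoupling_of_tendsto (fun n => (hG n).measurable_a)
    (fun k n => measurableSet_notIso k (hem n) (hG n).measurable_a (hG n).measurable_I)
    (δ := fun k n => ∫⁻ ω, ∑ v, (n : ℝ≥0∞)⁻¹ *
      π k n (a n ω, v) {y | ¬ Matches k (simpleMult y.1) v y.2} ∂P n)
    (fun k => ?_) fun k n => ?_
  · refine tendsto_lintegral_of_highProb (f := fun ξ => ∑ v, (ξ.1 : ℝ≥0∞)⁻¹ *
      π k ξ.1 (a ξ.1 ξ.2, v) {y | ¬ Matches k (simpleMult y.1) v y.2}) (fun ξ => ?_) fun ε hε => ?_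
    · rw [← sum_inv_natCast (hn0 ξ.1)]
      have := hπ1 k ξ.1
      exact Finset.sum_le_sum fun v _ => mul_le_of_le_one_right' prob_le_one
    · obtain ⟨c, T, hc1, hcε, hT⟩ := exists_goodTrees_IR hA hb hb' (fun n => (hG n).phi_gt) k
        (ENNReal.half_pos hε.ne')
      filter_upwards [hT] with ξ hξ
      have := hπ1 k ξ.1
      let α := a ξ.1 ξ.2
      let bad : Set (TreeData (Fin (ξ.1 : ℕ))) :=
        (goodTrees k c T (p ξ.1 α) (m ξ.1 α) (q ξ.1 α))ᶜ
      have hmix := congrArg (fun μ : Measure (TreeData (Fin (ξ.1 : ℕ))) => μ bad)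
        (sum_smul_treeLaw (hn0 ξ.1) (labelRootIR (m ξ.1 α)) (labelLawIR (m ξ.1 α) (q ξ.1 α)))
      simp only [Measure.finsetSum_apply, Measure.smul_apply, smul_eq_mul] at hmix
      calc ∑ v, ((ξ.1 : ℕ) : ℝ≥0∞)⁻¹ * π k ξ.1 (α, v) {y | ¬ Matches k (simpleMult y.1) v y.2}
          ≤ ∑ v, ((ξ.1 : ℕ) : ℝ≥0∞)⁻¹ * ((1 - c ^ (2 * T.card)) +
              treeLaw (labelRootIR (m ξ.1 α) v) (labelLawIR (m ξ.1 α) (q ξ.1 α)) bad) :=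
            Finset.sum_le_sum fun v _ => mul_le_mul_right (measure_not_matches_le_add simpleMult k v
              (pow_le_one' hc1 _) (hπ4 k ξ.1 (α, v) c T hc1)) _
        _ = (1 - c ^ (2 * T.card)) + treeLaw (labelLawIR (m ξ.1 α) fun _ => ((ξ.1 : ℕ) : ℝ≥0∞)⁻¹)
              (labelLawIR (m ξ.1 α) (q ξ.1 α)) bad := by
            simp only [mul_add, Finset.sum_add_distrib, ← Finset.sum_mul,
              sum_inv_natCast (hn0 ξ.1), one_mul]
            exact congrArg _ hmix
        _ ≤ ε / 2 + ε / 2 := add_le_add hcε hξ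
        _ = ε := ENNReal.add_halves ε
  · have := hπ1 k n
    refine exists_isTreeCoupling (Γ := Γ n) (π := π k n) (hn0 n) (hG n).measurable_a
      (hGm n) (hG n).measurable_I (fun v H => ?_) (fun x => hπ2 k n x)
      (root := fun α v => labelRootIR (m n α) v) (node := fun α => labelLawIR (m n α) (q n α))
      (fun α v => ?_) (fun x => hπ3 k n x) (fun ω => ?_) (fun ω => ?_) simpleMult k
    · refine ((hG n).law v H).trans ?_
      filter_upwards [(hG n).phi_gt] with ω hω
      change _ = (n : ℝ)⁻¹ * (graphLaw (p n (a n ω)) {H}).toReal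
      -- Clipping the probabilities at zero made `graphLaw` a probability measure for all
      -- attributes; almost surely it changes nothing.
      have hpe : p n (a n ω) = edgeProb θ (φ n) fun i => (a n ω i).1 := posEdgeProb_eq hω
      rw [graphLaw_singleton,
        ENNReal.toReal_ofReal (bernoulliGraphProb_nonneg (hp0 n _) (hp1 n _) H), hpe]
    · rw [labelRootIR, Measure.map_apply Measurable.of_discrete MeasurableSet.of_discrete]
      simp
    · rw [map_sum_smul _ _ Measurable.of_discrete, rootLawIR]
      refine Finset.sum_congr rfl fun v _ => ?_
      rw [labelRootIR, Measure.map_map Measurable.of_discrete Measurable.of_discrete]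
      rfl
    · rw [labelLawIR, map_sum_smul _ _ Measurable.of_discrete, nodeLawIR]
      refine Finset.sum_congr rfl fun v _ => ?_
      rw [Measure.map_map Measurable.of_discrete Measurable.of_discrete]
      rfl

end TreeCouplingIR

end GraphCoupling

theorem theorem3 {S : Type*} [MetricSpace S] [TopologicalSpace.SeparableSpace S]
    [MeasurableSpace S] [BorelSpace S] {Ω : ℕ+ → Type*} [∀ n, MeasurableSpace (Ω n)]
    (P : ∀ n, Measure (Ω n)) [∀ n, IsProbabilityMeasure (P n)] :
    -- configuration model
    (∀ (pick : ∀ (n : ℕ+) (d : Fin (n : ℕ) → ℕ), GraphCoupling.PickRule d)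
        (a : ∀ n, Ω n → Fin (n : ℕ) → ℕ × S)
        (G : ∀ n, Ω n → Fin (n : ℕ) → Fin (n : ℕ) → ℕ) (I : ∀ n, Ω n → Fin (n : ℕ))
        (ν : Measure (ℕ × S)) [IsProbabilityMeasure ν],
        (∀ n, GraphCoupling.IsCM (P n) (pick n) (a n) (G n) (I n)) →
        GraphCoupling.AssumptionCM P a ν →
        GraphCoupling.ExistsTreeCoupling P a G I
          (fun n ω => GraphCoupling.rootLawCM (a n ω))
          (fun n ω => GraphCoupling.nodeLawCM (a n ω))) ∧
    -- inhomogeneous random graph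
    (∀ (θ : ℝ≥0) (φ : ∀ n : ℕ+, ℝ≥0 → ℝ≥0 → (Fin (n : ℕ) → ℝ≥0) → ℝ)
        (a : ∀ n, Ω n → Fin (n : ℕ) → ℝ≥0 × S)
        (G : ∀ n, Ω n → SimpleGraph (Fin (n : ℕ))) (I : ∀ n, Ω n → Fin (n : ℕ))
        (ν : Measure (ℝ≥0 × S)) [IsProbabilityMeasure ν] (b : ∀ n, Ω n → ℝ≥0),
        (∀ n, GraphCoupling.IsIR (P n) θ (φ n) (a n) (G n) (I n)) →
        GraphCoupling.AssumptionIR P θ φ a ν →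
        (∀ n, Measurable[GraphCoupling.attrSigma (a n)] (b n)) →
        GraphCoupling.TendstoInProb P b atTop →
        GraphCoupling.TendstoInProb P (fun n ω => (b n ω : ℝ) / √((n : ℕ) : ℝ)) (𝓝 0) →
        GraphCoupling.ExistsTreeCoupling P a
          (fun n ω => GraphCoupling.simpleMult (G n ω)) I
          (fun n ω => GraphCoupling.rootLawIR θ (b n ω) (a n ω))
          (fun n ω => GraphCoupling.nodeLawIR θ (b n ω) (a n ω))) := by
  refine ⟨fun pick a G I ν _ hG hA => ?_, fun θ φ a G I ν _ b hG hA hbm hb hb' => ?_⟩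
  · exact GraphCoupling.existsTreeCoupling_CM pick hG hA
  · exact GraphCoupling.existsTreeCoupling_IR hG hA hbm hb hb'
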